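/- **Setting.** Let $\alpha^1,\alpha^2,\alpha^3,\beta$ be the standard $4\times4$ Dirac matrices, $\alpha^k=\begin{pmatrix}0&\sigma^k\\ \sigma^k&0\end{pmatrix}$, $\beta=\begin{pmatrix}\mathbb I_2&0\\0&-\mathbb I_2\end{pmatrix}$, with $\sigma^k$ the Pauli matrices. Let $H^{1/2}=H^{1/2}(\mathbb R^3;\mathbb C^4)$ with scalar product $\langle f|g\rangle_{H^{1/2}}=\int_{\mathbb R^3}\sqrt{|p|^2+1}\,(\hat f(p),\hat g(p))\,dp$, where $\hat{\ }$ is the unitary Fourier transform and $(\cdot,\cdot)$ the Hermitian product of $\mathbb C^4$. Let $\Lambda_\pm$ be the orthogonal projectors onto the positive/negative spectral subspaces of $D=i\boldsymbol\alpha\cdot\nabla-\beta$, write $\psi_\pm=\Lambda_\pm\psi$ and $X_\pm=\Lambda_\pm H^{1/2}$. Put $\rho_\psi=|\psi|^2$, $J_\psi=(\psi,\boldsymbol\alpha\psi)$, $\gamma_K=\pi/2$, and let $e\in\mathbb R$ satisfy $e^2\gamma_K<\frac1{87}$. For $m\in(0,1]$ and $\psi\in H^{1/2}$ let $$\mathcal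 I^{(m)}(\psi)=\|\psi_+\|_{H^{1/2}}^2-\|\psi_-\|_{H^{1/2}}^2-m\frac{e^2}{2}\int_{\mathbb R^3\times\mathbb R^3}\frac{\rho_\psi(x)\rho_\psi(y)-J_\psi(x)\cdot J_\psi(y)}{|x-y|}\,dx\,dy .$$ Let $\Sigma=\{\psi\in H^{1/2}:\|\psi\|_{L^2}=1\}$ and $\Sigma_+=\Sigma\cap X_+$. For $w\in\Sigma_+$ let $W=\mathrm{span}_{\mathbb C}\{w\}$, $\mathcal X_W=\{\psi\in\Sigma:\psi_+\in W\}$ and $\lambda_W(m)=\sup_{\mathcal X_W}\mathcal I^{(m)}$. **Proposition.** Let $m\in(0,1]$. For every $w\in\Sigma_+$ there is $\psi=\psi^{(m)}(w)\in\mathcal X_W$ with $\mathcal I^{(m)}(\psi)=\max_{\mathcal X_W}\mathcal I^{(m)}=\lambda_W(m)$, and it is the strict global maximizer up to a phase: $\mathcal I^{(m)}(\phi)<\mathcal I^{(m)}(\psi)$ for every $\phi\in\mathcal X_W$ that is not of the form $c\,\psi$ with $c\in\mathbb C$, $|c|=1$. The phase is fixed by $\psi_+=(1-\|\psi_-\|_{L^2}^2)^{1/2}\,w$.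 Moreover $\mathcal I^{(m)}$ is (real) Fréchet differentiable at $\psi$ and there is $\omega=\omega(\psi)\in\mathbb R$ with $$d\mathcal I^{(m)}(\psi)[h]-2\omega\,\mathrm{Re}\,\langle\psi|h\rangle_{L^2}=0\qquad\text{for all }h\in W\oplus X_-,$$ and the following hold: (i) $0<\omega\le\lambda_W(m)$ and $\|\psi_+\|_{L^2}^2>\|\psi_-\|_{L^2}^2$; (ii) $\|\psi_+\|_{H^{1/2}}^2-\|\psi_-\|_{H^{1/2}}^2\ge1$; (iii) $\|\psi_-\|_{H^{1/2}}^2\le m\,\frac{e^2}{2}\,\gamma_K\,\|w\|_{H^{1/2}}^2$; (iv) the map $v\mapsto\psi^{(m)}\big(v/\|v\|_{L^2}\big)$ from $X_+\setminus\{0\}$ to $H^{1/2}$ is $C^\infty$ (over $\mathbb R$, with respect to the $H^{1/2}$ norms). -/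

import Mathlib

open MeasureTheory
open scoped FourierTransform ContDiff

namespace MaxwellDirac

noncomputable section

/-- Physical (and momentum) space `ℝ³`. -/
abbrev R3 : Type := EuclideanSpace ℝ (Fin 3)

/-- Spinor space `ℂ⁴` with its Hermitian scalar product. -/
abbrev C4 : Type := EuclideanSpace ℂ (Fin 4)

/-- `L²(ℝ³; ℂ⁴)`. -/
abbrev L2 : Type := Lp C4 2 (volume : Measure R3)

/-- `λ(p) = √(|p|² + 1)` at the momentum `p = 2πξ`, where `ξ` is the variable of Mathlib's Fourier
transform `𝓕 u ξ = ∫ exp(-2πi x·ξ) u(x) dx`. -/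
def lam (ξ : R3) : ℝ := √((2 * Real.pi * ‖ξ‖) ^ 2 + 1)

lemma lam_pos (ξ : R3) : 0 < lam ξ := Real.sqrt_pos.2 (by positivity)

lemma continuous_lam : Continuous lam := by unfold lam; fun_prop

/-! ### The space `H^{1/2}(ℝ³; ℂ⁴)` -/

/-- The elements of `H^{1/2}`: the `f ∈ L²` with `λ(p)^{1/2} f̂ ∈ L²`. -/
def halfSubmodule : Submodule ℂ L2 where
  carrier := {f | MemLp (fun ξ => √(lam ξ) • (𝓕 f : L2) ξ) 2 (volume : Measure R3)}
  zero_mem' := by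
    have h0 : (𝓕 (0 : L2) : L2) = 0 := (Lp.fourierTransformₗᵢ R3 C4).map_zero
    have h : (fun _ => (0 : C4)) =ᵐ[(volume : Measure R3)]
        fun ξ => √(lam ξ) • (𝓕 (0 : L2) : L2) ξ := by
      rw [h0]
      filter_upwards [Lp.coeFn_zero C4 2 (volume : Measure R3)] with ξ hξ
      rw [hξ, Pi.zero_apply, smul_zero]
    exact (memLp_congr_ae h).1 MemLp.zero'
  add_mem' := by
    intro f g hf hg
    refine (memLp_congr_ae ?_).1 (MemLp.add hf hg)
    rw [FourierTransform.fourier_add]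
    filter_upwards [Lp.coeFn_add (𝓕 f : L2) (𝓕 g : L2)] with ξ hξ
    rw [hξ, Pi.add_apply, Pi.add_apply, smul_add]
  smul_mem' := by
    intro c f hf
    refine (memLp_congr_ae ?_).1 (MemLp.const_smul hf c)
    rw [FourierTransform.fourier_smul]
    filter_upwards [Lp.coeFn_smul c (𝓕 f : L2)] with ξ hξ
    simp only [Pi.smul_apply, hξ]
    rw [smul_comm]

/-- The Sobolev space `H^{1/2}(ℝ³; ℂ⁴)`. It is a separate type, since it carries the `H^{1/2}`
norm and not the `L²` norm. -/
def Hhalf : Type := halfSubmodule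

instance : AddCommGroup Hhalf := inferInstanceAs (AddCommGroup halfSubmodule)

instance : Module ℂ Hhalf := inferInstanceAs (Module ℂ halfSubmodule)

/-- The inclusion `H^{1/2} ⊆ L²`. -/
def toL2 : Hhalf →ₗ[ℂ] L2 := halfSubmodule.subtype

lemma toL2_injective : Function.Injective toL2 := Subtype.val_injective

/-- The map `f ↦ λ^{1/2} f̂` from `H^{1/2}` to `L²`. -/
def weightedFourier : Hhalf →ₗ[ℂ] L2 where
  toFun f := MemLp.toLp (fun ξ => √(lam ξ) • (𝓕 (toL2 f) : L2) ξ) f.2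
  map_add' := by
    intro f g
    apply Lp.ext
    refine (MemLp.coeFn_toLp _).trans ?_
    have h : (𝓕 (toL2 (f + g)) : L2) = 𝓕 (toL2 f) + 𝓕 (toL2 g) := by
      rw [map_add, FourierTransform.fourier_add]
    rw [h]
    filter_upwards [Lp.coeFn_add (𝓕 (toL2 f) : L2) (𝓕 (toL2 g) : L2),
      Lp.coeFn_add (MemLp.toLp (fun ξ => √(lam ξ) • (𝓕 (toL2 f) : L2) ξ) f.2)
        (MemLp.toLp (fun ξ => √(lam ξ) • (𝓕 (toL2 g) : L2) ξ) g.2),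
      MemLp.coeFn_toLp f.2, MemLp.coeFn_toLp g.2] with ξ h1 h2 h3 h4
    rw [h1, h2, Pi.add_apply, Pi.add_apply, smul_add]
    exact congrArg₂ (· + ·) h3.symm h4.symm
  map_smul' := by
    intro c f
    apply Lp.ext
    refine (MemLp.coeFn_toLp _).trans ?_
    have h : (𝓕 (toL2 (c • f)) : L2) = c • 𝓕 (toL2 f) := by
      rw [map_smul, FourierTransform.fourier_smul]
    rw [h]
    filter_upwards [Lp.coeFn_smul c (𝓕 (toL2 f) : L2),
      Lp.coeFn_smul c (MemLp.toLp (fun ξ => √(lam ξ) • (𝓕 (toL2 f) : L2) ξ) f.2),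
      MemLp.coeFn_toLp f.2] with ξ h1 h2 h3
    rw [h1, RingHom.id_apply, h2, Pi.smul_apply, Pi.smul_apply, smul_comm]
    exact congrArg (c • ·) h3.symm

lemma weightedFourier_injective : Function.Injective weightedFourier := by
  rw [injective_iff_map_eq_zero]
  intro f hf
  apply toL2_injective
  apply (Lp.fourierTransformₗᵢ R3 C4).injective
  rw [map_zero, map_zero]
  have h1 : weightedFourier f =ᵐ[volume] fun ξ => √(lam ξ) • (𝓕 (toL2 f) : L2) ξ :=
    MemLp.coeFn_toLp f.2
  rw [hf] at h1
  apply Lp.ext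
  filter_upwards [h1, Lp.coeFn_zero C4 2 (volume : Measure R3)] with ξ h2 h3
  rw [h3] at h2
  rw [h3]
  exact (smul_eq_zero.1 h2.symm).resolve_left (Real.sqrt_pos.2 (lam_pos ξ)).ne'

instance : NormedAddCommGroup Hhalf :=
  NormedAddCommGroup.induced Hhalf L2 weightedFourier weightedFourier_injective

/-- The scalar product `⟨f | g⟩_{H^{1/2}} = ∫ λ(p) (f̂(p), ĝ(p)) dp`. -/
instance : InnerProductSpace ℂ Hhalf where
  toNormedSpace := NormedSpace.induced ℂ Hhalf L2 weightedFourier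
  inner f g := inner ℂ (weightedFourier f) (weightedFourier g)
  norm_sq_eq_re_inner f := norm_sq_eq_re_inner (𝕜 := ℂ) (weightedFourier f)
  conj_inner_symm f g := inner_conj_symm _ _
  add_left f g h := by rw [map_add, inner_add_left]
  smul_left f g c := by rw [map_smul, inner_smul_left]

/-! ### The Dirac operator `D = iα·∇ - β` and its spectral projectors -/

/-- The Dirac matrices `α¹, α², α³`. -/
def alpha : Fin 3 → Matrix (Fin 4) (Fin 4) ℂ :=
  ![!![0, 0, 0, 1; 0, 0, 1, 0; 0, 1, 0, 0; 1, 0, 0, 0],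
    !![0, 0, 0, -Complex.I; 0, 0, Complex.I, 0; 0, -Complex.I, 0, 0; Complex.I, 0, 0, 0],
    !![0, 0, 1, 0; 0, 0, 0, -1; 1, 0, 0, 0; 0, -1, 0, 0]]

/-- The Dirac matrix `β`. -/
def beta : Matrix (Fin 4) (Fin 4) ℂ := Matrix.diagonal ![1, 1, -1, -1]

/-- A `4 × 4` matrix as an operator on spinors. -/
abbrev op (M : Matrix (Fin 4) (Fin 4) ℂ) : C4 →L[ℂ] C4 := Matrix.toEuclideanCLM (𝕜 := ℂ) M

/-- The Fourier symbol `-(α·p) - β` of `D = iα·∇ - β`, at `p = 2πξ`. -/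
def diracSymbol (ξ : R3) : C4 →L[ℂ] C4 :=
  -(∑ k, ((2 * Real.pi * ξ k : ℝ) : ℂ) • op (alpha k)) - op beta

/-- For `s = ±1`, the symbol `½ (1 ± λ(p)⁻¹ D̂(p))` of the projector `Λ_±(D)`: the symbol of `D` is
Hermitian with eigenvalues `±λ(p)`, and this is the orthogonal projector onto the eigenspace
for `±λ(p)`. -/
def projSymbol (s : ℝ) (ξ : R3) : C4 →L[ℂ] C4 :=
  (1 / 2 : ℂ) • (ContinuousLinearMap.id ℂ C4 + ((s / lam ξ : ℝ) : ℂ) • diracSymbol ξ)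

lemma continuous_projSymbol (s : ℝ) : Continuous (projSymbol s) := by
  have h : Continuous fun ξ => s / lam ξ :=
    continuous_const.div continuous_lam fun ξ => (lam_pos ξ).ne'
  unfold projSymbol diracSymbol
  fun_prop

lemma exists_norm_projSymbol_le (s : ℝ) : ∃ C : ℝ, ∀ ξ, ‖projSymbol s ξ‖ ≤ C := by
  refine ⟨1 / 2 * (‖ContinuousLinearMap.id ℂ C4‖ +
    |s| * (∑ k, ‖op (alpha k)‖ + ‖op beta‖)), fun ξ => ?_⟩
  have hl := lam_pos ξ
  have h1 : 1 ≤ lam ξ := Real.one_le_sqrt.2 (by nlinarith [sq_nonneg (2 * Real.pi * ‖ξ‖)])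
  have hk : ∀ k, |2 * Real.pi * ξ k| ≤ lam ξ := by
    intro k
    have h2 : ‖ξ k‖ ≤ ‖ξ‖ := PiLp.norm_apply_le ξ k
    have h3 : |2 * Real.pi * ξ k| ≤ 2 * Real.pi * ‖ξ‖ := by
      rw [abs_mul, abs_of_pos Real.two_pi_pos]
      exact mul_le_mul_of_nonneg_left h2 Real.two_pi_pos.le
    refine h3.trans (Real.le_sqrt_of_sq_le ?_)
    linarith
  have hd : ‖diracSymbol ξ‖ ≤ lam ξ * (∑ k, ‖op (alpha k)‖ + ‖op beta‖) := by
    unfold diracSymbol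
    refine (norm_sub_le _ _).trans ?_
    rw [norm_neg, mul_add, Finset.mul_sum]
    refine add_le_add ((norm_sum_le _ _).trans (Finset.sum_le_sum fun k _ => ?_)) ?_
    · rw [norm_smul, Complex.norm_real, Real.norm_eq_abs]
      exact mul_le_mul_of_nonneg_right (hk k) (norm_nonneg _)
    · exact le_mul_of_one_le_left (norm_nonneg _) h1
  unfold projSymbol
  rw [norm_smul]
  have h2 : ‖(1 / 2 : ℂ)‖ = 1 / 2 := by norm_num
  rw [h2]
  refine mul_le_mul_of_nonneg_left ?_ (by norm_num)
  refine (norm_add_le _ _).trans (add_le_add le_rfl ?_)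
  rw [norm_smul, Complex.norm_real, Real.norm_eq_abs, abs_div, abs_of_pos hl]
  calc |s| / lam ξ * ‖diracSymbol ξ‖
      ≤ |s| / lam ξ * (lam ξ * (∑ k, ‖op (alpha k)‖ + ‖op beta‖)) :=
        mul_le_mul_of_nonneg_left hd (by positivity)
    _ = |s| * (∑ k, ‖op (alpha k)‖ + ‖op beta‖) := by field_simp

lemma memLp_projSymbol (s : ℝ) {g : R3 → C4} (hg : MemLp g 2 (volume : Measure R3)) :
    MemLp (fun ξ => projSymbol s ξ (g ξ)) 2 (volume : Measure R3) := by
  obtain ⟨C, hC⟩ := exists_norm_projSymbol_le s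
  refine MemLp.of_le_mul (c := C) hg ?_ ?_
  · exact isBoundedBilinearMap_apply.continuous.comp_aestronglyMeasurable
      ((continuous_projSymbol s).aestronglyMeasurable.prodMk hg.1)
  · exact Filter.Eventually.of_forall fun ξ => (projSymbol s ξ).le_of_opNorm_le (hC ξ) _

/-- Multiplication by `projSymbol s` on `L²` of momentum space. -/
def symbolMul (s : ℝ) : L2 →ₗ[ℂ] L2 where
  toFun g := MemLp.toLp (fun ξ => projSymbol s ξ (g ξ)) (memLp_projSymbol s (Lp.memLp g))
  map_add' := by
    intro f g
    rw [← MemLp.toLp_add]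
    apply MemLp.toLp_congr
    filter_upwards [Lp.coeFn_add f g] with ξ h
    rw [h, Pi.add_apply, Pi.add_apply, map_add]
  map_smul' := by
    intro c f
    rw [RingHom.id_apply, ← MemLp.toLp_const_smul]
    apply MemLp.toLp_congr
    filter_upwards [Lp.coeFn_smul c f] with ξ h
    rw [h, Pi.smul_apply, Pi.smul_apply, map_smul]

/-- The Fourier multiplier with symbol `projSymbol s`, on `L²`. -/
def projL2 (s : ℝ) : L2 →ₗ[ℂ] L2 :=
  (Lp.fourierTransformₗᵢ R3 C4).symm.toLinearEquiv.toLinearMap ∘ₗ symbolMul s ∘ₗ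
    (Lp.fourierTransformₗᵢ R3 C4).toLinearEquiv.toLinearMap

lemma fourier_projL2 (s : ℝ) (f : L2) :
    (𝓕 (projL2 s f) : L2) =ᵐ[volume] fun ξ => projSymbol s ξ ((𝓕 f : L2) ξ) := by
  have h : (𝓕 (projL2 s f) : L2) = symbolMul s (𝓕 f) :=
    (Lp.fourierTransformₗᵢ R3 C4).apply_symm_apply _
  rw [h]
  exact MemLp.coeFn_toLp (memLp_projSymbol s (Lp.memLp (𝓕 f : L2)))

lemma projL2_mem (s : ℝ) : ∀ f ∈ halfSubmodule, projL2 s f ∈ halfSubmodule := by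
  intro f hf
  refine (memLp_congr_ae ?_).1 (memLp_projSymbol s hf)
  filter_upwards [fourier_projL2 s f] with ξ h
  rw [h]
  exact (projSymbol s ξ).map_smul_of_tower (√(lam ξ)) _

/-- The Fourier multiplier with symbol `projSymbol s`, on `H^{1/2}`. -/
def proj (s : ℝ) : Hhalf →ₗ[ℂ] Hhalf := (projL2 s).restrict (projL2_mem s)

/-- The projector `Λ₊(D)` on `H^{1/2}`; `ψ₊ = Λ₊(D) ψ`. -/
def projPlus : Hhalf →ₗ[ℂ] Hhalf := proj 1

/-- The projector `Λ₋(D)` on `H^{1/2}`; `ψ₋ = Λ₋(D) ψ`. -/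
def projMinus : Hhalf →ₗ[ℂ] Hhalf := proj (-1)

/-- `X₊(D) = Λ₊(D) H^{1/2}`. -/
def Xplus : Submodule ℂ Hhalf := LinearMap.range projPlus

/-- `X₋(D) = Λ₋(D) H^{1/2}`. -/
def Xminus : Submodule ℂ Hhalf := LinearMap.range projMinus

/-! ### The functionals `I^{(m)}` and the constraints -/

/-- The charge density `ρ_ψ = |ψ|²`. -/
def rho (ψ : Hhalf) (x : R3) : ℝ := ‖(toL2 ψ) x‖ ^ 2

/-- The components `(ψ, α^k ψ)` of the current `J_ψ`; they are real, since `α^k` is Hermitian. -/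
def current (ψ : Hhalf) (k : Fin 3) (x : R3) : ℝ :=
  (inner ℂ ((toL2 ψ) x) (op (alpha k) ((toL2 ψ) x))).re

/-- `∫∫ (ρ_ψ(x) ρ_ψ(y) - J_ψ(x)·J_ψ(y)) / |x - y| dx dy`. -/
def interaction (ψ : Hhalf) : ℝ :=
  ∫ z : R3 × R3,
    (rho ψ z.1 * rho ψ z.2 - ∑ k, current ψ k z.1 * current ψ k z.2) / ‖z.1 - z.2‖

/-- The functional `I^{(m)}` with charge `e`. -/
def functional (e m : ℝ) (ψ : Hhalf) : ℝ :=
  ‖projPlus ψ‖ ^ 2 - ‖projMinus ψ‖ ^ 2 - m * (e ^ 2 / 2) * interaction ψ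

/-- `Σ`, the `L²` unit sphere of `H^{1/2}`. -/
def unitSphere : Set Hhalf := {ψ | ‖toL2 ψ‖ ^ 2 = 1}

/-- `Σ₊`, the `L²` unit sphere of `X₊(D)`. -/
def unitSpherePlus : Set Hhalf := {w | w ∈ Xplus ∧ ‖toL2 w‖ ^ 2 = 1}

/-- `X_W = {ψ ∈ Σ : ψ₊ ∈ W}`. -/
def constraint (W : Submodule ℂ Hhalf) : Set Hhalf := {ψ | ψ ∈ unitSphere ∧ projPlus ψ ∈ W}

/-- `λ_W(m)`, the supremum of `I^{(m)}` on `X_W`. -/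
def maxLevel (e m : ℝ) (W : Submodule ℂ Hhalf) : ℝ := sSup (functional e m '' constraint W)

/-- The `L²` normalization `P(v) = v / ‖v‖_{L²}`. -/
def normalize (v : Hhalf) : Hhalf := ((‖toL2 v‖⁻¹ : ℝ) : ℂ) • v

/-- The constant `γ_K = π/2` of Kato's inequality. -/
def gammaK : ℝ := Real.pi / 2

end

end MaxwellDirac

open MaxwellDirac

namespace MaxwellDirac

noncomputable section

open Set Filter Topology

/-! ### Gaussian integrals -/

/-! Write |·| for the `L²` norm and ‖·‖ for the `H^{1/2}` norm. Up to a phase, every competitor over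
`w` has the form ψ = √(1 - |φ|²) w + φ with φ ∈ X₋ and |φ| ≤ 1 (`exists_eq_smul_state`). So the task
is to maximize a single function of φ, namely E(φ) = ‖w‖² - q(φ) - Q(ψ), where q(φ) = ‖φ‖² +
‖w‖²|φ|² and Q is m e²/2 times the interaction. Put s = m (e²/2) γ_K, which is less than 1/174.

Two bounds on Q carry the argument. The Fierz inequality |J| ≤ ρ gives Q ≥ 0. Kato's inequality
(`kato_inequality`), after the current term is dropped because the Coulomb kernel is positive
definite, gives Q(ψ) ≤ s‖ψ‖²|ψ|² (`coulombForm_self_le`). Hence E(φ) ≤ ‖w‖² - q(φ), while E(0) ≥ (1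
- s)‖w‖², and any φ with q(φ) > ‖w‖²/174 loses against 0. On the remaining convex region the
polarized Kato bounds make the Hessian of E at most -q (`QuarticSetting.hess_le`). Strong concavity
then makes maximizing sequences Cauchy, so no compactness is needed. Comparison with 0 gives q(φ) ≤
s‖w‖² for the maximizer, which is (iii) and also places it strictly inside the region, where it must
be critical. Conversely, a critical point in the region is the strict global maximizer
(`QuarticSetting.energy_lt_of_grad_eq_zero`). The same coercivity lets the implicit function theorem
act on the critical point equation, and uniqueness identifies its solution with the maximizer; this
gives (iv).

In the Euler-Lagrange equation, the directions in X₋ come from criticality, the direction `w`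
defines the multiplier, and the direction `i w` comes from phase invariance. Testing with ψ gives ω
= I(ψ) - Q(ψ), whence the bounds on ω.

Item (ii) is the delicate one, since q(φ) ≤ s‖w‖² alone only yields 1 - s when ‖w‖ is close to 1.
Testing the equation with φ bounds ‖φ‖² by the kinetic energy of ψ times |φ|. If (ii) failed, ‖w‖² -
1 would be at most of order ‖φ‖², so `w` would have kinetic energy of order ‖φ‖, and the smallness
of s would contradict this bound (`one_le_sub_of_bootstrap`). -/

lemma lintegral_Ioi_exp_neg_mul_sq {c : ℝ} (hc : 0 < c) :
    ∫⁻ s in Ioi (0 : ℝ), ENNReal.ofReal (Real.exp (-c * s ^ 2)) =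
      ENNReal.ofReal (√(Real.pi / c) / 2) := by
  rw [← integral_gaussian_Ioi, ofReal_integral_eq_lintegral_ofReal]
  · exact (integrable_exp_neg_mul_sq hc).integrableOn
  · exact ae_of_all _ fun s => (Real.exp_pos _).le

lemma lintegral_Ioi_mul_exp_neg_mul_sq {c : ℝ} (hc : 0 < c) :
    ∫⁻ s in Ioi (0 : ℝ), ENNReal.ofReal (2 * s * Real.exp (-c * s ^ 2)) =
      ENNReal.ofReal (1 / c) := by
  have hd : ∀ x ∈ Ici (0 : ℝ), HasDerivAt (fun s : ℝ => -(1 / c) * Real.exp (-c * s ^ 2))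
      (2 * x * Real.exp (-c * x ^ 2)) x := by
    intro x _
    have h := (((hasDerivAt_pow 2 x).const_mul (-c)).exp).const_mul (-(1 / c))
    convert! h using 1
    field_simp
    ring
  have hp : ∀ x ∈ Ioi (0 : ℝ), 0 ≤ 2 * x * Real.exp (-c * x ^ 2) := by
    intro x hx
    have : (0 : ℝ) < x := hx
    positivity
  have ht : Tendsto (fun s : ℝ => -(1 / c) * Real.exp (-c * s ^ 2)) atTop (𝓝 (-(1 / c) * 0)) := by
    refine Tendsto.const_mul _ (Real.tendsto_exp_atBot.comp ?_)
    exact (tendsto_pow_atTop two_ne_zero).const_mul_atTop_of_neg (neg_neg_of_pos hc)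
  have h := integral_Ioi_of_hasDerivAt_of_nonneg' hd hp ht
  rw [← ofReal_integral_eq_lintegral_ofReal (integrableOn_Ioi_deriv_of_nonneg' hd hp ht)
    ((ae_restrict_iff' measurableSet_Ioi).2 (ae_of_all _ hp)), h]
  simp

lemma lintegral_Ioi_inv_cube_mul_exp {c : ℝ} (hc : 0 < c) :
    ∫⁻ s in Ioi (0 : ℝ), ENNReal.ofReal (2 * (s ^ 3)⁻¹ * Real.exp (-c / s ^ 2)) =
      ENNReal.ofReal (1 / c) := by
  -- The primitive `(1/c) exp(-c/s²)` is written through `expNegInvGlue` so that it is continuous at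
  -- `s = 0` with value 0; division by zero would give the value `1/c` there.
  set g : ℝ → ℝ := fun s => (1 / c) * expNegInvGlue (s ^ 2 / c) with hg
  have hgp : ∀ x : ℝ, 0 < x → g x = (1 / c) * Real.exp (-c / x ^ 2) := by
    intro x hx
    have : ¬ x ^ 2 / c ≤ 0 := not_le.2 (by positivity)
    simp only [hg, expNegInvGlue, this, if_false, inv_div, neg_div]
  have hgc : Continuous g := by
    have h1 : Continuous expNegInvGlue := (expNegInvGlue.contDiff (n := 0)).continuous
    exact continuous_const.mul (h1.comp (by fun_prop))
  have hd : ∀ x ∈ Ioi (0 : ℝ), HasDerivAt g (2 * (x ^ 3)⁻¹ * Real.exp (-c / x ^ 2)) x := by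
    intro x hx
    have hx : 0 < x := hx
    have h := ((((hasDerivAt_pow 2 x).inv (by positivity)).const_mul (-c)).exp).const_mul (1 / c)
    have h' : HasDerivAt (fun s => (1 / c) * Real.exp (-c / s ^ 2))
        (2 * (x ^ 3)⁻¹ * Real.exp (-c / x ^ 2)) x := by
      convert! h using 1
      rw [div_eq_mul_inv (-c)]
      simp only [Pi.inv_apply]
      field_simp
      norm_num
    refine h'.congr_of_eventuallyEq ?_
    filter_upwards [lt_mem_nhds hx] with y hy using hgp y hy
  have hp : ∀ x ∈ Ioi (0 : ℝ), 0 ≤ 2 * (x ^ 3)⁻¹ * Real.exp (-c / x ^ 2) := by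
    intro x hx
    have : (0 : ℝ) < x := hx
    positivity
  have ht : Tendsto g atTop (𝓝 ((1 / c) * Real.exp 0)) := by
    have h1 : Tendsto (fun s : ℝ => -c / s ^ 2) atTop (𝓝 0) :=
      Tendsto.const_div_atTop (tendsto_pow_atTop two_ne_zero) _
    refine ((h1.rexp).const_mul (1 / c)).congr' ?_
    filter_upwards [eventually_gt_atTop 0] with y hy using (hgp y hy).symm
  have hcw : ContinuousWithinAt g (Ici 0) 0 := hgc.continuousWithinAt
  have h := integral_Ioi_of_hasDerivAt_of_nonneg hcw hd hp ht
  rw [← ofReal_integral_eq_lintegral_ofReal (integrableOn_Ioi_deriv_of_nonneg hcw hd hp ht)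
    ((ae_restrict_iff' measurableSet_Ioi).2 (ae_of_all _ hp)), h]
  simp [hg, expNegInvGlue]

lemma lintegral_exp_neg_mul_sq_norm {b : ℝ} (hb : 0 < b) (a : R3) :
    ∫⁻ k : R3, ENNReal.ofReal (Real.exp (-b * ‖k - a‖ ^ 2)) =
      ENNReal.ofReal ((√(Real.pi / b)) ^ 3) := by
  rw [lintegral_sub_right_eq_self (fun k : R3 => ENNReal.ofReal (Real.exp (-b * ‖k‖ ^ 2))) a]
  have h := GaussianFourier.integral_rexp_neg_mul_sq_norm (V := R3) hb
  have h3 : (Real.pi / b) ^ ((Module.finrank ℝ R3 : ℝ) / 2) = (√(Real.pi / b)) ^ 3 := by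
    rw [Real.sqrt_eq_rpow, ← Real.rpow_natCast, ← Real.rpow_mul (by positivity)]
    simp; ring_nf
  rw [← h3, ← h, ofReal_integral_eq_lintegral_ofReal]
  -- The integral of a non-integrable function is 0 by default, but the Gaussian formula gives a
  -- positive value.
  · by_contra hi
    rw [integral_undef hi] at h
    have : 0 < (Real.pi / b) ^ ((Module.finrank ℝ R3 : ℝ) / 2) :=
      Real.rpow_pos_of_pos (by positivity) _
    linarith
  · exact ae_of_all _ fun s => (Real.exp_pos _).le

/-- The composition formula for Riesz kernels:
`∫ dk / (|k|² |q - k|²) = π³ / |q|` in `ℝ³`. -/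
lemma lintegral_inv_sq_mul_inv_sq {q : R3} (hq : q ≠ 0) :
    ∫⁻ k : R3, ENNReal.ofReal (1 / (‖k‖ ^ 2 * ‖q - k‖ ^ 2)) =
      ENNReal.ofReal (Real.pi ^ 3 / ‖q‖) := by
  have hq0 : 0 < ‖q‖ := norm_pos_iff.2 hq
  -- From `1/X = ∫ 2s exp(-s²X) ds` for both factors, with the second variable written as `x s`: the
  -- Jacobian `s` turns `4 s (x s)` into `4 x s³`. The scale `s` then separates from the ratio `x`.
  set G : R3 → ℝ → ℝ → ENNReal := fun k x s =>
    ENNReal.ofReal (4 * x * s ^ 3 * Real.exp (-(s ^ 2) * (‖k‖ ^ 2 + x ^ 2 * ‖q - k‖ ^ 2))) with hG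
  have hGm : Measurable fun z : R3 × ℝ × ℝ => G z.1 z.2.1 z.2.2 := by
    simp only [hG]; fun_prop
  have h1 : ∀ᵐ k : R3, ENNReal.ofReal (1 / (‖k‖ ^ 2 * ‖q - k‖ ^ 2)) =
      ∫⁻ s in Ioi (0 : ℝ), ∫⁻ x in Ioi (0 : ℝ), G k x s := by
    have hk0 : ∀ᵐ k : R3, k ≠ 0 := by simp [ae_iff]
    have hkq : ∀ᵐ k : R3, k ≠ q := by simp [ae_iff]
    filter_upwards [hk0, hkq] with k hk hkq
    have hX : 0 < ‖k‖ ^ 2 := by have := norm_pos_iff.2 hk; positivity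
    have hY : 0 < ‖q - k‖ ^ 2 := by
      have := norm_pos_iff.2 (sub_ne_zero.2 hkq.symm); positivity
    have h2 : ∀ s ∈ Ioi (0 : ℝ), ∫⁻ x in Ioi (0 : ℝ), G k x s =
        ENNReal.ofReal (1 / ‖q - k‖ ^ 2) *
          ENNReal.ofReal (2 * s * Real.exp (-‖k‖ ^ 2 * s ^ 2)) := by
      intro s hs
      have hs : 0 < s := hs
      have h3 : ∀ x, G k x s = ENNReal.ofReal (2 * s * Real.exp (-‖k‖ ^ 2 * s ^ 2) * s ^ 2) *
          ENNReal.ofReal (2 * x * Real.exp (-(s ^ 2 * ‖q - k‖ ^ 2) * x ^ 2)) := by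
        intro x
        rw [← ENNReal.ofReal_mul (by positivity)]
        simp only [hG]
        congr 1
        have : Real.exp (-(s ^ 2) * (‖k‖ ^ 2 + x ^ 2 * ‖q - k‖ ^ 2)) =
            Real.exp (-‖k‖ ^ 2 * s ^ 2) * Real.exp (-(s ^ 2 * ‖q - k‖ ^ 2) * x ^ 2) := by
          rw [← Real.exp_add]; ring_nf
        rw [this]; ring
      simp_rw [h3]
      rw [lintegral_const_mul _ (by fun_prop), lintegral_Ioi_mul_exp_neg_mul_sq (by positivity),
        ← ENNReal.ofReal_mul (by positivity), ← ENNReal.ofReal_mul (by positivity)]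
      congr 1
      field_simp
    rw [setLIntegral_congr_fun measurableSet_Ioi h2, lintegral_const_mul _ (by fun_prop),
      lintegral_Ioi_mul_exp_neg_mul_sq hX, ← ENNReal.ofReal_mul (by positivity)]
    congr 1
    field_simp
  rw [lintegral_congr_ae h1]
  have h2 : ∫⁻ k : R3, ∫⁻ s in Ioi (0 : ℝ), ∫⁻ x in Ioi (0 : ℝ), G k x s =
      ∫⁻ x in Ioi (0 : ℝ), ∫⁻ s in Ioi (0 : ℝ), ∫⁻ k : R3, G k x s := by
    calc _ = ∫⁻ k : R3, ∫⁻ x in Ioi (0 : ℝ), ∫⁻ s in Ioi (0 : ℝ), G k x s := by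
          refine lintegral_congr fun k => ?_
          rw [lintegral_lintegral_swap]
          exact (hGm.comp (f := fun z : ℝ × ℝ => (k, z.2, z.1)) (by fun_prop)).aemeasurable
      _ = ∫⁻ x in Ioi (0 : ℝ), ∫⁻ k : R3, ∫⁻ s in Ioi (0 : ℝ), G k x s := by
          rw [lintegral_lintegral_swap]
          refine Measurable.aemeasurable ?_
          exact Measurable.lintegral_prod_right'
            (hGm.comp (f := fun z : (R3 × ℝ) × ℝ => (z.1.1, z.1.2, z.2)) (by fun_prop))
      _ = _ := by
          refine lintegral_congr fun x => ?_
          rw [lintegral_lintegral_swap]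
          exact (hGm.comp (f := fun z : R3 × ℝ => (z.1, x, z.2)) (by fun_prop)).aemeasurable
  rw [h2]
  have h3 : ∀ x ∈ Ioi (0 : ℝ), ∫⁻ s in Ioi (0 : ℝ), ∫⁻ k : R3, G k x s =
      ENNReal.ofReal (2 * Real.pi ^ 2 / ‖q‖) * ENNReal.ofReal ((1 + x ^ 2)⁻¹) := by
    intro x hx
    have hx : 0 < x := hx
    have hx1 : 0 < 1 + x ^ 2 := by positivity
    have h4 : ∀ s ∈ Ioi (0 : ℝ), ∫⁻ k : R3, G k x s =
        ENNReal.ofReal (4 * x * (√(Real.pi / (1 + x ^ 2))) ^ 3) *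
          ENNReal.ofReal (Real.exp (-(x ^ 2 / (1 + x ^ 2) * ‖q‖ ^ 2) * s ^ 2)) := by
      intro s hs
      have hs : 0 < s := hs
      -- Completing the square in `k`. The Gaussian integral over `k` produces `s⁻³`, which cancels
      -- the prefactor `s³`; the `s` integral is then Gaussian and the `x` integral is an
      -- arctangent.
      have h5 : ∀ k, G k x s =
          ENNReal.ofReal (4 * x * s ^ 3 * Real.exp (-(x ^ 2 / (1 + x ^ 2) * ‖q‖ ^ 2) * s ^ 2)) *
          ENNReal.ofReal (Real.exp (-(s ^ 2 * (1 + x ^ 2)) * ‖k - (x ^ 2 / (1 + x ^ 2)) • q‖ ^ 2)) := by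
        intro k
        rw [← ENNReal.ofReal_mul (by positivity)]
        simp only [hG]
        congr 1
        rw [mul_assoc, mul_assoc (4 * x * s ^ 3), ← Real.exp_add, ← mul_assoc]
        congr 2
        rw [@norm_sub_sq_real, @norm_sub_sq_real, norm_smul, inner_smul_right, real_inner_comm,
          Real.norm_eq_abs, abs_of_pos (by positivity : 0 < x ^ 2 / (1 + x ^ 2))]
        field_simp
        ring
      simp_rw [h5]
      rw [lintegral_const_mul _ (by fun_prop), lintegral_exp_neg_mul_sq_norm (by positivity),
        ← ENNReal.ofReal_mul (by positivity), ← ENNReal.ofReal_mul (by positivity)]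
      congr 1
      have : √(Real.pi / (s ^ 2 * (1 + x ^ 2))) = √(Real.pi / (1 + x ^ 2)) / s := by
        rw [mul_comm, ← div_div, Real.sqrt_div (by positivity), Real.sqrt_sq hs.le]
      rw [this]
      field_simp
    rw [setLIntegral_congr_fun measurableSet_Ioi h4, lintegral_const_mul _ (by fun_prop),
      lintegral_Ioi_exp_neg_mul_sq (by positivity), ← ENNReal.ofReal_mul (by positivity),
      ← ENNReal.ofReal_mul (by positivity)]
    congr 1
    have h6 : √(Real.pi / (x ^ 2 / (1 + x ^ 2) * ‖q‖ ^ 2)) =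
        √Real.pi * √(1 + x ^ 2) / (x * ‖q‖) := by
      rw [← Real.sqrt_mul (by positivity), ← Real.sqrt_sq (by positivity : 0 ≤ x * ‖q‖),
        ← Real.sqrt_div (by positivity)]
      congr 1
      field_simp
    rw [h6, Real.sqrt_div Real.pi_pos.le]
    have h7 : √Real.pi ^ 4 = Real.pi ^ 2 := by
      rw [show 4 = 2 * 2 from rfl, pow_mul, Real.sq_sqrt Real.pi_pos.le]
    have h8 : √(1 + x ^ 2) ^ 2 = 1 + x ^ 2 := Real.sq_sqrt hx1.le
    have h9 : 0 < √(1 + x ^ 2) := Real.sqrt_pos.2 hx1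
    field_simp
    rw [h7, h8]
    ring
  rw [setLIntegral_congr_fun measurableSet_Ioi h3, lintegral_const_mul _ (by fun_prop),
    ← ofReal_integral_eq_lintegral_ofReal integrable_inv_one_add_sq.integrableOn
      (ae_of_all _ fun x => by positivity), integral_Ioi_inv_one_add_sq, Real.arctan_zero,
    ← ENNReal.ofReal_mul (by positivity)]
  congr 1
  field_simp
  ring

/-! ### Kato's inequality -/

/-- Translation on `L²`. -/
def translate (k : R3) : L2 →ₗᵢ[ℂ] L2 :=
  Lp.compMeasurePreservingₗᵢ ℂ (fun q : R3 => q - k) (measurePreserving_sub_right volume k)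

lemma coeFn_translate (k : R3) (F : L2) : translate k F =ᵐ[volume] fun q => F (q - k) :=
  Lp.coeFn_compMeasurePreserving F (measurePreserving_sub_right volume k)

/-- The plane wave with frequency `k`. -/
def planeWave (k x : R3) : ℂ := Complex.exp (((2 * Real.pi * inner ℝ x k : ℝ) : ℂ) * Complex.I)

lemma continuous_planeWave : Continuous fun z : R3 × R3 => planeWave z.1 z.2 := by
  unfold planeWave; fun_prop

lemma norm_planeWave (k x : R3) : ‖planeWave k x‖ = 1 := Complex.norm_exp_ofReal_mul_I _

lemma memLp_planeWave (k : R3) : MemLp (planeWave k) ⊤ (volume : Measure R3) :=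
  memLp_top_of_bound
    (continuous_planeWave.comp (Continuous.prodMk_right k)).aestronglyMeasurable 1
    (ae_of_all _ fun x => (norm_planeWave k x).le)

/-- Modulation on `L²`. -/
def modulate (k : R3) : L2 →L[ℂ] L2 :=
  (ContinuousLinearMap.lsmul ℂ ℂ).holderL volume ⊤ 2 2 (memLp_planeWave k).toLp

lemma coeFn_modulate (k : R3) (f : L2) :
    modulate k f =ᵐ[volume] fun x => planeWave k x • f x := by
  have h : modulate k f =ᵐ[volume] _ :=
    (ContinuousLinearMap.lsmul ℂ ℂ).coeFn_holder (r := 2) (memLp_planeWave k).toLp f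
  filter_upwards [h, (memLp_planeWave k).coeFn_toLp] with x h1 h2
  rw [h1, h2]
  rfl

/-- Both sides are continuous in `F`, so Schwartz functions suffice; there it is a change of
variables in the Fourier integral. -/
lemma fourierInv_translate (k : R3) (F : L2) :
    (𝓕⁻ (translate k F) : L2) = modulate k (𝓕⁻ F) := by
  refine DenseRange.induction_on (p := fun F : L2 => (𝓕⁻ (translate k F) : L2) = modulate k (𝓕⁻ F))
    (SchwartzMap.denseRange_toLpCLM (F := C4) (μ := (volume : Measure R3)) (p := 2)
      ENNReal.ofNat_ne_top) F ?_ ?_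
  · refine isClosed_eq ?_ ?_
    · exact (Lp.fourierTransformₗᵢ R3 C4).symm.continuous.comp (translate k).continuous
    · exact (modulate k).continuous.comp (Lp.fourierTransformₗᵢ R3 C4).symm.continuous
  · intro g
    have h1 : translate k (SchwartzMap.toLpCLM ℝ C4 2 volume g) =
        (g.compSubConstCLM ℂ k).toLp 2 volume := by
      apply Lp.ext
      filter_upwards [coeFn_translate k (SchwartzMap.toLpCLM ℝ C4 2 volume g),
        (g.compSubConstCLM ℂ k).coeFn_toLp 2 volume,
        (measurePreserving_sub_right volume k).quasiMeasurePreserving.ae (g.coeFn_toLp 2 volume)]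
        with q h2 h3 h4
      rw [h2, h3, SchwartzMap.compSubConstCLM_apply]
      exact h4
    rw [h1, SchwartzMap.toLpCLM_apply, SchwartzMap.toLp_fourierInv_eq,
      SchwartzMap.toLp_fourierInv_eq]
    apply Lp.ext
    filter_upwards [(𝓕⁻ (g.compSubConstCLM ℂ k)).coeFn_toLp 2 volume,
      coeFn_modulate k ((𝓕⁻ g).toLp 2 volume), (𝓕⁻ g).coeFn_toLp 2 volume] with x h2 h3 h4
    rw [h2, h3, h4, SchwartzMap.fourierInv_coe, SchwartzMap.fourierInv_coe, Real.fourierInv_eq',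
      Real.fourierInv_eq', ← integral_smul,
      ← integral_add_right_eq_self _ k]
    refine integral_congr_ae (ae_of_all _ fun q => ?_)
    simp only [SchwartzMap.compSubConstCLM_apply, add_sub_cancel_right, smul_smul]
    congr 1
    rw [planeWave, ← Complex.exp_add]
    congr 1
    rw [inner_add_left, real_inner_comm x k]
    push_cast
    ring

/-- The Fourier transform of `|f|²` is the autocorrelation of the transform of `f`: Plancherel
applied to `⟨f, e_k f⟩`, where modulation by `e_k` becomes translation by `k`. -/
lemma integral_planeWave_mul_norm_sq (k : R3) (f : L2) :
    ∫ x, planeWave k x * ((‖f x‖ ^ 2 : ℝ) : ℂ) =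
      ∫ q, inner ℂ ((𝓕 f : L2) q) ((𝓕 f : L2) (q - k)) := by
  have h1 : inner ℂ (𝓕 f : L2) (translate k (𝓕 f)) = inner ℂ f (modulate k f) := by
    have h := fourierInv_translate k (𝓕 f)
    rw [FourierTransform.fourierInv_fourier_eq] at h
    rw [← h, ← Lp.inner_fourier_eq f, FourierTransform.fourier_fourierInv_eq]
  rw [L2.inner_def, L2.inner_def] at h1
  calc _ = ∫ x, inner ℂ (f x) ((modulate k f) x) := by
        refine integral_congr_ae ?_
        filter_upwards [coeFn_modulate k f] with x hx
        rw [hx, inner_smul_right, inner_self_eq_norm_sq_to_K]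
        push_cast
        rfl
    _ = _ := h1.symm
    _ = _ := by
        refine integral_congr_ae ?_
        filter_upwards [coeFn_translate k (𝓕 f)] with x hx
        rw [hx]

lemma enorm_integral_planeWave_mul_norm_sq_le (k : R3) (f : L2) :
    ‖∫ x, planeWave k x * ((‖f x‖ ^ 2 : ℝ) : ℂ)‖ₑ ≤
      ∫⁻ q, ‖(𝓕 f : L2) q‖ₑ * ‖(𝓕 f : L2) (q - k)‖ₑ := by
  rw [integral_planeWave_mul_norm_sq]
  refine (enorm_integral_le_lintegral_enorm _).trans (lintegral_mono fun q => ?_)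
  rw [← ofReal_norm, ← ofReal_norm, ← ofReal_norm, ← ENNReal.ofReal_mul (norm_nonneg _)]
  exact ENNReal.ofReal_le_ofReal (norm_inner_le_norm _ _)

lemma integrable_norm_sq (f : L2) : Integrable (fun x => ‖f x‖ ^ 2) (volume : Measure R3) :=
  (Lp.memLp f).integrable_norm_pow two_ne_zero

lemma gaussian_eq_integral_planeWave {s : ℝ} (hs : 0 < s) (z : R3) :
    ((Real.exp (-(Real.pi * s ^ 2) * ‖z‖ ^ 2) : ℝ) : ℂ) =
      ∫ k : R3, (((s ^ 3)⁻¹ * Real.exp (-(Real.pi / s ^ 2) * ‖k‖ ^ 2) : ℝ) : ℂ) *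
        planeWave k z := by
  have hb : 0 < ((Real.pi / s ^ 2 : ℝ) : ℂ).re := by
    rw [Complex.ofReal_re]; positivity
  have h := fourier_gaussian_innerProductSpace (V := R3) hb (-z)
  rw [Real.fourier_eq'] at h
  have h2 : (Real.pi / ((Real.pi / s ^ 2 : ℝ) : ℂ)) ^ ((Module.finrank ℝ R3 : ℂ) / 2) =
      ((s ^ 3 : ℝ) : ℂ) := by
    have h3 : (Real.pi / ((Real.pi / s ^ 2 : ℝ) : ℂ)) = ((s ^ 2 : ℝ) : ℂ) := by
      have : (Real.pi : ℂ) ≠ 0 := by exact_mod_cast Real.pi_ne_zero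
      push_cast
      field_simp
    have h4 : ((Module.finrank ℝ R3 : ℂ) / 2) = ((3 / 2 : ℝ) : ℂ) := by
      simp
    rw [h3, h4, ← Complex.ofReal_cpow (by positivity), ← Real.rpow_natCast s 2,
      ← Real.rpow_mul hs.le, ← Real.rpow_natCast s 3]
    norm_num
  rw [h2] at h
  have h5 : Complex.exp (-(Real.pi : ℂ) ^ 2 * (‖-z‖ : ℂ) ^ 2 / ((Real.pi / s ^ 2 : ℝ) : ℂ)) =
      ((Real.exp (-(Real.pi * s ^ 2) * ‖z‖ ^ 2) : ℝ) : ℂ) := by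
    have : (Real.pi : ℂ) ≠ 0 := by exact_mod_cast Real.pi_ne_zero
    have hs' : (s : ℂ) ≠ 0 := by exact_mod_cast hs.ne'
    rw [norm_neg]
    push_cast
    congr 1
    field_simp
  rw [h5] at h
  have hs' : ((s ^ 3 : ℝ) : ℂ) ≠ 0 := by exact_mod_cast (pow_pos hs 3).ne'
  rw [← mul_right_inj' hs', ← h, ← integral_const_mul]
  refine integral_congr_ae (ae_of_all _ fun k => ?_)
  simp only [planeWave, smul_eq_mul]
  have h6 : (((s ^ 3)⁻¹ * Real.exp (-(Real.pi / s ^ 2) * ‖k‖ ^ 2) : ℝ) : ℂ) =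
      ((s ^ 3 : ℝ) : ℂ)⁻¹ * ((Real.exp (-(Real.pi / s ^ 2) * ‖k‖ ^ 2) : ℝ) : ℂ) := by
    push_cast; rfl
  rw [h6, ← mul_assoc, ← mul_assoc, mul_inv_cancel₀ hs', one_mul, mul_comm]
  congr 1
  · push_cast; rfl
  · rw [inner_neg_right, real_inner_comm]
    push_cast
    congr 1
    ring

lemma integrable_gaussian {b : ℝ} (hb : 0 < b) :
    Integrable (fun k : R3 => Real.exp (-b * ‖k‖ ^ 2)) := by
  by_contra hi
  have h := GaussianFourier.integral_rexp_neg_mul_sq_norm (V := R3) hb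
  rw [integral_undef hi] at h
  have : 0 < (Real.pi / b) ^ ((Module.finrank ℝ R3 : ℝ) / 2) :=
    Real.rpow_pos_of_pos (by positivity) _
  linarith

lemma integrable_planeWave_mul {g h : R3 → ℝ} (hgc : Continuous g) (hg : Integrable g)
    (hh : Integrable h) (y : R3) :
    Integrable (Function.uncurry fun x k : R3 => (g k : ℂ) * planeWave k (x - y) * ((h x : ℝ) : ℂ))
      (volume.prod volume) := by
  have hm : AEStronglyMeasurable (fun z : R3 × R3 =>
      (g z.2 : ℂ) * planeWave z.2 (z.1 - y) * ((h z.1 : ℝ) : ℂ)) (volume.prod volume) := by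
    have h3 : Continuous fun z : R3 × R3 => planeWave z.2 (z.1 - y) := by
      unfold planeWave; fun_prop
    have h4 : Continuous fun z : R3 × R3 => (g z.2 : ℂ) := by fun_prop
    have h5 : AEStronglyMeasurable (fun x => ((h x : ℝ) : ℂ)) (volume : Measure R3) :=
      Complex.continuous_ofReal.comp_aestronglyMeasurable hh.aestronglyMeasurable
    exact (h4.mul h3).aestronglyMeasurable.mul h5.comp_fst
  refine Integrable.mono (hh.mul_prod hg) hm (ae_of_all _ fun z => ?_)
  simp only [Function.uncurry, norm_mul, norm_planeWave, mul_one, Complex.norm_real]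
  rw [mul_comm]

/-- The transform of `1/|x|` is not integrable, so Fubini is applied to Gaussians instead and the
Coulomb kernel is recovered by integrating over `s`. The centre `y` enters only through a phase,
which disappears under the absolute value; hence the bound is uniform in `y`. -/
lemma lintegral_gaussian_mul_norm_sq_le (f : L2) (y : R3) {s : ℝ} (hs : 0 < s) :
    ∫⁻ x, ENNReal.ofReal (Real.exp (-(Real.pi * s ^ 2) * ‖x - y‖ ^ 2) * ‖f x‖ ^ 2) ≤
      ∫⁻ k : R3, ENNReal.ofReal ((s ^ 3)⁻¹ * Real.exp (-(Real.pi / s ^ 2) * ‖k‖ ^ 2)) *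
        ∫⁻ q, ‖(𝓕 f : L2) q‖ₑ * ‖(𝓕 f : L2) (q - k)‖ₑ := by
  obtain ⟨g, hg⟩ : ∃ g : R3 → ℝ, g = fun k => (s ^ 3)⁻¹ * Real.exp (-(Real.pi / s ^ 2) * ‖k‖ ^ 2) :=
    ⟨_, rfl⟩
  have hgc : Continuous g := by rw [hg]; fun_prop
  have hg0 : ∀ k, ENNReal.ofReal ((s ^ 3)⁻¹ * Real.exp (-(Real.pi / s ^ 2) * ‖k‖ ^ 2)) =
      ‖(g k : ℂ)‖ₑ := by
    intro k
    rw [← ofReal_norm, Complex.norm_real, Real.norm_eq_abs, hg, abs_of_nonneg (by positivity)]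
  have hgauss : ∀ z : R3, ((Real.exp (-(Real.pi * s ^ 2) * ‖z‖ ^ 2) : ℝ) : ℂ) =
      ∫ k : R3, (g k : ℂ) * planeWave k z := by
    intro z
    rw [gaussian_eq_integral_planeWave hs, hg]
  have hgi : Integrable g := by
    rw [hg]; exact (integrable_gaussian (by positivity)).const_mul _
  have hf := integrable_norm_sq f
  have hi : Integrable fun x => Real.exp (-(Real.pi * s ^ 2) * ‖x - y‖ ^ 2) * ‖f x‖ ^ 2 := by
    refine hf.mono ((by fun_prop : Continuous fun x : R3 =>
      Real.exp (-(Real.pi * s ^ 2) * ‖x - y‖ ^ 2)).aestronglyMeasurable.mul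
        hf.aestronglyMeasurable) (ae_of_all _ fun x => ?_)
    rw [norm_mul]
    refine mul_le_of_le_one_left (norm_nonneg _) ?_
    rw [Real.norm_eq_abs, abs_of_pos (Real.exp_pos _), Real.exp_le_one_iff]
    have : 0 ≤ (Real.pi * s ^ 2) * ‖x - y‖ ^ 2 := by positivity
    linarith
  rw [← ofReal_integral_eq_lintegral_ofReal hi (ae_of_all _ fun x => by positivity)]
  have h0 : 0 ≤ ∫ x, Real.exp (-(Real.pi * s ^ 2) * ‖x - y‖ ^ 2) * ‖f x‖ ^ 2 :=
    integral_nonneg fun x => by positivity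
  have hsplit : ∀ k x : R3, planeWave k (x - y) = planeWave k x * planeWave k (-y) := by
    intro k x
    simp only [planeWave]
    rw [← Complex.exp_add, inner_sub_left, inner_neg_left]
    congr 1
    push_cast
    ring
  have h1 : ((∫ x, Real.exp (-(Real.pi * s ^ 2) * ‖x - y‖ ^ 2) * ‖f x‖ ^ 2 : ℝ) : ℂ) =
      ∫ k : R3, (g k : ℂ) * planeWave k (-y) *
        ∫ x, planeWave k x * ((‖f x‖ ^ 2 : ℝ) : ℂ) := by
    rw [← integral_complex_ofReal]
    calc _ = ∫ x, ∫ k : R3, (g k : ℂ) * planeWave k (x - y) * ((‖f x‖ ^ 2 : ℝ) : ℂ) := by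
          clear hg0 hi h0
          refine integral_congr_ae (ae_of_all _ fun x => ?_)
          simp only
          rw [integral_mul_const, Complex.ofReal_mul, hgauss]
      _ = ∫ k : R3, ∫ x, (g k : ℂ) * planeWave k (x - y) * ((‖f x‖ ^ 2 : ℝ) : ℂ) :=
          integral_integral_swap (integrable_planeWave_mul hgc hgi hf y)
      _ = _ := by
          refine integral_congr_ae (ae_of_all _ fun k => ?_)
          simp only
          rw [← integral_const_mul]
          refine integral_congr_ae (ae_of_all _ fun x => ?_)
          simp only
          rw [hsplit]
          ring
  calc ENNReal.ofReal (∫ x, Real.exp (-(Real.pi * s ^ 2) * ‖x - y‖ ^ 2) * ‖f x‖ ^ 2)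
      = ‖((∫ x, Real.exp (-(Real.pi * s ^ 2) * ‖x - y‖ ^ 2) * ‖f x‖ ^ 2 : ℝ) : ℂ)‖ₑ := by
        rw [← ofReal_norm, Complex.norm_real, Real.norm_eq_abs, abs_of_nonneg h0]
    _ ≤ _ := by
        rw [h1]
        refine (enorm_integral_le_lintegral_enorm _).trans (lintegral_mono fun k => ?_)
        rw [enorm_mul, enorm_mul]
        have h3 : ‖planeWave k (-y)‖ₑ = 1 := by
          rw [← ofReal_norm, norm_planeWave, ENNReal.ofReal_one]
        rw [hg0, h3, mul_one]
        gcongr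
        exact enorm_integral_planeWave_mul_norm_sq_le k f

/-- `∫ |f(x)|² / |x - y| dx` is dominated by the quadratic form with kernel `1 / (π |k|²)`
in momentum space. -/
lemma lintegral_norm_sq_div_le_lintegral_lintegral (f : L2) (y : R3) :
    ∫⁻ x, ENNReal.ofReal (‖f x‖ ^ 2 / ‖x - y‖) ≤
      ∫⁻ k : R3, ENNReal.ofReal (1 / (Real.pi * ‖k‖ ^ 2)) *
        ∫⁻ q, ‖(𝓕 f : L2) q‖ₑ * ‖(𝓕 f : L2) (q - k)‖ₑ := by
  have hfm : Measurable fun x => f x := (Lp.stronglyMeasurable f).measurable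
  have hFm : Measurable fun x => (𝓕 f : L2) x := (Lp.stronglyMeasurable _).measurable
  calc ∫⁻ x, ENNReal.ofReal (‖f x‖ ^ 2 / ‖x - y‖)
      = ∫⁻ x, ∫⁻ s in Ioi (0 : ℝ), ENNReal.ofReal 2 *
          ENNReal.ofReal (Real.exp (-(Real.pi * s ^ 2) * ‖x - y‖ ^ 2) * ‖f x‖ ^ 2) := by
        -- Subordination: `1/r = 2 ∫₀^∞ exp(-π s² r²) ds`.
        have hy : ∀ᵐ x : R3, x ≠ y := by simp [ae_iff]
        refine lintegral_congr_ae ?_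
        filter_upwards [hy] with x hx
        have hr : 0 < ‖x - y‖ := norm_pos_iff.2 (sub_ne_zero.2 hx)
        have h2 : ∀ s : ℝ, ENNReal.ofReal 2 *
            ENNReal.ofReal (Real.exp (-(Real.pi * s ^ 2) * ‖x - y‖ ^ 2) * ‖f x‖ ^ 2) =
            ENNReal.ofReal (2 * ‖f x‖ ^ 2) *
              ENNReal.ofReal (Real.exp (-(Real.pi * ‖x - y‖ ^ 2) * s ^ 2)) := by
          intro s
          rw [← ENNReal.ofReal_mul (by positivity), ← ENNReal.ofReal_mul (by positivity)]
          congr 1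
          have : -(Real.pi * s ^ 2) * ‖x - y‖ ^ 2 = -(Real.pi * ‖x - y‖ ^ 2) * s ^ 2 := by ring
          rw [this]; ring
        simp_rw [h2]
        rw [lintegral_const_mul _ (by fun_prop), lintegral_Ioi_exp_neg_mul_sq (by positivity),
          ← ENNReal.ofReal_mul (by positivity)]
        congr 1
        have : √(Real.pi / (Real.pi * ‖x - y‖ ^ 2)) = 1 / ‖x - y‖ := by
          rw [← Real.sqrt_sq (by positivity : 0 ≤ 1 / ‖x - y‖)]
          congr 1
          field_simp
        rw [this]
        field_simp
    _ = ∫⁻ s in Ioi (0 : ℝ), ∫⁻ x, ENNReal.ofReal 2 *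
          ENNReal.ofReal (Real.exp (-(Real.pi * s ^ 2) * ‖x - y‖ ^ 2) * ‖f x‖ ^ 2) := by
        rw [lintegral_lintegral_swap]
        refine Measurable.aemeasurable ?_
        fun_prop
    _ ≤ ∫⁻ s in Ioi (0 : ℝ), ∫⁻ k : R3,
          ENNReal.ofReal (2 * (s ^ 3)⁻¹ * Real.exp (-(Real.pi * ‖k‖ ^ 2) / s ^ 2)) *
          ∫⁻ q, ‖(𝓕 f : L2) q‖ₑ * ‖(𝓕 f : L2) (q - k)‖ₑ := by
        refine setLIntegral_mono' measurableSet_Ioi fun s hs => ?_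
        rw [lintegral_const_mul' _ _ ENNReal.ofReal_ne_top]
        refine (mul_le_mul_right (lintegral_gaussian_mul_norm_sq_le f y hs) _).trans ?_
        rw [← lintegral_const_mul' _ _ ENNReal.ofReal_ne_top]
        refine lintegral_mono fun k => le_of_eq ?_
        rw [← mul_assoc, ← ENNReal.ofReal_mul (by positivity)]
        congr 2
        rw [mul_assoc]
        congr 3
        ring
    _ = ∫⁻ k : R3, ∫⁻ s in Ioi (0 : ℝ),
          ENNReal.ofReal (2 * (s ^ 3)⁻¹ * Real.exp (-(Real.pi * ‖k‖ ^ 2) / s ^ 2)) *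
          ∫⁻ q, ‖(𝓕 f : L2) q‖ₑ * ‖(𝓕 f : L2) (q - k)‖ₑ := by
        rw [lintegral_lintegral_swap]
        refine Measurable.aemeasurable (Measurable.mul (by fun_prop) ?_)
        refine Measurable.lintegral_prod_right' (f := fun z : (ℝ × R3) × R3 =>
          ‖(𝓕 f : L2) z.2‖ₑ * ‖(𝓕 f : L2) (z.2 - z.1.2)‖ₑ) ?_
        fun_prop
    _ = _ := by
        have hk0 : ∀ᵐ k : R3, k ≠ 0 := by simp [ae_iff]
        refine lintegral_congr_ae ?_
        filter_upwards [hk0] with k hk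
        have hk' : 0 < ‖k‖ := norm_pos_iff.2 hk
        rw [lintegral_mul_const _ (by fun_prop), lintegral_Ioi_inv_cube_mul_exp (by positivity)]

/-- The quadratic form `⟨f, |p| f⟩`. -/
def absMomentum (f : L2) : ENNReal :=
  ∫⁻ ξ : R3, ENNReal.ofReal (2 * Real.pi * ‖ξ‖ * ‖(𝓕 f : L2) ξ‖ ^ 2)

/-- A Schur test. The product of the two values of `F` is split by `2ab ≤ a² + b²` with the weights
`|q|/|q-k|` and its inverse. The substitution `(k, q) ↦ (-k, q-k)` exchanges the two halves, and the
Riesz composition formula evaluates each: `(1/π) |q|² (π³/|q|) = (π/2)(2π|q|)`. -/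
lemma lintegral_schur_kernel_le (f : L2) :
    ∫⁻ k : R3, ENNReal.ofReal (1 / (Real.pi * ‖k‖ ^ 2)) *
        ∫⁻ q, ‖(𝓕 f : L2) q‖ₑ * ‖(𝓕 f : L2) (q - k)‖ₑ ≤
      ENNReal.ofReal gammaK * absMomentum f := by
  obtain ⟨F, hF⟩ : ∃ F : R3 → C4, F = fun q => (𝓕 f : L2) q := ⟨_, rfl⟩
  have hFm : Measurable F := hF ▸ (Lp.stronglyMeasurable _).measurable
  have hpi := Real.pi_pos
  -- the Schur weight `|q|²`
  obtain ⟨A, hA⟩ : ∃ A : R3 → R3 → ENNReal, A = fun k q =>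
      ENNReal.ofReal (1 / (Real.pi * ‖k‖ ^ 2) * (‖F q‖ ^ 2 * ‖q‖ ^ 2 / ‖q - k‖ ^ 2)) := ⟨_, rfl⟩
  have hAm : Measurable fun z : R3 × R3 => A z.1 z.2 := by
    simp only [hA]; fun_prop
  have hAint : ∫⁻ k, ∫⁻ q, A k q = ENNReal.ofReal gammaK * absMomentum f := by
    rw [lintegral_lintegral_swap hAm.aemeasurable, absMomentum,
      ← lintegral_const_mul _ (by fun_prop)]
    have hq0 : ∀ᵐ q : R3, q ≠ 0 := by simp [ae_iff]
    refine lintegral_congr_ae ?_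
    filter_upwards [hq0] with q hq
    have hq' : 0 < ‖q‖ := norm_pos_iff.2 hq
    have h1 : ∀ k, A k q = ENNReal.ofReal (1 / Real.pi * (‖F q‖ ^ 2 * ‖q‖ ^ 2)) *
        ENNReal.ofReal (1 / (‖k‖ ^ 2 * ‖q - k‖ ^ 2)) := by
      intro k
      rw [← ENNReal.ofReal_mul (by positivity)]
      simp only [hA]
      congr 1
      rw [one_div, one_div, one_div, mul_inv, mul_inv, div_eq_mul_inv]
      ring
    simp_rw [h1]
    rw [lintegral_const_mul _ (by fun_prop), lintegral_inv_sq_mul_inv_sq hq,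
      ← ENNReal.ofReal_mul (by positivity), ← ENNReal.ofReal_mul (by unfold gammaK; positivity)]
    congr 1
    unfold gammaK
    simp only [hF]
    field_simp
  have hBint : ∫⁻ k, ∫⁻ q, A (-k) (q - k) = ∫⁻ k, ∫⁻ q, A k q := by
    calc _ = ∫⁻ k, ∫⁻ q, A (-k) q :=
          lintegral_congr fun k => lintegral_sub_right_eq_self (fun q => A (-k) q) k
      _ = _ := lintegral_neg_eq_self (μ := (volume : Measure R3)) (fun k => ∫⁻ q, A k q)
  have hpt : ∀ k : R3, ∀ᵐ q : R3,
      ENNReal.ofReal (1 / (Real.pi * ‖k‖ ^ 2)) * (‖F q‖ₑ * ‖F (q - k)‖ₑ) ≤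
        ENNReal.ofReal (1 / 2) * (A k q + A (-k) (q - k)) := by
    intro k
    have hq0 : ∀ᵐ q : R3, q ≠ 0 := by simp [ae_iff]
    have hqk : ∀ᵐ q : R3, q ≠ k := by simp [ae_iff]
    filter_upwards [hq0, hqk] with q hq hqk
    have hq' : 0 < ‖q‖ := norm_pos_iff.2 hq
    have hqk' : 0 < ‖q - k‖ := norm_pos_iff.2 (sub_ne_zero.2 hqk)
    simp only [hA]
    rw [← ofReal_norm, ← ofReal_norm, ← ENNReal.ofReal_mul (norm_nonneg (F q)),
      ← ENNReal.ofReal_mul (by positivity), ← ENNReal.ofReal_add (by positivity) (by positivity),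
      ← ENNReal.ofReal_mul (by positivity)]
    refine ENNReal.ofReal_le_ofReal ?_
    rw [norm_neg, sub_neg_eq_add, sub_add_cancel, ← mul_add, mul_left_comm (1 / 2 : ℝ)]
    refine mul_le_mul_of_nonneg_left ?_ (by positivity)
    have h := two_mul_le_add_sq (‖F q‖ * ‖q‖ / ‖q - k‖) (‖F (q - k)‖ * ‖q - k‖ / ‖q‖)
    have h2 : 2 * (‖F q‖ * ‖q‖ / ‖q - k‖) * (‖F (q - k)‖ * ‖q - k‖ / ‖q‖) =
        2 * (‖F q‖ * ‖F (q - k)‖) := by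
      field_simp
    rw [h2, div_pow, div_pow, mul_pow, mul_pow] at h
    linarith
  have hFq : ∀ q, (𝓕 f : L2) q = F q := fun q => by rw [hF]
  simp_rw [hFq]
  calc _ = ∫⁻ k : R3, ∫⁻ q, ENNReal.ofReal (1 / (Real.pi * ‖k‖ ^ 2)) * (‖F q‖ₑ * ‖F (q - k)‖ₑ) :=
        lintegral_congr fun k => (lintegral_const_mul _ (by fun_prop)).symm
    _ ≤ ∫⁻ k : R3, ∫⁻ q, ENNReal.ofReal (1 / 2) * (A k q + A (-k) (q - k)) :=
        lintegral_mono fun k => lintegral_mono_ae (hpt k)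
    _ = ENNReal.ofReal (1 / 2) *
        ((∫⁻ k, ∫⁻ q, A k q) + ∫⁻ k, ∫⁻ q, A (-k) (q - k)) := by
        have hB : Measurable fun z : R3 × R3 => A (-z.1) (z.2 - z.1) :=
          hAm.comp (by fun_prop : Measurable fun z : R3 × R3 => (-z.1, z.2 - z.1))
        have hA1 : Measurable fun k => ∫⁻ q, A k q := Measurable.lintegral_prod_right' hAm
        have hB1 : Measurable fun k => ∫⁻ q, A (-k) (q - k) := Measurable.lintegral_prod_right' hB
        rw [← lintegral_add_left hA1, ← lintegral_const_mul _ (hA1.fun_add hB1)]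
        refine lintegral_congr fun k => ?_
        have hAk : Measurable fun q => A k q := hAm.comp (by fun_prop : Measurable fun q => (k, q))
        have hBk : Measurable fun q => A (-k) (q - k) :=
          hB.comp (by fun_prop : Measurable fun q => (k, q))
        rw [lintegral_const_mul _ (hAk.fun_add hBk), lintegral_add_left hAk]
    _ = _ := by
        rw [hBint, hAint, ← two_mul, ← mul_assoc, ← ENNReal.ofReal_ofNat,
          ← ENNReal.ofReal_mul (by positivity)]
        norm_num

/-- Kato's inequality `|x - y|⁻¹ ≤ (π/2) |p|`. -/
theorem kato_inequality (f : L2) (y : R3) :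
    ∫⁻ x, ENNReal.ofReal (‖f x‖ ^ 2 / ‖x - y‖) ≤ ENNReal.ofReal gammaK * absMomentum f :=
  (lintegral_norm_sq_div_le_lintegral_lintegral f y).trans (lintegral_schur_kernel_le f)

/-! ### The symbol of the Dirac operator -/

/-- The matrix of `diracSymbol`. -/
def diracMatrix (ξ : R3) : Matrix (Fin 4) (Fin 4) ℂ :=
  -(∑ k, ((2 * Real.pi * ξ k : ℝ) : ℂ) • alpha k) - beta

lemma diracSymbol_eq_op (ξ : R3) : diracSymbol ξ = op (diracMatrix ξ) := by
  simp only [diracSymbol, diracMatrix, op, map_sub, map_neg, map_sum, map_smul]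

lemma alpha_isHermitian (k : Fin 3) : (alpha k).IsHermitian := by
  unfold Matrix.IsHermitian
  fin_cases k <;> ext i j <;> fin_cases i <;> fin_cases j <;> simp [alpha]

lemma beta_isHermitian : beta.IsHermitian := by
  unfold Matrix.IsHermitian
  ext i j; fin_cases i <;> fin_cases j <;> simp [beta, Matrix.diagonal]

lemma diracMatrix_isHermitian (ξ : R3) : (diracMatrix ξ).IsHermitian := by
  unfold Matrix.IsHermitian diracMatrix
  rw [Matrix.conjTranspose_sub, Matrix.conjTranspose_neg, Matrix.conjTranspose_sum,
    beta_isHermitian.eq]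
  congr 2
  refine Finset.sum_congr rfl fun k _ => ?_
  rw [Matrix.conjTranspose_smul, (alpha_isHermitian k).eq]
  congr 1
  exact Complex.conj_ofReal _

lemma lam_sq (ξ : R3) : lam ξ ^ 2 = (2 * Real.pi * ‖ξ‖) ^ 2 + 1 := Real.sq_sqrt (by positivity)

lemma one_le_lam (ξ : R3) : 1 ≤ lam ξ :=
  Real.one_le_sqrt.2 (by nlinarith [sq_nonneg (2 * Real.pi * ‖ξ‖)])

/-- The Clifford relations cancel the mixed terms, which is checked entry by entry. Together with
Hermiticity this makes the two symbols `projSymbol (±1)` complementary orthogonal projectors. -/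
lemma diracMatrix_mul_self (ξ : R3) :
    diracMatrix ξ * diracMatrix ξ = ((lam ξ ^ 2 : ℝ) : ℂ) • (1 : Matrix (Fin 4) (Fin 4) ℂ) := by
  have h : lam ξ ^ 2 = (2 * Real.pi * ξ 0) ^ 2 + (2 * Real.pi * ξ 1) ^ 2 +
      (2 * Real.pi * ξ 2) ^ 2 + 1 := by
    rw [lam_sq, mul_pow, EuclideanSpace.real_norm_sq_eq, Fin.sum_univ_three]; ring
  have hI := Complex.I_sq
  have hb : beta = !![1, 0, 0, 0; 0, 1, 0, 0; 0, 0, -1, 0; 0, 0, 0, -1] := by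
    ext i j; fin_cases i <;> fin_cases j <;> simp [beta, Matrix.diagonal]
  rw [h]
  unfold diracMatrix
  simp only [Fin.sum_univ_three, hb]
  generalize (2 * Real.pi * ξ 0) = a
  generalize (2 * Real.pi * ξ 1) = b
  generalize (2 * Real.pi * ξ 2) = c
  ext i j
  fin_cases i <;> fin_cases j <;>
    simp [Matrix.mul_apply, Fin.sum_univ_four, alpha] <;> ring_nf <;>
    simp only [hI] <;> ring_nf

lemma op_mul (A B : Matrix (Fin 4) (Fin 4) ℂ) (v : C4) : op (A * B) v = op A (op B v) := by
  simp only [op, map_mul]; rfl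

lemma inner_op_left {A : Matrix (Fin 4) (Fin 4) ℂ} (hA : A.IsHermitian) (u v : C4) :
    inner ℂ (op A u) v = inner ℂ u (op A v) := by
  have h : ContinuousLinearMap.adjoint (op A) = op A := by
    have : star (op A) = op A := by
      rw [op, ← map_star, Matrix.star_eq_conjTranspose, hA.eq]
    exact this
  nth_rewrite 1 [← h]
  rw [ContinuousLinearMap.adjoint_inner_left]

lemma diracSymbol_apply_apply (ξ : R3) (v : C4) :
    diracSymbol ξ (diracSymbol ξ v) = ((lam ξ ^ 2 : ℝ) : ℂ) • v := by
  rw [diracSymbol_eq_op, ← op_mul, diracMatrix_mul_self, op, map_smul, map_one]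
  rfl

lemma projSymbol_apply (s : ℝ) (ξ : R3) (v : C4) :
    projSymbol s ξ v = (1 / 2 : ℂ) • (v + ((s / lam ξ : ℝ) : ℂ) • diracSymbol ξ v) := rfl

lemma projSymbol_add (ξ : R3) (v : C4) : projSymbol 1 ξ v + projSymbol (-1) ξ v = v := by
  rw [projSymbol_apply, projSymbol_apply, neg_div, Complex.ofReal_neg, neg_smul]
  module

lemma inner_projSymbol_left (s : ℝ) (ξ : R3) (u v : C4) :
    inner ℂ (projSymbol s ξ u) v = inner ℂ u (projSymbol s ξ v) := by
  simp only [projSymbol_apply, inner_smul_left, inner_smul_right, inner_add_left, inner_add_right,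
    diracSymbol_eq_op, inner_op_left (diracMatrix_isHermitian ξ), Complex.conj_ofReal]
  have h2 : (starRingEnd ℂ) (1 / 2 : ℂ) = 1 / 2 := by
    rw [map_div₀, map_one, map_ofNat]
  rw [h2]

lemma projSymbol_comp_neg {s : ℝ} (hs : s ^ 2 = 1) (ξ : R3) (v : C4) :
    projSymbol s ξ (projSymbol (-s) ξ v) = 0 := by
  have hl : (lam ξ : ℂ) ≠ 0 := by exact_mod_cast (lam_pos ξ).ne'
  have hs' : (s : ℂ) ^ 2 = 1 := by exact_mod_cast hs
  simp only [projSymbol_apply, map_smul, map_add, diracSymbol_apply_apply, smul_add, smul_smul]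
  have h1 : 1 / 2 * ((-s / lam ξ : ℝ) : ℂ) * (1 / 2 * (((s / lam ξ : ℝ) : ℂ) *
      ((lam ξ ^ 2 : ℝ) : ℂ))) = - (1 / 4) := by
    push_cast
    field_simp
    linear_combination (-4 : ℂ) * hs'
  rw [h1]
  push_cast
  module

lemma norm_sq_projSymbol_add (ξ : R3) (v : C4) :
    ‖projSymbol 1 ξ v‖ ^ 2 + ‖projSymbol (-1) ξ v‖ ^ 2 = ‖v‖ ^ 2 := by
  have h0 : inner ℂ (projSymbol 1 ξ v) (projSymbol (-1) ξ v) = 0 := by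
    rw [inner_projSymbol_left, projSymbol_comp_neg (by norm_num), inner_zero_right]
  have h := norm_add_sq (𝕜 := ℂ) (projSymbol 1 ξ v) (projSymbol (-1) ξ v)
  rw [h0, projSymbol_add] at h
  simp only [map_zero, mul_zero, add_zero] at h
  exact h.symm

/-! ### Fourier representation of the norms -/

/-- The Fourier transform of an element of `H^{1/2}`. -/
def hat (f : Hhalf) : L2 := 𝓕 (toL2 f)

lemma coeFn_weightedFourier (f : Hhalf) :
    weightedFourier f =ᵐ[volume] fun ξ => √(lam ξ) • hat f ξ := MemLp.coeFn_toLp f.2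

lemma norm_eq_norm_weightedFourier (f : Hhalf) : ‖f‖ = ‖weightedFourier f‖ := rfl

lemma norm_sq_eq_integral (g : L2) : ‖g‖ ^ 2 = ∫ ξ, ‖g ξ‖ ^ 2 := by
  have h := norm_sq_eq_re_inner (𝕜 := ℂ) g
  rw [L2.inner_def] at h
  rw [h]
  have h2 : ∀ ξ, inner ℂ (g ξ) (g ξ) = ((‖g ξ‖ ^ 2 : ℝ) : ℂ) := by
    intro ξ; rw [inner_self_eq_norm_sq_to_K]; push_cast; rfl
  simp_rw [h2]
  rw [integral_complex_ofReal]
  rfl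

lemma norm_sq_weighted_ae (f : Hhalf) :
    (fun ξ => ‖weightedFourier f ξ‖ ^ 2) =ᵐ[volume] fun ξ => lam ξ * ‖hat f ξ‖ ^ 2 := by
  filter_upwards [coeFn_weightedFourier f] with ξ h
  rw [h, norm_smul, mul_pow, Real.norm_eq_abs, abs_of_nonneg (Real.sqrt_nonneg _),
    Real.sq_sqrt (lam_pos ξ).le]

lemma integrable_lam_mul (f : Hhalf) : Integrable fun ξ => lam ξ * ‖hat f ξ‖ ^ 2 :=
  (integrable_norm_sq (weightedFourier f)).congr (norm_sq_weighted_ae f)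

lemma norm_sq_eq (f : Hhalf) : ‖f‖ ^ 2 = ∫ ξ, lam ξ * ‖hat f ξ‖ ^ 2 := by
  rw [norm_eq_norm_weightedFourier, norm_sq_eq_integral, integral_congr_ae (norm_sq_weighted_ae f)]

lemma norm_sq_toL2_eq (f : Hhalf) : ‖toL2 f‖ ^ 2 = ∫ ξ, ‖hat f ξ‖ ^ 2 := by
  rw [← norm_sq_eq_integral, hat, Lp.norm_fourier_eq]

lemma norm_toL2_le (f : Hhalf) : ‖toL2 f‖ ≤ ‖f‖ := by
  refine le_of_sq_le_sq ?_ (norm_nonneg _)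
  rw [norm_sq_eq, norm_sq_toL2_eq]
  exact integral_mono (integrable_norm_sq _) (integrable_lam_mul f) fun ξ =>
    le_mul_of_one_le_left (by positivity) (one_le_lam ξ)

/-- The quadratic form `⟨f, |p| f⟩` as a real number. -/
def kinetic (f : Hhalf) : ℝ := ∫ ξ, 2 * Real.pi * ‖ξ‖ * ‖hat f ξ‖ ^ 2

lemma two_pi_norm_le_lam (ξ : R3) : 2 * Real.pi * ‖ξ‖ ≤ lam ξ :=
  Real.le_sqrt_of_sq_le (by linarith)

lemma integrable_kinetic (f : Hhalf) : Integrable fun ξ => 2 * Real.pi * ‖ξ‖ * ‖hat f ξ‖ ^ 2 := by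
  refine (integrable_lam_mul f).mono ?_ (ae_of_all _ fun ξ => ?_)
  · exact (by fun_prop : Continuous fun ξ : R3 => 2 * Real.pi * ‖ξ‖).aestronglyMeasurable.mul
      (integrable_norm_sq (hat f)).aestronglyMeasurable
  · have := lam_pos ξ
    rw [Real.norm_of_nonneg (by positivity), Real.norm_of_nonneg (by positivity)]
    exact mul_le_mul_of_nonneg_right (two_pi_norm_le_lam ξ) (by positivity)

lemma kinetic_nonneg (f : Hhalf) : 0 ≤ kinetic f := integral_nonneg fun ξ => by positivity

lemma kinetic_le (f : Hhalf) : kinetic f ≤ ‖f‖ ^ 2 := by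
  rw [norm_sq_eq]
  exact integral_mono (integrable_kinetic f) (integrable_lam_mul f) fun ξ =>
    mul_le_mul_of_nonneg_right (two_pi_norm_le_lam ξ) (by positivity)

lemma absMomentum_toL2 (f : Hhalf) : absMomentum (toL2 f) = ENNReal.ofReal (kinetic f) := by
  rw [kinetic, ofReal_integral_eq_lintegral_ofReal (integrable_kinetic f)
    (ae_of_all _ fun ξ => by positivity)]
  rfl

/-- Since `|p|² = (λ-1)(λ+1)`, this is the weighted arithmetic-geometric mean inequality under the
integral. It shows that a state whose `H^{1/2}` norm is close to its `L²` norm has small kinetic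
energy; the parameter `t` is left free for the proof of (ii). -/
lemma kinetic_le_of_pos (f : Hhalf) {t : ℝ} (ht : 0 < t) :
    kinetic f ≤ (t * (‖f‖ ^ 2 - ‖toL2 f‖ ^ 2) + t⁻¹ * (‖f‖ ^ 2 + ‖toL2 f‖ ^ 2)) / 2 := by
  have h1 := integrable_lam_mul f
  have h2 := integrable_norm_sq (hat f)
  have hs : Integrable fun ξ => lam ξ * ‖hat f ξ‖ ^ 2 - ‖hat f ξ‖ ^ 2 := h1.sub h2
  have ha : Integrable fun ξ => lam ξ * ‖hat f ξ‖ ^ 2 + ‖hat f ξ‖ ^ 2 := h1.add h2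
  have h3 : (t * (‖f‖ ^ 2 - ‖toL2 f‖ ^ 2) + t⁻¹ * (‖f‖ ^ 2 + ‖toL2 f‖ ^ 2)) / 2 =
      ∫ ξ, (t * (lam ξ * ‖hat f ξ‖ ^ 2 - ‖hat f ξ‖ ^ 2) +
        t⁻¹ * (lam ξ * ‖hat f ξ‖ ^ 2 + ‖hat f ξ‖ ^ 2)) / 2 := by
    rw [integral_div, integral_add (hs.const_mul t) (ha.const_mul t⁻¹),
      integral_const_mul, integral_const_mul, integral_sub h1 h2, integral_add h1 h2,
      norm_sq_eq, norm_sq_toL2_eq]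
  rw [h3]
  refine integral_mono (integrable_kinetic f)
    (((hs.const_mul t).add (ha.const_mul t⁻¹)).div_const 2) fun ξ => ?_
  have h4 : 2 * Real.pi * ‖ξ‖ ≤ (t * (lam ξ - 1) + t⁻¹ * (lam ξ + 1)) / 2 := by
    have hl := one_le_lam ξ
    have h5 := lam_sq ξ
    refine abs_le_of_sq_le_sq' ?_ (by
      have : 0 ≤ t * (lam ξ - 1) := mul_nonneg ht.le (by linarith)
      positivity) |>.2
    have h6 : (2 * Real.pi * ‖ξ‖) ^ 2 = (t * (lam ξ - 1)) * (t⁻¹ * (lam ξ + 1)) := by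
      field_simp; linarith
    rw [h6]
    nlinarith [sq_nonneg (t * (lam ξ - 1) - t⁻¹ * (lam ξ + 1))]
  have h5 := mul_le_mul_of_nonneg_right h4 (by positivity : 0 ≤ ‖hat f ξ‖ ^ 2)
  linarith

/-! ### The projectors -/

lemma hat_proj (s : ℝ) (f : Hhalf) :
    hat (proj s f) =ᵐ[volume] fun ξ => projSymbol s ξ (hat f ξ) := fourier_projL2 s (toL2 f)

lemma hat_injective : Function.Injective hat :=
  (Lp.fourierTransformₗᵢ R3 C4).injective.comp toL2_injective

lemma hat_add (f g : Hhalf) : hat (f + g) = hat f + hat g := by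
  rw [hat, map_add, FourierTransform.fourier_add]; rfl

lemma hat_zero : hat 0 = 0 := by
  rw [hat, map_zero]; exact (Lp.fourierTransformₗᵢ R3 C4).map_zero

lemma projPlus_add_projMinus (f : Hhalf) : projPlus f + projMinus f = f := by
  apply hat_injective
  rw [hat_add]
  apply Lp.ext
  filter_upwards [Lp.coeFn_add (hat (projPlus f)) (hat (projMinus f)), hat_proj 1 f,
    hat_proj (-1) f] with ξ h1 h2 h3
  rw [h1, Pi.add_apply]
  exact (congrArg₂ (· + ·) h2 h3).trans (projSymbol_add ξ _)

lemma proj_comp_neg {s : ℝ} (hs : s ^ 2 = 1) (f : Hhalf) : proj s (proj (-s) f) = 0 := by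
  apply hat_injective
  rw [hat_zero]
  apply Lp.ext
  filter_upwards [Lp.coeFn_zero C4 2 (volume : Measure R3), hat_proj s (proj (-s) f),
    hat_proj (-s) f] with ξ h1 h2 h3
  rw [h1, h2, h3, projSymbol_comp_neg hs]
  rfl

lemma projPlus_projMinus (f : Hhalf) : projPlus (projMinus f) = 0 :=
  proj_comp_neg (by norm_num) f

lemma projMinus_projPlus (f : Hhalf) : projMinus (projPlus f) = 0 := by
  have h := proj_comp_neg (s := -1) (by norm_num) f
  rwa [neg_neg] at h

/-- The projectors are Fourier multipliers, so the splitting is orthogonal at each momentum.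
Integrating against `λ`, `1` and `|p|` gives the three Pythagorean identities below. -/
lemma norm_sq_hat_ae (f : Hhalf) :
    (fun ξ => ‖hat (projPlus f) ξ‖ ^ 2 + ‖hat (projMinus f) ξ‖ ^ 2) =ᵐ[volume]
      fun ξ => ‖hat f ξ‖ ^ 2 := by
  filter_upwards [hat_proj 1 f, hat_proj (-1) f] with ξ h2 h3
  have := norm_sq_projSymbol_add ξ (hat f ξ)
  rw [← h2, ← h3] at this
  exact this

lemma norm_sq_projPlus_add (f : Hhalf) : ‖projPlus f‖ ^ 2 + ‖projMinus f‖ ^ 2 = ‖f‖ ^ 2 := by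
  rw [norm_sq_eq, norm_sq_eq, norm_sq_eq,
    ← integral_add (integrable_lam_mul _) (integrable_lam_mul _)]
  refine integral_congr_ae ?_
  filter_upwards [norm_sq_hat_ae f] with ξ h
  rw [← mul_add, h]

lemma norm_sq_toL2_projPlus_add (f : Hhalf) :
    ‖toL2 (projPlus f)‖ ^ 2 + ‖toL2 (projMinus f)‖ ^ 2 = ‖toL2 f‖ ^ 2 := by
  rw [norm_sq_toL2_eq, norm_sq_toL2_eq, norm_sq_toL2_eq,
    ← integral_add (integrable_norm_sq _) (integrable_norm_sq _)]
  exact integral_congr_ae (norm_sq_hat_ae f)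

lemma kinetic_projPlus_add (f : Hhalf) :
    kinetic (projPlus f) + kinetic (projMinus f) = kinetic f := by
  rw [kinetic, kinetic, kinetic, ← integral_add (integrable_kinetic _) (integrable_kinetic _)]
  refine integral_congr_ae ?_
  filter_upwards [norm_sq_hat_ae f] with ξ h
  rw [← mul_add, h]

lemma norm_projPlus_le (f : Hhalf) : ‖projPlus f‖ ≤ ‖f‖ :=
  le_of_sq_le_sq (by have := norm_sq_projPlus_add f; nlinarith [sq_nonneg ‖projMinus f‖])
    (norm_nonneg _)

lemma norm_projMinus_le (f : Hhalf) : ‖projMinus f‖ ≤ ‖f‖ :=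
  le_of_sq_le_sq (by have := norm_sq_projPlus_add f; nlinarith [sq_nonneg ‖projPlus f‖])
    (norm_nonneg _)

lemma mem_Xminus_iff (f : Hhalf) : f ∈ Xminus ↔ projPlus f = 0 := by
  constructor
  · rintro ⟨g, rfl⟩
    exact projPlus_projMinus g
  · intro h
    have := projPlus_add_projMinus f
    rw [h, zero_add] at this
    exact ⟨f, this⟩

lemma mem_Xplus_iff (f : Hhalf) : f ∈ Xplus ↔ projMinus f = 0 := by
  constructor
  · rintro ⟨g, rfl⟩
    exact projMinus_projPlus g
  · intro h
    have := projPlus_add_projMinus f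
    rw [h, add_zero] at this
    exact ⟨f, this⟩

lemma projMinus_of_mem {f : Hhalf} (hf : f ∈ Xminus) : projMinus f = f := by
  have := projPlus_add_projMinus f
  rwa [(mem_Xminus_iff f).1 hf, zero_add] at this

lemma projPlus_of_mem {f : Hhalf} (hf : f ∈ Xplus) : projPlus f = f := by
  have := projPlus_add_projMinus f
  rwa [(mem_Xplus_iff f).1 hf, add_zero] at this

/-! ### Completeness -/

/-- As `λ ≥ 1`, dividing by `λ^{1/2}` stays in `L²`. Hence `H^{1/2}` is unitarily equivalent to `L²`
and inherits its completeness, on which the Cauchy sequence argument and the implicit function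
theorem depend. -/
lemma weightedFourier_surjective : Function.Surjective weightedFourier := by
  intro g
  have hm : MemLp (fun ξ => (√(lam ξ))⁻¹ • g ξ) 2 (volume : Measure R3) := by
    refine MemLp.of_le (Lp.memLp g) ?_ (ae_of_all _ fun ξ => ?_)
    · have hc : Continuous fun ξ => (√(lam ξ))⁻¹ :=
        (Real.continuous_sqrt.comp continuous_lam).inv₀
          fun ξ => (Real.sqrt_pos.2 (lam_pos ξ)).ne'
      exact hc.aestronglyMeasurable.smul (Lp.aestronglyMeasurable g)
    · rw [norm_smul]
      refine mul_le_of_le_one_left (norm_nonneg _) ?_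
      rw [norm_inv, Real.norm_of_nonneg (Real.sqrt_nonneg _)]
      exact inv_le_one_of_one_le₀ (Real.one_le_sqrt.2 (one_le_lam ξ))
  set f0 : L2 := 𝓕⁻ (hm.toLp : L2) with hf0
  have h1 : (𝓕 f0 : L2) = hm.toLp := FourierTransform.fourier_fourierInv_eq _
  have h2 : (fun ξ => √(lam ξ) • (𝓕 f0 : L2) ξ) =ᵐ[volume] g := by
    rw [h1]
    filter_upwards [hm.coeFn_toLp] with ξ h
    rw [h, smul_smul, mul_inv_cancel₀ (Real.sqrt_pos.2 (lam_pos ξ)).ne', one_smul]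
  have hmem : f0 ∈ halfSubmodule := (memLp_congr_ae h2.symm).1 (Lp.memLp g)
  refine ⟨(⟨f0, hmem⟩ : halfSubmodule), ?_⟩
  apply Lp.ext
  exact (coeFn_weightedFourier _).trans h2

/-- `f ↦ λ^{1/2} f̂` as a unitary map. -/
def weightedFourierEquiv : Hhalf ≃ₗᵢ[ℂ] L2 where
  toLinearEquiv := LinearEquiv.ofBijective weightedFourier
    ⟨weightedFourier_injective, weightedFourier_surjective⟩
  norm_map' _ := rfl

instance : CompleteSpace Hhalf :=
  (completeSpace_congr (e := weightedFourierEquiv.toEquiv)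
    weightedFourierEquiv.isometry.isUniformEmbedding).2 inferInstance

/-- `Λ₊` as a bounded operator. -/
def projPlusL : Hhalf →L[ℂ] Hhalf :=
  projPlus.mkContinuous 1 fun f => by rw [one_mul]; exact norm_projPlus_le f

/-- `Λ₋` as a bounded operator. -/
def projMinusL : Hhalf →L[ℂ] Hhalf :=
  projMinus.mkContinuous 1 fun f => by rw [one_mul]; exact norm_projMinus_le f

lemma isClosed_Xminus : IsClosed (Xminus : Set Hhalf) := by
  have : (Xminus : Set Hhalf) = projPlusL ⁻¹' {0} := by
    ext f
    exact mem_Xminus_iff f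
  rw [this]
  exact isClosed_singleton.preimage projPlusL.continuous

instance : CompleteSpace Xminus := isClosed_Xminus.completeSpace_coe

end

end MaxwellDirac

namespace MaxwellDirac

noncomputable section

open Set Filter Topology

set_option maxSynthPendingDepth 3

/-! ### The density four-vector, pointwise -/

/-- `Re (u, v) Re (u', v') - ∑ Re (u, αᵏ v) Re (u', αᵏ v')`. -/
def spinorPairing (u v u' v' : C4) : ℝ :=
  (inner ℂ u v).re * (inner ℂ u' v').re -
    ∑ k, (inner ℂ u (op (alpha k) v)).re * (inner ℂ u' (op (alpha k) v')).re

lemma continuous_spinorPairing :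
    Continuous fun p : C4 × C4 × C4 × C4 => spinorPairing p.1 p.2.1 p.2.2.1 p.2.2.2 := by
  unfold spinorPairing
  have h1 : Continuous Complex.re := Complex.continuous_re
  fun_prop

lemma alpha_mul_self (k : Fin 3) : alpha k * alpha k = 1 := by
  fin_cases k <;> ext i j <;> fin_cases i <;> fin_cases j <;>
    simp [alpha, Matrix.mul_apply, Fin.sum_univ_four]

lemma norm_op_alpha (k : Fin 3) (v : C4) : ‖op (alpha k) v‖ = ‖v‖ := by
  have h : inner ℂ (op (alpha k) v) (op (alpha k) v) = inner ℂ v v := by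
    rw [inner_op_left (alpha_isHermitian k), ← op_mul, alpha_mul_self, op, map_one]; rfl
  rw [@norm_eq_sqrt_re_inner ℂ, h, ← @norm_eq_sqrt_re_inner ℂ]

lemma re_inner_comm (u v : C4) : (inner ℂ u v).re = (inner ℂ v u).re := by
  rw [← inner_conj_symm, Complex.conj_re]

lemma re_inner_alpha_comm (k : Fin 3) (u v : C4) :
    (inner ℂ u (op (alpha k) v)).re = (inner ℂ v (op (alpha k) u)).re := by
  rw [re_inner_comm, inner_op_left (alpha_isHermitian k)]

lemma abs_re_inner_le (u v : C4) : |(inner ℂ u v).re| ≤ ‖u‖ * ‖v‖ :=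
  (Complex.abs_re_le_norm _).trans (norm_inner_le_norm _ _)

lemma abs_re_inner_alpha_le (k : Fin 3) (u v : C4) :
    |(inner ℂ u (op (alpha k) v)).re| ≤ ‖u‖ * ‖v‖ := by
  simpa [norm_op_alpha] using abs_re_inner_le u (op (alpha k) v)

/-- One charge term and three current terms, each estimated by Cauchy-Schwarz because every `αᵏ` is
an isometry. This crude factor 4 is the 4 in `abs_quartic_le`; diagonal values are treated
separately without it. -/
lemma abs_spinorPairing_le (u v u' v' : C4) :
    |spinorPairing u v u' v'| ≤ 4 * (‖u‖ * ‖v‖ * ‖u'‖ * ‖v'‖) := by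
  have h : ∀ {a b A B : ℝ}, |a| ≤ A → |b| ≤ B → |a * b| ≤ A * B := by
    intro a b A B ha hb
    rw [abs_mul]
    exact mul_le_mul ha hb (abs_nonneg _) ((abs_nonneg _).trans ha)
  unfold spinorPairing
  refine (abs_sub _ _).trans ?_
  have h1 := h (abs_re_inner_le u v) (abs_re_inner_le u' v')
  have h2 : |∑ k, (inner ℂ u (op (alpha k) v)).re * (inner ℂ u' (op (alpha k) v')).re| ≤
      ∑ _k : Fin 3, ‖u‖ * ‖v‖ * (‖u'‖ * ‖v'‖) :=
    (Finset.abs_sum_le_sum_abs _ _).trans (Finset.sum_le_sum fun k _ =>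
      h (abs_re_inner_alpha_le k u v) (abs_re_inner_alpha_le k u' v'))
  simp only [Finset.sum_const, Finset.card_univ, Fintype.card_fin, nsmul_eq_mul] at h2
  push_cast at h2
  linarith

lemma spinorPairing_swap_left (u v u' v' : C4) :
    spinorPairing u v u' v' = spinorPairing v u u' v' := by
  unfold spinorPairing
  simp only [re_inner_comm u v, re_inner_alpha_comm _ u v]

lemma spinorPairing_swap (u v u' v' : C4) :
    spinorPairing u v u' v' = spinorPairing u' v' u v := by
  unfold spinorPairing
  simp only [mul_comm]

lemma spinorPairing_add_left (u₁ u₂ v u' v' : C4) :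
    spinorPairing (u₁ + u₂) v u' v' = spinorPairing u₁ v u' v' + spinorPairing u₂ v u' v' := by
  unfold spinorPairing
  simp only [inner_add_left, Complex.add_re, add_mul, Finset.sum_add_distrib]
  ring

lemma spinorPairing_smul_left (c : ℝ) (u v u' v' : C4) :
    spinorPairing ((c : ℂ) • u) v u' v' = c * spinorPairing u v u' v' := by
  unfold spinorPairing
  simp only [inner_smul_left, Complex.conj_ofReal, Complex.re_ofReal_mul, mul_assoc,
    ← Finset.mul_sum]
  ring

/-- The numbers `(u, u)` and `(u, αᵏ u)` are real by Hermiticity, so multiplication by `i` leaves no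
real part. This is infinitesimal phase invariance. -/
lemma spinorPairing_I_smul (u v v' : C4) : spinorPairing v v' u (Complex.I • u) = 0 := by
  have h : ∀ k, (inner ℂ u (op (alpha k) u)).im = 0 := by
    intro k
    rw [← Complex.conj_eq_iff_im, inner_conj_symm, inner_op_left (alpha_isHermitian k)]
  have h0 : (inner ℂ u u : ℂ).im = 0 := by
    rw [← Complex.conj_eq_iff_im, inner_conj_symm]
  unfold spinorPairing
  simp only [map_smul, inner_smul_right, Complex.I_mul_re, h, h0]
  simp

/-- The Fierz inequality `|J| ≤ ρ`. -/
lemma sum_sq_re_inner_alpha_le (u : C4) :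
    ∑ k, (inner ℂ u (op (alpha k) u)).re ^ 2 ≤ (‖u‖ ^ 2) ^ 2 := by
  have h0 : ‖u‖ ^ 2 = ∑ i, ((u i).re ^ 2 + (u i).im ^ 2) := by
    rw [EuclideanSpace.norm_sq_eq]
    refine Finset.sum_congr rfl fun i _ => ?_
    rw [Complex.sq_norm, Complex.normSq_apply]; ring
  rw [h0]
  simp only [Fin.sum_univ_three, Fin.sum_univ_four, PiLp.inner_apply, op, alpha,
    Matrix.ofLp_toEuclideanCLM, Matrix.mulVec, dotProduct]
  simp [Complex.mul_re, Complex.mul_im]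
  set a0 := (u 0).re
  set a1 := (u 1).re
  set a2 := (u 2).re
  set a3 := (u 3).re
  set b0 := (u 0).im
  set b1 := (u 1).im
  set b2 := (u 2).im
  set b3 := (u 3).im
  -- The Fierz identity: `ρ² - |J|²` equals the first square (of the scalar density) plus four times
  -- the second (the pseudoscalar density, up to sign and normalization).
  nlinarith [sq_nonneg (a0 ^ 2 + b0 ^ 2 + a1 ^ 2 + b1 ^ 2 - a2 ^ 2 - b2 ^ 2 - a3 ^ 2 - b3 ^ 2),
    sq_nonneg (a0 * b2 - b0 * a2 + a1 * b3 - b1 * a3)]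

lemma spinorPairing_self_nonneg (u v : C4) : 0 ≤ spinorPairing u u v v := by
  unfold spinorPairing
  have hn : ∀ u : C4, (inner ℂ u u).re = ‖u‖ ^ 2 := fun u => (norm_sq_eq_re_inner (𝕜 := ℂ) u).symm
  rw [hn, hn, sub_nonneg]
  refine abs_le_of_sq_le_sq' ?_ (by positivity) |>.2
  refine (Finset.sum_mul_sq_le_sq_mul_sq _ _ _).trans ?_
  rw [mul_pow]
  exact mul_le_mul (sum_sq_re_inner_alpha_le u) (sum_sq_re_inner_alpha_le v)
    (Finset.sum_nonneg fun _ _ => sq_nonneg _) (by positivity)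

/-! ### Coulomb integrals -/

lemma measurable_coe (f : L2) : Measurable fun x => f x := (Lp.stronglyMeasurable f).measurable

lemma lintegral_norm_mul_norm_le_of_sq {α : Type*} [MeasurableSpace α] {μ : Measure α}
    {p q : α → ℝ} (hp : Measurable p) (hq : Measurable q) (hp0 : ∀ x, 0 ≤ p x)
    (hq0 : ∀ x, 0 ≤ q x) {A B : ℝ} (hA : 0 ≤ A) (hB : 0 ≤ B)
    (h1 : ∫⁻ x, ENNReal.ofReal (p x ^ 2) ∂μ ≤ ENNReal.ofReal (A ^ 2))
    (h2 : ∫⁻ x, ENNReal.ofReal (q x ^ 2) ∂μ ≤ ENNReal.ofReal (B ^ 2)) :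
    ∫⁻ x, ENNReal.ofReal (p x * q x) ∂μ ≤ ENNReal.ofReal (A * B) := by
  have key := ENNReal.lintegral_mul_le_Lp_mul_Lq μ Real.HolderConjugate.two_two
    (f := fun x => ENNReal.ofReal (p x)) (g := fun x => ENNReal.ofReal (q x))
    (by fun_prop) (by fun_prop)
  have hsq : ∀ {r : ℝ}, 0 ≤ r → ENNReal.ofReal r ^ (2 : ℝ) = ENNReal.ofReal (r ^ 2) := by
    intro r hr
    rw [ENNReal.ofReal_rpow_of_nonneg hr (by norm_num)]; norm_num
  have hrt : ∀ {r : ℝ}, 0 ≤ r → ENNReal.ofReal (r ^ 2) ^ (1 / 2 : ℝ) = ENNReal.ofReal r := by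
    intro r hr
    rw [ENNReal.ofReal_rpow_of_nonneg (by positivity) (by norm_num), ← Real.sqrt_eq_rpow,
      Real.sqrt_sq hr]
  simp only [Pi.mul_apply] at key
  simp_rw [hsq (hp0 _), hsq (hq0 _), ← ENNReal.ofReal_mul (hp0 _)] at key
  refine key.trans ?_
  rw [ENNReal.ofReal_mul hA, ← hrt hA, ← hrt hB]
  gcongr

lemma lintegral_norm_sq (f : L2) : ∫⁻ x, ENNReal.ofReal (‖f x‖ ^ 2) = ENNReal.ofReal (‖f‖ ^ 2) := by
  rw [norm_sq_eq_integral, ofReal_integral_eq_lintegral_ofReal (integrable_norm_sq f)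
    (ae_of_all _ fun x => by positivity)]

lemma gammaK_pos : 0 < gammaK := by unfold gammaK; positivity

/-- Kato's inequality polarized by Cauchy-Schwarz, with the kernel shared as `|x-y|^{-1/2}` between
the two factors. -/
lemma lintegral_norm_mul_norm_div_le (f g : Hhalf) (y : R3) :
    ∫⁻ x, ENNReal.ofReal (‖toL2 f x‖ * ‖toL2 g x‖ / ‖x - y‖) ≤
      ENNReal.ofReal (gammaK * √(kinetic f) * √(kinetic g)) := by
  have hg := gammaK_pos
  have hfm := measurable_coe (toL2 f)
  have hgm := measurable_coe (toL2 g)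
  have hK : ∀ f : Hhalf, ∫⁻ x, ENNReal.ofReal ((‖toL2 f x‖ / √‖x - y‖) ^ 2) ≤
      ENNReal.ofReal ((√gammaK * √(kinetic f)) ^ 2) := by
    intro f
    have h := kato_inequality (toL2 f) y
    rw [absMomentum_toL2, ← ENNReal.ofReal_mul hg.le] at h
    rw [mul_pow, Real.sq_sqrt hg.le, Real.sq_sqrt (kinetic_nonneg f)]
    simp_rw [div_pow, Real.sq_sqrt (norm_nonneg _)]
    exact h
  have h := lintegral_norm_mul_norm_le_of_sq (μ := (volume : Measure R3))
    (p := fun x => ‖toL2 f x‖ / √‖x - y‖) (q := fun x => ‖toL2 g x‖ / √‖x - y‖)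
    (by fun_prop) (by fun_prop) (fun x => by positivity) (fun x => by positivity)
    (by positivity) (by positivity) (hK f) (hK g)
  have h1 : √gammaK * √(kinetic f) * (√gammaK * √(kinetic g)) =
      gammaK * √(kinetic f) * √(kinetic g) := by
    rw [mul_mul_mul_comm, Real.mul_self_sqrt hg.le, mul_assoc]
  rw [h1] at h
  refine le_of_eq_of_le (lintegral_congr fun x => ?_) h
  congr 1
  rw [div_mul_div_comm, Real.mul_self_sqrt (norm_nonneg _)]

/-- Kato's bound in `x` is uniform in `y`, so the `y` integral costs only `L²` norms. Only the first
pair of arguments therefore pays with kinetic energy, and this asymmetry is what the Hessian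
estimate and (ii) exploit. -/
lemma lintegral_coulomb_le (f g h k : Hhalf) :
    ∫⁻ z : R3 × R3, ENNReal.ofReal (‖toL2 f z.1‖ * ‖toL2 g z.1‖ * ‖toL2 h z.2‖ * ‖toL2 k z.2‖ /
        ‖z.1 - z.2‖) ≤
      ENNReal.ofReal (gammaK * √(kinetic f) * √(kinetic g) * (‖toL2 h‖ * ‖toL2 k‖)) := by
  have hg := gammaK_pos
  have hfm := measurable_coe (toL2 f)
  have hgm := measurable_coe (toL2 g)
  have hhm := measurable_coe (toL2 h)
  have hkm := measurable_coe (toL2 k)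
  change ∫⁻ z : R3 × R3, _ ∂(volume.prod volume) ≤ _
  rw [lintegral_prod_symm' _ (by fun_prop)]
  calc _ ≤ ∫⁻ y, ENNReal.ofReal (gammaK * √(kinetic f) * √(kinetic g)) *
        ENNReal.ofReal (‖toL2 h y‖ * ‖toL2 k y‖) := by
        refine lintegral_mono fun y => ?_
        refine le_trans (le_of_eq ?_) (mul_le_mul_left (lintegral_norm_mul_norm_div_le f g y) _)
        rw [← lintegral_mul_const' _ _ ENNReal.ofReal_ne_top]
        refine lintegral_congr fun x => ?_
        rw [← ENNReal.ofReal_mul (by positivity)]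
        congr 1
        ring
    _ = ENNReal.ofReal (gammaK * √(kinetic f) * √(kinetic g)) *
        ∫⁻ y, ENNReal.ofReal (‖toL2 h y‖ * ‖toL2 k y‖) :=
        lintegral_const_mul' _ _ ENNReal.ofReal_ne_top
    _ ≤ ENNReal.ofReal (gammaK * √(kinetic f) * √(kinetic g)) *
        ENNReal.ofReal (‖toL2 h‖ * ‖toL2 k‖) := by
        gcongr
        exact lintegral_norm_mul_norm_le_of_sq (by fun_prop) (by fun_prop)
          (fun _ => norm_nonneg _) (fun _ => norm_nonneg _) (norm_nonneg _) (norm_nonneg _)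
          (lintegral_norm_sq _).le (lintegral_norm_sq _).le
    _ = _ := by rw [← ENNReal.ofReal_mul (by positivity)]

/-- The integrand of the quartic form. -/
def coulombIntegrand (f g h k : Hhalf) (z : R3 × R3) : ℝ :=
  spinorPairing (toL2 f z.1) (toL2 g z.1) (toL2 h z.2) (toL2 k z.2) / ‖z.1 - z.2‖

lemma measurable_coulombIntegrand (f g h k : Hhalf) : Measurable (coulombIntegrand f g h k) := by
  have hfm := measurable_coe (toL2 f)
  have hgm := measurable_coe (toL2 g)
  have hhm := measurable_coe (toL2 h)
  have hkm := measurable_coe (toL2 k)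
  refine Measurable.div ?_ (by fun_prop)
  exact continuous_spinorPairing.measurable.comp (f := fun z : R3 × R3 =>
    (toL2 f z.1, toL2 g z.1, toL2 h z.2, toL2 k z.2)) (by fun_prop)

lemma abs_coulombIntegrand_le (f g h k : Hhalf) (z : R3 × R3) :
    |coulombIntegrand f g h k z| ≤
      4 * (‖toL2 f z.1‖ * ‖toL2 g z.1‖ * ‖toL2 h z.2‖ * ‖toL2 k z.2‖ / ‖z.1 - z.2‖) := by
  rw [coulombIntegrand, abs_div, abs_of_nonneg (norm_nonneg (z.1 - z.2)), ← mul_div_assoc]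
  exact div_le_div_of_nonneg_right (abs_spinorPairing_le _ _ _ _) (norm_nonneg _)

lemma lintegral_coulombIntegrand_le (f g h k : Hhalf) :
    ∫⁻ z, ENNReal.ofReal |coulombIntegrand f g h k z| ≤
      ENNReal.ofReal (4 * (gammaK * √(kinetic f) * √(kinetic g) * (‖toL2 h‖ * ‖toL2 k‖))) := by
  calc _ ≤ ∫⁻ z : R3 × R3, ENNReal.ofReal 4 * ENNReal.ofReal
          (‖toL2 f z.1‖ * ‖toL2 g z.1‖ * ‖toL2 h z.2‖ * ‖toL2 k z.2‖ / ‖z.1 - z.2‖) := by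
        refine lintegral_mono fun z => ?_
        rw [← ENNReal.ofReal_mul (by norm_num)]
        exact ENNReal.ofReal_le_ofReal (abs_coulombIntegrand_le f g h k z)
    _ ≤ _ := by
        rw [lintegral_const_mul' _ _ ENNReal.ofReal_ne_top, ENNReal.ofReal_mul (by norm_num)]
        gcongr
        exact lintegral_coulomb_le f g h k

lemma integrable_coulombIntegrand (f g h k : Hhalf) : Integrable (coulombIntegrand f g h k) := by
  refine ⟨(measurable_coulombIntegrand f g h k).aestronglyMeasurable, ?_⟩
  rw [hasFiniteIntegral_iff_norm]
  exact (lintegral_coulombIntegrand_le f g h k).trans_lt ENNReal.ofReal_lt_top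

/-- The quartic form, as a function. -/
def coulombForm (f g h k : Hhalf) : ℝ := ∫ z, coulombIntegrand f g h k z

lemma abs_coulombForm_le_kinetic (f g h k : Hhalf) :
    |coulombForm f g h k| ≤
      4 * (gammaK * √(kinetic f) * √(kinetic g) * (‖toL2 h‖ * ‖toL2 k‖)) := by
  have hg := gammaK_pos
  have h1 : |coulombForm f g h k| ≤ ∫ z, |coulombIntegrand f g h k z| :=
    abs_integral_le_integral_abs
  refine h1.trans ?_
  rw [← ENNReal.ofReal_le_ofReal_iff (by positivity), ofReal_integral_eq_lintegral_ofReal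
    (integrable_coulombIntegrand f g h k).abs (ae_of_all _ fun z => abs_nonneg _)]
  exact lintegral_coulombIntegrand_le f g h k

lemma sqrt_kinetic_le (f : Hhalf) : √(kinetic f) ≤ ‖f‖ :=
  Real.sqrt_le_iff.2 ⟨norm_nonneg _, kinetic_le f⟩

lemma abs_coulombForm_le (f g h k : Hhalf) :
    |coulombForm f g h k| ≤ 4 * gammaK * (‖f‖ * ‖g‖ * (‖toL2 h‖ * ‖toL2 k‖)) := by
  have hg := gammaK_pos
  refine (abs_coulombForm_le_kinetic f g h k).trans ?_
  have h1 := sqrt_kinetic_le f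
  have h2 := sqrt_kinetic_le g
  have : √(kinetic f) * √(kinetic g) ≤ ‖f‖ * ‖g‖ := by gcongr
  calc _ = 4 * gammaK * ((√(kinetic f) * √(kinetic g)) * (‖toL2 h‖ * ‖toL2 k‖)) := by ring
    _ ≤ _ := by gcongr

lemma coulombForm_swap_left (f g h k : Hhalf) : coulombForm f g h k = coulombForm g f h k := by
  unfold coulombForm coulombIntegrand
  simp_rw [spinorPairing_swap_left (toL2 f _)]

lemma coulombForm_swap (f g h k : Hhalf) : coulombForm f g h k = coulombForm h k f g := by
  unfold coulombForm coulombIntegrand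
  change ∫ z : R3 × R3, _ ∂(volume.prod volume) = ∫ z : R3 × R3, _ ∂(volume.prod volume)
  rw [← integral_prod_swap]
  refine integral_congr_ae (ae_of_all _ fun z => ?_)
  simp only [Prod.fst_swap, Prod.snd_swap]
  rw [spinorPairing_swap, norm_sub_rev]

lemma coulombForm_swap_right (f g h k : Hhalf) : coulombForm f g h k = coulombForm f g k h := by
  rw [coulombForm_swap, coulombForm_swap_left, coulombForm_swap]

lemma ae_fst {p : R3 → Prop} (h : ∀ᵐ x : R3, p x) : ∀ᵐ z : R3 × R3, p z.1 :=
  (Measure.quasiMeasurePreserving_fst (μ := (volume : Measure R3)) (ν := (volume : Measure R3))).ae h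

lemma ae_snd {p : R3 → Prop} (h : ∀ᵐ x : R3, p x) : ∀ᵐ z : R3 × R3, p z.2 :=
  (Measure.quasiMeasurePreserving_snd (μ := (volume : Measure R3)) (ν := (volume : Measure R3))).ae h

lemma coulombForm_add_left (f₁ f₂ g h k : Hhalf) :
    coulombForm (f₁ + f₂) g h k = coulombForm f₁ g h k + coulombForm f₂ g h k := by
  unfold coulombForm
  rw [← integral_add (integrable_coulombIntegrand _ _ _ _) (integrable_coulombIntegrand _ _ _ _)]
  refine integral_congr_ae ?_
  filter_upwards [ae_fst (Lp.coeFn_add (toL2 f₁) (toL2 f₂))] with z hz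
  simp only [coulombIntegrand]
  rw [map_add, hz, Pi.add_apply, spinorPairing_add_left, add_div]

lemma coulombForm_smul_left (c : ℝ) (f g h k : Hhalf) :
    coulombForm (c • f) g h k = c * coulombForm f g h k := by
  unfold coulombForm
  rw [← integral_const_mul]
  refine integral_congr_ae ?_
  filter_upwards [ae_fst (Lp.coeFn_smul (c : ℂ) (toL2 f))] with z hz
  simp only [coulombIntegrand]
  have : c • f = (c : ℂ) • f := rfl
  rw [this, map_smul, hz, Pi.smul_apply, spinorPairing_smul_left, mul_div_assoc]

lemma norm_coulombForm_le (f g h k : Hhalf) :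
    ‖coulombForm f g h k‖ ≤ 4 * gammaK * ‖f‖ * ‖g‖ * ‖h‖ * ‖k‖ := by
  have hg := gammaK_pos
  refine (abs_coulombForm_le f g h k).trans ?_
  calc _ = 4 * gammaK * ‖f‖ * ‖g‖ * ‖toL2 h‖ * ‖toL2 k‖ := by ring
    _ ≤ _ := by gcongr <;> exact norm_toL2_le _

/-- The bilinear forms `(h, k) ↦ coulombForm f g h k`. -/
def coulombBilin (f g : Hhalf) : Hhalf →L[ℝ] Hhalf →L[ℝ] ℝ :=
  LinearMap.mkContinuous₂ (LinearMap.mk₂ ℝ (coulombForm f g)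
    (fun h₁ h₂ k => by
      rw [coulombForm_swap, coulombForm_add_left, coulombForm_swap, coulombForm_swap h₂])
    (fun c h k => by rw [coulombForm_swap, coulombForm_smul_left, coulombForm_swap]; rfl)
    (fun h k₁ k₂ => by
      rw [coulombForm_swap_right, coulombForm_swap, coulombForm_add_left, coulombForm_swap,
        coulombForm_swap k₂, coulombForm_swap_right, coulombForm_swap_right f g k₂])
    (fun c h k => by
      rw [coulombForm_swap_right, coulombForm_swap, coulombForm_smul_left, coulombForm_swap,
        coulombForm_swap_right]; rfl))
    (4 * gammaK * ‖f‖ * ‖g‖) (norm_coulombForm_le f g)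

lemma coulombBilin_apply (f g h k : Hhalf) : coulombBilin f g h k = coulombForm f g h k := rfl

lemma norm_coulombBilin_le (f g : Hhalf) : ‖coulombBilin f g‖ ≤ 4 * gammaK * ‖f‖ * ‖g‖ := by
  have hg := gammaK_pos
  exact ContinuousLinearMap.opNorm_le_bound₂ _ (by positivity) (norm_coulombForm_le f g)

/-- The quartic form as a continuous multilinear object. -/
def coulombQuartic : Hhalf →L[ℝ] Hhalf →L[ℝ] Hhalf →L[ℝ] Hhalf →L[ℝ] ℝ :=
  LinearMap.mkContinuous₂ (LinearMap.mk₂ ℝ coulombBilin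
    (fun f₁ f₂ g => by
      ext h k
      simp only [coulombBilin_apply, add_apply, coulombForm_add_left])
    (fun c f g => by
      ext h k
      simp only [coulombBilin_apply, smul_apply, coulombForm_smul_left,
        smul_eq_mul])
    (fun f g₁ g₂ => by
      ext h k
      simp only [coulombBilin_apply, add_apply, coulombForm_swap_left f,
        coulombForm_add_left])
    (fun c f g => by
      ext h k
      simp only [coulombBilin_apply, smul_apply, coulombForm_swap_left f,
        coulombForm_smul_left, smul_eq_mul]))
    (4 * gammaK) norm_coulombBilin_le

lemma coulombQuartic_apply (f g h k : Hhalf) : coulombQuartic f g h k = coulombForm f g h k := rfl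

/-! ### Positivity -/

lemma coulombForm_nonneg (f h : Hhalf) : 0 ≤ coulombForm f f h h :=
  integral_nonneg fun _ => div_nonneg (spinorPairing_self_nonneg _ _) (norm_nonneg _)

lemma rho_eq (ψ : Hhalf) (x : R3) : rho ψ x = (inner ℂ (toL2 ψ x) (toL2 ψ x)).re :=
  norm_sq_eq_re_inner (𝕜 := ℂ) _

lemma interaction_eq (ψ : Hhalf) : interaction ψ = coulombForm ψ ψ ψ ψ := by
  unfold interaction coulombForm coulombIntegrand spinorPairing
  simp only [rho_eq, current]

lemma integral_inv_sq_mul_inv_sq {x y : R3} (h : x ≠ y) :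
    ∫ z : R3, 1 / (‖x - z‖ ^ 2 * ‖y - z‖ ^ 2) = Real.pi ^ 3 / ‖x - y‖ := by
  have hl : ∫⁻ z : R3, ENNReal.ofReal (1 / (‖x - z‖ ^ 2 * ‖y - z‖ ^ 2)) =
      ENNReal.ofReal (Real.pi ^ 3 / ‖x - y‖) := by
    rw [norm_sub_rev x y, ← lintegral_inv_sq_mul_inv_sq (sub_ne_zero.2 h.symm),
      ← lintegral_sub_right_eq_self (fun k : R3 => ENNReal.ofReal (1 / (‖k‖ ^ 2 * ‖y - x - k‖ ^ 2))) x]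
    refine lintegral_congr fun z => ?_
    rw [norm_sub_rev x z, sub_sub_sub_cancel_right]
  rw [integral_eq_lintegral_of_nonneg_ae (ae_of_all _ fun z => by positivity), hl,
    ENNReal.toReal_ofReal (by positivity)]
  refine Measurable.aestronglyMeasurable ?_
  fun_prop

lemma ae_fst_ne_snd : ∀ᵐ z : R3 × R3, z.1 ≠ z.2 := by
  change ∀ᵐ z : R3 × R3 ∂(volume.prod volume), z.1 ≠ z.2
  have hm : MeasurableSet {z : R3 × R3 | z.1 ≠ z.2} :=
    (isOpen_ne_fun continuous_fst continuous_snd).measurableSet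
  rw [Measure.ae_prod_iff_ae_ae hm]
  refine ae_of_all _ fun x => ?_
  have : ∀ᵐ y : R3, y ≠ x := by simp [ae_iff]
  filter_upwards [this] with y hy using hy.symm

/-- The Coulomb kernel is positive definite. -/
lemma integral_mul_div_norm_sub_nonneg {j : R3 → ℝ} (hj : Measurable j)
    (hi : Integrable fun z : R3 × R3 => j z.1 * j z.2 / ‖z.1 - z.2‖) :
    0 ≤ ∫ z : R3 × R3, j z.1 * j z.2 / ‖z.1 - z.2‖ := by
  -- By the composition formula the kernel is a multiple of `∫ dw / (|x-w|² |y-w|²)`. After Fubini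
  -- the double integral becomes the integral over `w` of a square.
  obtain ⟨Θ, hΘ⟩ : ∃ Θ : (R3 × R3) × R3 → ℝ, Θ = fun p =>
    j p.1.1 * j p.1.2 * (1 / (‖p.1.1 - p.2‖ ^ 2 * ‖p.1.2 - p.2‖ ^ 2)) := ⟨_, rfl⟩
  have hm : Measurable Θ := by rw [hΘ]; fun_prop
  have hΘi : Integrable Θ (volume.prod volume) := by
    refine ⟨hm.aestronglyMeasurable, ?_⟩
    rw [hasFiniteIntegral_iff_norm, lintegral_prod _ (by fun_prop)]
    have h1 : ∀ᵐ z : R3 × R3, ∫⁻ w, ENNReal.ofReal ‖Θ (z, w)‖ =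
        ENNReal.ofReal (Real.pi ^ 3) * ENNReal.ofReal ‖j z.1 * j z.2 / ‖z.1 - z.2‖‖ := by
      filter_upwards [ae_fst_ne_snd] with z hz
      have h2 : ∀ w, ENNReal.ofReal ‖Θ (z, w)‖ = ENNReal.ofReal |j z.1 * j z.2| *
          ENNReal.ofReal (1 / (‖z.1 - w‖ ^ 2 * ‖z.2 - w‖ ^ 2)) := by
        intro w
        rw [← ENNReal.ofReal_mul (abs_nonneg _), hΘ, norm_mul, Real.norm_eq_abs,
          Real.norm_of_nonneg (by positivity)]
      have h3 : 0 < ‖z.1 - z.2‖ := norm_pos_iff.2 (sub_ne_zero.2 hz)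
      simp_rw [h2]
      rw [lintegral_const_mul' _ _ ENNReal.ofReal_ne_top, norm_div, norm_norm,
        ← ENNReal.ofReal_mul (by positivity)]
      have h4 := integral_inv_sq_mul_inv_sq hz
      have h5 : ∫⁻ w : R3, ENNReal.ofReal (1 / (‖z.1 - w‖ ^ 2 * ‖z.2 - w‖ ^ 2)) =
          ENNReal.ofReal (Real.pi ^ 3 / ‖z.1 - z.2‖) := by
        rw [← h4, ofReal_integral_eq_lintegral_ofReal]
        · by_contra hn
          rw [integral_undef hn] at h4
          have : 0 < Real.pi ^ 3 / ‖z.1 - z.2‖ := by positivity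
          linarith
        · exact ae_of_all _ fun w => by positivity
      rw [h5, ← ENNReal.ofReal_mul (abs_nonneg _), Real.norm_eq_abs]
      congr 1
      ring
    rw [lintegral_congr_ae h1, lintegral_const_mul' _ _ ENNReal.ofReal_ne_top]
    refine ENNReal.mul_lt_top ENNReal.ofReal_lt_top ?_
    have := hi.2
    rwa [hasFiniteIntegral_iff_norm] at this
  have h1 : ∫ z : R3 × R3, j z.1 * j z.2 / ‖z.1 - z.2‖ =
      (Real.pi ^ 3)⁻¹ * ∫ z : R3 × R3, ∫ w, Θ (z, w) := by
    rw [← integral_const_mul]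
    refine integral_congr_ae ?_
    filter_upwards [ae_fst_ne_snd] with z hz
    rw [hΘ]
    simp only
    rw [integral_const_mul, integral_inv_sq_mul_inv_sq hz]
    have := Real.pi_ne_zero
    field_simp
  have h2 : ∫ z : R3 × R3, ∫ w, Θ (z, w) = ∫ w, ∫ z : R3 × R3, Θ (z, w) :=
    integral_integral_swap hΘi
  rw [h1, h2]
  refine mul_nonneg (by positivity) (integral_nonneg fun w => ?_)
  have h3 : ∫ z : R3 × R3, Θ (z, w) =
      (∫ x, j x * (1 / ‖x - w‖ ^ 2)) * ∫ x, j x * (1 / ‖x - w‖ ^ 2) := by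
    rw [← integral_prod_mul]
    refine integral_congr_ae (ae_of_all _ fun z => ?_)
    rw [hΘ]
    simp only
    rw [one_div, mul_inv, one_div, one_div]
    ring
  simp only
  rw [h3]
  exact mul_self_nonneg _

lemma integrable_mul_div_of_le {ψ : Hhalf} {j : R3 → ℝ} (hj : Measurable j)
    (hle : ∀ x, |j x| ≤ ‖toL2 ψ x‖ * ‖toL2 ψ x‖) :
    Integrable fun z : R3 × R3 => j z.1 * j z.2 / ‖z.1 - z.2‖ := by
  refine ⟨Measurable.aestronglyMeasurable (by fun_prop), ?_⟩
  rw [hasFiniteIntegral_iff_norm]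
  refine lt_of_le_of_lt (lintegral_mono fun z => ENNReal.ofReal_le_ofReal ?_)
    ((lintegral_coulomb_le ψ ψ ψ ψ).trans_lt ENNReal.ofReal_lt_top)
  rw [norm_div, norm_norm, norm_mul, Real.norm_eq_abs, Real.norm_eq_abs]
  refine div_le_div_of_nonneg_right ?_ (norm_nonneg _)
  rw [mul_assoc (‖toL2 ψ z.1‖ * _)]
  exact mul_le_mul (hle _) (hle _) (abs_nonneg _) (by positivity)

lemma measurable_current (ψ : Hhalf) (k : Fin 3) : Measurable (current ψ k) := by
  have hm := measurable_coe (toL2 ψ)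
  have hc : Continuous fun v : C4 => (inner ℂ v (op (alpha k) v)).re :=
    Complex.continuous_re.comp (by fun_prop)
  exact hc.measurable.comp hm

/-- The interaction energy is dominated by the electrostatic energy, and hence by Kato's bound. -/
lemma coulombForm_self_le (ψ : Hhalf) :
    coulombForm ψ ψ ψ ψ ≤ gammaK * kinetic ψ * ‖toL2 ψ‖ ^ 2 := by
  have hm := measurable_coe (toL2 ψ)
  have hrm : Measurable (rho ψ) := by unfold rho; fun_prop
  have hrho := integrable_mul_div_of_le (ψ := ψ) hrm fun x => by
    rw [rho, abs_of_nonneg (by positivity), sq]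
  have hcur : ∀ k, Integrable fun z : R3 × R3 =>
      current ψ k z.1 * current ψ k z.2 / ‖z.1 - z.2‖ := fun k =>
    integrable_mul_div_of_le (measurable_current ψ k) fun x => abs_re_inner_alpha_le k _ _
  have h1 : coulombForm ψ ψ ψ ψ = (∫ z : R3 × R3, rho ψ z.1 * rho ψ z.2 / ‖z.1 - z.2‖) -
      ∑ k, ∫ z : R3 × R3, current ψ k z.1 * current ψ k z.2 / ‖z.1 - z.2‖ := by
    rw [← interaction_eq, interaction, ← integral_finsetSum _ fun k _ => hcur k,
      ← integral_sub hrho (integrable_finsetSum _ fun k _ => hcur k)]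
    refine integral_congr_ae (ae_of_all _ fun z => ?_)
    simp only
    rw [sub_div, Finset.sum_div]
  have h2 : 0 ≤ ∑ k, ∫ z : R3 × R3, current ψ k z.1 * current ψ k z.2 / ‖z.1 - z.2‖ :=
    Finset.sum_nonneg fun k _ => integral_mul_div_norm_sub_nonneg (measurable_current ψ k) (hcur k)
  have h3 : ∫ z : R3 × R3, rho ψ z.1 * rho ψ z.2 / ‖z.1 - z.2‖ ≤
      gammaK * kinetic ψ * ‖toL2 ψ‖ ^ 2 := by
    have hg := gammaK_pos
    have hk := kinetic_nonneg ψ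
    rw [← ENNReal.ofReal_le_ofReal_iff (by positivity), ofReal_integral_eq_lintegral_ofReal hrho
      (ae_of_all _ fun z => by unfold rho; positivity)]
    have h4 := lintegral_coulomb_le ψ ψ ψ ψ
    have h5 : gammaK * √(kinetic ψ) * √(kinetic ψ) * (‖toL2 ψ‖ * ‖toL2 ψ‖) =
        gammaK * kinetic ψ * ‖toL2 ψ‖ ^ 2 := by
      rw [mul_assoc gammaK, Real.mul_self_sqrt hk, sq]
    rw [h5] at h4
    refine le_of_eq_of_le (lintegral_congr fun z => ?_) h4
    simp only [rho]
    congr 2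
    ring
  linarith

/-- The quartic form is invariant under phase rotations to first order. -/
lemma coulombForm_I_smul (f g h : Hhalf) : coulombForm f g h (Complex.I • h) = 0 := by
  unfold coulombForm
  rw [← integral_zero (R3 × R3) ℝ]
  refine integral_congr_ae ?_
  filter_upwards [ae_snd (Lp.coeFn_smul Complex.I (toL2 h))] with z hz
  simp only [coulombIntegrand]
  rw [map_smul, hz, Pi.smul_apply, spinorPairing_I_smul, zero_div]

/-! ### A concave maximization problem with a quartic perturbation -/

/-- A space `E` of negative states inside `H`, with a weaker Hilbert seminorm on `H` and a small
quartic form. -/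
structure QuarticSetting (H E : Type*) [NormedAddCommGroup H] [InnerProductSpace ℝ H]
    [NormedAddCommGroup E] [InnerProductSpace ℝ E] where
  /-- the inclusion of the negative states -/
  incl : E →L[ℝ] H
  norm_incl : ∀ φ, ‖incl φ‖ = ‖φ‖
  /-- the weaker scalar product -/
  weak : H →L[ℝ] H →L[ℝ] ℝ
  /-- the weaker norm -/
  weakNorm : Seminorm ℝ H
  weak_comm : ∀ f g, weak f g = weak g f
  weak_self : ∀ f, weak f f = weakNorm f ^ 2
  abs_weak_le : ∀ f g, |weak f g| ≤ weakNorm f * weakNorm g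
  weakNorm_le : ∀ f, weakNorm f ≤ ‖f‖
  /-- the quartic form -/
  quartic : H →L[ℝ] H →L[ℝ] H →L[ℝ] H →L[ℝ] ℝ
  /-- the size of the quartic form -/
  size : ℝ
  size_nonneg : 0 ≤ size
  size_lt : size < 1 / 174
  quartic_swap_left : ∀ f g h k, quartic f g h k = quartic g f h k
  quartic_swap : ∀ f g h k, quartic f g h k = quartic h k f g
  abs_quartic_le : ∀ f g h k,
    |quartic f g h k| ≤ 4 * size * (‖f‖ * ‖g‖ * (weakNorm h * weakNorm k))
  quartic_self_nonneg : ∀ f, 0 ≤ quartic f f f f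
  quartic_self_le : ∀ f, quartic f f f f ≤ size * ‖f‖ ^ 2 * weakNorm f ^ 2

lemma hasDerivAt_quartic {H : Type*} [NormedAddCommGroup H] [NormedSpace ℝ H]
    (T : H →L[ℝ] H →L[ℝ] H →L[ℝ] H →L[ℝ] ℝ) {u v x y : ℝ → H} {u' v' x' y' : H} {t : ℝ}
    (hu : HasDerivAt u u' t) (hv : HasDerivAt v v' t) (hx : HasDerivAt x x' t)
    (hy : HasDerivAt y y' t) :
    HasDerivAt (fun s => T (u s) (v s) (x s) (y s))
      (T u' (v t) (x t) (y t) + T (u t) v' (x t) (y t) + T (u t) (v t) x' (y t) +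
        T (u t) (v t) (x t) y') t := by
  have h1 : HasDerivAt (fun s => T (u s)) (T u') t := T.hasFDerivAt.comp_hasDerivAt t hu
  have h2 := ((h1.clm_apply hv).clm_apply hx).clm_apply hy
  simpa [add_apply] using h2

/-- A second order Taylor estimate. -/
lemma le_of_second_deriv_le {g g' g'' : ℝ → ℝ} {c : ℝ}
    (h1 : ∀ t ∈ Icc (0 : ℝ) 1, HasDerivAt g (g' t) t)
    (h2 : ∀ t ∈ Icc (0 : ℝ) 1, HasDerivAt g' (g'' t) t)
    (h3 : ∀ t ∈ Icc (0 : ℝ) 1, g'' t ≤ -c) : g 1 ≤ g 0 + g' 0 - c / 2 := by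
  have hanti : ∀ {k k' : ℝ → ℝ}, (∀ t ∈ Icc (0 : ℝ) 1, HasDerivAt k (k' t) t) →
      (∀ t ∈ Icc (0 : ℝ) 1, k' t ≤ 0) → AntitoneOn k (Icc 0 1) := by
    intro k k' hk hk'
    refine antitoneOn_of_deriv_nonpos (convex_Icc 0 1)
      (fun t ht => (hk t ht).continuousAt.continuousWithinAt)
      (fun t ht => (hk t (interior_subset ht)).differentiableAt.differentiableWithinAt)
      fun t ht => ?_
    rw [(hk t (interior_subset ht)).deriv]
    exact hk' t (interior_subset ht)
  have h0 : (0 : ℝ) ∈ Icc (0 : ℝ) 1 := by simp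
  have h4 : AntitoneOn (fun t => g' t + c * t) (Icc 0 1) := by
    refine hanti (k' := fun t => g'' t + c) (fun t ht => ?_) fun t ht => by linarith [h3 t ht]
    simpa using (h2 t ht).fun_add ((hasDerivAt_id t).const_mul c)
  have h5 : AntitoneOn (fun t => g t - g' 0 * t + c / 2 * t ^ 2) (Icc 0 1) := by
    refine hanti (k' := fun t => g' t - g' 0 + c * t) (fun t ht => ?_) fun t ht => ?_
    · have := ((h1 t ht).sub ((hasDerivAt_id t).const_mul (g' 0))).add
        ((hasDerivAt_pow 2 t).const_mul (c / 2))
      convert! this using 1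
      simp
      ring
    · have := h4 h0 ht ht.1
      simp only [mul_zero, add_zero] at this
      linarith
  have h6 := h5 h0 (by simp : (1 : ℝ) ∈ Icc (0 : ℝ) 1) zero_le_one
  simp only at h6
  linarith

/-! ### Derivatives of the energy along lines -/

namespace QuarticSetting

variable {H E : Type*} [NormedAddCommGroup H] [InnerProductSpace ℝ H]
  [NormedAddCommGroup E] [InnerProductSpace ℝ E] (S : QuarticSetting H E)

/-- The amplitude `√(1 - |φ|²)` of the positive part. -/
def amp (φ : E) : ℝ := √(1 - S.weak (S.incl φ) (S.incl φ))

/-- The normalized state with positive direction `w` and negative part `φ`. -/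
def state (w : H) (φ : E) : H := S.amp φ • w + S.incl φ

/-- The energy to be maximized. -/
def energy (w : H) (φ : E) : ℝ :=
  ‖w‖ ^ 2 - (‖φ‖ ^ 2 + ‖w‖ ^ 2 * S.weak (S.incl φ) (S.incl φ)) -
    S.quartic (S.state w φ) (S.state w φ) (S.state w φ) (S.state w φ)

/-- The weak scalar product on negative states. -/
def weakE : E →L[ℝ] E →L[ℝ] ℝ := S.weak.bilinearComp S.incl S.incl

lemma weakE_apply (φ h : E) : S.weakE φ h = S.weak (S.incl φ) (S.incl h) := rfl

/-- The gradient of the energy. -/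
def grad (w : H) (φ : E) : E →L[ℝ] ℝ :=
  -((2 : ℝ) • innerSL ℝ φ) - (2 * ‖w‖ ^ 2) • S.weakE φ -
    (4 : ℝ) • ((S.quartic (S.state w φ) (S.state w φ) (S.state w φ)).comp S.incl -
      (S.quartic (S.state w φ) (S.state w φ) (S.state w φ) w / S.amp φ) • S.weakE φ)

/-- The derivative of the state. -/
def dstate (w : H) (φ h : E) : H := (-(S.weakE φ h) / S.amp φ) • w + S.incl h

/-- The definition of `grad` displays a linear functional whose smooth dependence on `(w, φ)` is
visible. This is the equivalent form given by the chain rule, with the quartic form evaluated on the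
derivative of the state. -/
lemma grad_apply (w : H) (φ h : E) : S.grad w φ h =
    -2 * inner ℝ φ h - 2 * ‖w‖ ^ 2 * S.weakE φ h -
      4 * S.quartic (S.state w φ) (S.state w φ) (S.state w φ) (S.dstate w φ h) := by
  simp only [grad, dstate, sub_apply, neg_apply, smul_apply, innerSL_apply_apply,
    ContinuousLinearMap.comp_apply, map_add, map_smul, smul_eq_mul]
  ring

/-- The second derivative of the state. -/
def ddstate (w : H) (φ h : E) : H :=
  (-(S.weakE h h) / S.amp φ - (S.weakE φ h) ^ 2 / S.amp φ ^ 3) • w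

/-- The second derivative of the energy. -/
def hess (w : H) (φ h : E) : ℝ :=
  -2 * ‖h‖ ^ 2 - 2 * ‖w‖ ^ 2 * S.weakE h h -
    (8 * S.quartic (S.state w φ) (S.dstate w φ h) (S.state w φ) (S.dstate w φ h) +
      4 * S.quartic (S.state w φ) (S.state w φ) (S.dstate w φ h) (S.dstate w φ h) +
      4 * S.quartic (S.state w φ) (S.state w φ) (S.state w φ) (S.ddstate w φ h))

lemma quartic_swap_right (f g h k : H) : S.quartic f g h k = S.quartic f g k h := by
  rw [S.quartic_swap, S.quartic_swap_left, S.quartic_swap]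

lemma weakE_comm (φ h : E) : S.weakE φ h = S.weakE h φ := S.weak_comm _ _

lemma weakE_line (φ h : E) (t : ℝ) : S.weakE (φ + t • h) h = S.weakE φ h + t * S.weakE h h := by
  simp [add_apply, smul_apply]

lemma weakE_line_self (φ h : E) (t : ℝ) : S.weakE (φ + t • h) (φ + t • h) =
    S.weakE φ φ + 2 * t * S.weakE φ h + t ^ 2 * S.weakE h h := by
  simp only [map_add, map_smul, add_apply, smul_apply, smul_eq_mul, S.weakE_comm h φ]
  ring

lemma amp_eq (φ : E) : S.amp φ = √(1 - S.weakE φ φ) := rfl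

lemma amp_pos {φ : E} (h : S.weakE φ φ < 1) : 0 < S.amp φ := Real.sqrt_pos.2 (by
  rw [← weakE_apply]; linarith)

lemma hasDerivAt_amp (φ h : E) {t : ℝ} (ht : S.weakE (φ + t • h) (φ + t • h) < 1) :
    HasDerivAt (fun s : ℝ => S.amp (φ + s • h))
      (-(S.weakE (φ + t • h) h) / S.amp (φ + t • h)) t := by
  have h1 : HasDerivAt (fun s : ℝ => 1 - S.weakE (φ + s • h) (φ + s • h))
      (-(2 * S.weakE (φ + t • h) h)) t := by
    simp_rw [weakE_line_self]
    have := (((hasDerivAt_id t).const_mul 2).mul_const (S.weakE φ h)).const_add (S.weakE φ φ)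
      |>.add ((hasDerivAt_pow 2 t).mul_const (S.weakE h h))
    have := this.const_sub 1
    convert! this using 1
    rw [weakE_line]
    simp
    ring
  have h2 := h1.sqrt (by linarith)
  refine h2.congr_deriv ?_
  rw [amp_eq, neg_div, neg_div, mul_div_mul_left _ _ two_ne_zero]

lemma hasDerivAt_line (φ h : E) (t : ℝ) : HasDerivAt (fun s : ℝ => φ + s • h) h t := by
  simpa using ((hasDerivAt_id t).smul_const h).const_add φ

lemma hasDerivAt_state (w : H) (φ h : E) {t : ℝ} (ht : S.weakE (φ + t • h) (φ + t • h) < 1) :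
    HasDerivAt (fun s : ℝ => S.state w (φ + s • h)) (S.dstate w (φ + t • h) h) t :=
  ((S.hasDerivAt_amp φ h ht).smul_const w).add
    (S.incl.hasFDerivAt.comp_hasDerivAt t (hasDerivAt_line φ h t))

lemma hasDerivAt_dstate (w : H) (φ h : E) {t : ℝ} (ht : S.weakE (φ + t • h) (φ + t • h) < 1) :
    HasDerivAt (fun s : ℝ => S.dstate w (φ + s • h) h) (S.ddstate w (φ + t • h) h) t := by
  have ha := S.amp_pos ht
  have h1 : HasDerivAt (fun s : ℝ => -(S.weakE (φ + s • h) h)) (-(S.weakE h h)) t := by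
    simp_rw [weakE_line]
    have := (((hasDerivAt_id t).mul_const (S.weakE h h)).const_add (S.weakE φ h)).fun_neg
    rwa [one_mul] at this
  have h2 := h1.div (S.hasDerivAt_amp φ h ht) ha.ne'
  refine ((h2.smul_const w).add_const (S.incl h)).congr_deriv ?_
  rw [ddstate]
  congr 1
  field_simp

lemma hasDerivAt_energy (w : H) (φ h : E) {t : ℝ} (ht : S.weakE (φ + t • h) (φ + t • h) < 1) :
    HasDerivAt (fun s : ℝ => S.energy w (φ + s • h)) (S.grad w (φ + t • h) h) t := by
  have hs := S.hasDerivAt_state w φ h ht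
  have h1 := hasDerivAt_quartic S.quartic hs hs hs hs
  have h2 : HasDerivAt (fun s : ℝ => ‖φ + s • h‖ ^ 2) (2 * inner ℝ (φ + t • h) h) t :=
    (hasDerivAt_line φ h t).norm_sq
  have h3 : HasDerivAt (fun s : ℝ => S.weakE (φ + s • h) (φ + s • h))
      (2 * S.weakE (φ + t • h) h) t := by
    have := (S.weakE.hasFDerivAt.comp_hasDerivAt t (hasDerivAt_line φ h t)).clm_apply
      (hasDerivAt_line φ h t)
    refine this.congr_deriv ?_
    simp only [Function.comp]
    rw [S.weakE_comm h]
    ring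
  have h4 := ((h2.add (h3.const_mul (‖w‖ ^ 2))).const_sub (‖w‖ ^ 2)).sub h1
  refine h4.congr_deriv ?_
  set ψ := S.state w (φ + t • h)
  set ψ' := S.dstate w (φ + t • h) h
  -- The symmetries of the quartic form make the four terms of the product rule equal.
  rw [grad_apply, S.quartic_swap_left ψ' ψ ψ ψ, S.quartic_swap ψ ψ' ψ ψ,
    S.quartic_swap_right ψ ψ ψ' ψ]
  ring

lemma hasDerivAt_grad (w : H) (φ h : E) {t : ℝ} (ht : S.weakE (φ + t • h) (φ + t • h) < 1) :
    HasDerivAt (fun s : ℝ => S.grad w (φ + s • h) h) (S.hess w (φ + t • h) h) t := by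
  have hs := S.hasDerivAt_state w φ h ht
  have h1 := hasDerivAt_quartic S.quartic hs hs hs (S.hasDerivAt_dstate w φ h ht)
  have h2 : HasDerivAt (fun s : ℝ => inner ℝ (φ + s • h) h) (‖h‖ ^ 2) t := by
    have := (hasDerivAt_line φ h t).inner ℝ (hasDerivAt_const t h)
    simpa using this
  have h3 : HasDerivAt (fun s : ℝ => S.weakE (φ + s • h) h) (S.weakE h h) t := by
    simp_rw [weakE_line]
    simpa using ((hasDerivAt_id t).mul_const (S.weakE h h)).const_add (S.weakE φ h)
  have h4 := ((h2.const_mul (-2)).sub (h3.const_mul (2 * ‖w‖ ^ 2))).sub (h1.const_mul 4)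
  simp_rw [grad_apply]
  refine h4.congr_deriv ?_
  rw [hess]
  set ψ := S.state w (φ + t • h)
  set ψ' := S.dstate w (φ + t • h) h
  rw [S.quartic_swap_left ψ' ψ ψ ψ']
  ring

/-! ### Strong concavity near zero -/

/-- The natural strong norm of the problem, squared. -/
def strongSq (w : H) (φ : E) : ℝ := ‖φ‖ ^ 2 + ‖w‖ ^ 2 * S.weakE φ φ

lemma weakE_self (φ : E) : S.weakE φ φ = S.weakNorm (S.incl φ) ^ 2 := S.weak_self _

lemma weakE_self_nonneg (φ : E) : 0 ≤ S.weakE φ φ := by rw [weakE_self]; positivity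

lemma norm_sq_le_strongSq (w : H) (φ : E) : ‖φ‖ ^ 2 ≤ S.strongSq w φ := by
  have := S.weakE_self_nonneg φ
  unfold strongSq
  nlinarith [sq_nonneg ‖w‖, mul_nonneg (sq_nonneg ‖w‖) this]

/-- The region of strict concavity. -/
def region (w : H) : Set E := {φ | S.strongSq w φ ≤ ‖w‖ ^ 2 / 174}

variable {S}

lemma one_le_norm {w : H} (hw : S.weakNorm w = 1) : 1 ≤ ‖w‖ := hw ▸ S.weakNorm_le w

/-- Each of the two terms of `strongSq` is at most `‖w‖²/174`, and `174 > 13²`. -/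
lemma bounds_of_mem_region {w : H} (hw : S.weakNorm w = 1) {φ : E} (hφ : φ ∈ S.region w) :
    ‖φ‖ ≤ ‖w‖ / 13 ∧ S.weakNorm (S.incl φ) ≤ 1 / 13 := by
  have h1 := one_le_norm hw
  have hφ : ‖φ‖ ^ 2 + ‖w‖ ^ 2 * S.weakE φ φ ≤ ‖w‖ ^ 2 / 174 := hφ
  rw [weakE_self] at hφ
  have hn := apply_nonneg S.weakNorm (S.incl φ)
  constructor
  · refine abs_le_of_sq_le_sq' ?_ (by positivity) |>.2
    have := mul_nonneg (sq_nonneg ‖w‖) (sq_nonneg (S.weakNorm (S.incl φ)))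
    rw [div_pow]
    nlinarith [sq_nonneg ‖w‖]
  · refine abs_le_of_sq_le_sq' ?_ (by positivity) |>.2
    have h2 : ‖w‖ ^ 2 * S.weakNorm (S.incl φ) ^ 2 ≤ ‖w‖ ^ 2 * (1 / 174) := by
      nlinarith [sq_nonneg ‖φ‖]
    have := le_of_mul_le_mul_left h2 (by positivity)
    linarith

lemma weakE_lt_one_of_mem_region {w : H} (hw : S.weakNorm w = 1) {φ : E}
    (hφ : φ ∈ S.region w) : S.weakE φ φ < 1 := by
  have := (bounds_of_mem_region hw hφ).2
  have hn := apply_nonneg S.weakNorm (S.incl φ)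
  rw [weakE_self]
  nlinarith

set_option maxHeartbeats 1000000 in
-- The quadratic part of the energy contributes exactly `-2 strongSq h`. In the region the state
-- stays close to `w`, so the quartic terms are at most `size` times a constant times `strongSq h`,
-- and `size < 1/174` makes them cost no more than half of this.
lemma hess_le {w : H} (hw : S.weakNorm w = 1) {φ : E} (hφ : φ ∈ S.region w) (h : E) :
    S.hess w φ h ≤ -S.strongSq w h := by
  obtain ⟨hφ1, hφ2⟩ := bounds_of_mem_region hw hφ
  have hW := one_le_norm hw
  have hn0 := apply_nonneg S.weakNorm (S.incl φ)
  obtain ⟨r, hr⟩ : ∃ r, r = S.weakNorm (S.incl h) := ⟨_, rfl⟩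
  have hr0 : 0 ≤ r := hr ▸ apply_nonneg S.weakNorm _
  obtain ⟨x, hx⟩ : ∃ x, x = ‖h‖ := ⟨_, rfl⟩
  have hx0 : 0 ≤ x := hx ▸ norm_nonneg _
  obtain ⟨W, hWe⟩ : ∃ W, W = ‖w‖ := ⟨_, rfl⟩
  rw [← hWe] at hW hφ1
  have hlt := weakE_lt_one_of_mem_region hw hφ
  have ha0 := S.amp_pos hlt
  have hasq : S.amp φ ^ 2 = 1 - S.weakNorm (S.incl φ) ^ 2 := by
    rw [amp_eq, Real.sq_sqrt (by linarith), weakE_self]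
  obtain ⟨a, ha⟩ : ∃ a, a = S.amp φ := ⟨_, rfl⟩
  obtain ⟨p, hp⟩ : ∃ p, p = S.weakNorm (S.incl φ) := ⟨_, rfl⟩
  rw [← ha] at ha0 hasq
  rw [← hp] at hn0 hφ2 hasq
  have ha1 : a ≤ 1 := by nlinarith
  -- As `a ≤ 1`, one has `a ≥ a² ≥ 1 - 1/169`.
  have ha2 : 168 / 169 ≤ a := by nlinarith
  have hJ : |S.weakE φ h| ≤ p * r := by
    rw [hp, hr]; exact S.abs_weak_le _ _
  have hinv : a⁻¹ ≤ 169 / 168 := by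
    rw [inv_le_comm₀ ha0 (by norm_num)]; norm_num; linarith
  have hinv0 : 0 ≤ a⁻¹ := by positivity
  -- the state
  have hψ : ‖S.state w φ‖ ≤ 14 / 13 * W := by
    refine (norm_add_le _ _).trans ?_
    rw [norm_smul, S.norm_incl, Real.norm_eq_abs, ← ha, abs_of_pos ha0, ← hWe]
    nlinarith
  have hψn : S.weakNorm (S.state w φ) ≤ 14 / 13 := by
    refine (map_add_le_add _ _ _).trans ?_
    rw [map_smul_eq_mul, hw, Real.norm_eq_abs, ← ha, abs_of_pos ha0, ← hp]
    linarith
  -- its first derivative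
  have hc1 : |-(S.weakE φ h) / S.amp φ| ≤ r / 12 := by
    rw [abs_div, abs_neg, ← ha, abs_of_pos ha0, div_eq_mul_inv]
    calc |S.weakE φ h| * a⁻¹ ≤ (1 / 13 * r) * (169 / 168) := by
          refine mul_le_mul (hJ.trans ?_) hinv hinv0 (by positivity)
          exact mul_le_mul_of_nonneg_right hφ2 hr0
      _ ≤ r / 12 := by linarith
  have hψ' : ‖S.dstate w φ h‖ ≤ W * r / 12 + x := by
    refine (norm_add_le _ _).trans ?_
    rw [norm_smul, S.norm_incl, Real.norm_eq_abs, ← hWe, ← hx]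
    have := mul_le_mul_of_nonneg_right hc1 (by linarith : 0 ≤ W)
    linarith
  have hψn' : S.weakNorm (S.dstate w φ h) ≤ 13 / 12 * r := by
    refine (map_add_le_add _ _ _).trans ?_
    rw [map_smul_eq_mul, hw, Real.norm_eq_abs, ← hr]
    linarith
  -- its second derivative
  have hc2 : |-(S.weakE h h) / S.amp φ - (S.weakE φ h) ^ 2 / S.amp φ ^ 3| ≤ 13 / 12 * r ^ 2 := by
    have e1 : S.weakE h h = r ^ 2 := by rw [weakE_self, hr]
    have e2 : (S.weakE φ h) ^ 2 ≤ (1 / 13 * r) ^ 2 := by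
      rw [← sq_abs]
      exact pow_le_pow_left₀ (abs_nonneg _)
        (hJ.trans (mul_le_mul_of_nonneg_right hφ2 hr0)) 2
    have e3 : (a⁻¹) ^ 3 ≤ (169 / 168) ^ 3 := pow_le_pow_left₀ hinv0 hinv 3
    rw [e1, ← ha]
    refine (abs_sub _ _).trans ?_
    rw [abs_div, abs_neg, abs_of_nonneg (sq_nonneg r), abs_of_pos ha0, abs_div,
      abs_of_nonneg (sq_nonneg (S.weakE φ h)), abs_of_pos (pow_pos ha0 3), div_eq_mul_inv,
      div_eq_mul_inv, ← inv_pow]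
    calc r ^ 2 * a⁻¹ + (S.weakE φ h) ^ 2 * a⁻¹ ^ 3
        ≤ r ^ 2 * (169 / 168) + (1 / 13 * r) ^ 2 * (169 / 168) ^ 3 := by gcongr
      _ ≤ 13 / 12 * r ^ 2 := by nlinarith [sq_nonneg r]
  have hψn'' : S.weakNorm (S.ddstate w φ h) ≤ 13 / 12 * r ^ 2 := by
    rw [ddstate, map_smul_eq_mul, hw, Real.norm_eq_abs, mul_one]
    exact hc2
  -- the three quartic terms
  have hs0 := S.size_nonneg
  have hs1 := S.size_lt
  have q0 := fun f => apply_nonneg S.weakNorm f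
  have t1 : |S.quartic (S.state w φ) (S.dstate w φ h) (S.state w φ) (S.dstate w φ h)| ≤
      4 * S.size * ((14 / 13 * W) * (W * r / 12 + x) * ((14 / 13) * (13 / 12 * r))) := by
    refine (S.abs_quartic_le _ _ _ _).trans ?_
    gcongr
  have t2 : |S.quartic (S.state w φ) (S.state w φ) (S.dstate w φ h) (S.dstate w φ h)| ≤
      4 * S.size * ((14 / 13 * W) * (14 / 13 * W) * ((13 / 12 * r) * (13 / 12 * r))) := by
    refine (S.abs_quartic_le _ _ _ _).trans ?_
    gcongr
  have t3 : |S.quartic (S.state w φ) (S.state w φ) (S.state w φ) (S.ddstate w φ h)| ≤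
      4 * S.size * ((14 / 13 * W) * (14 / 13 * W) * ((14 / 13) * (13 / 12 * r ^ 2))) := by
    refine (S.abs_quartic_le _ _ _ _).trans ?_
    gcongr
  -- In the variables `x = ‖h‖` and `y = ‖w‖ r` the strong norm squared of `h` is `x² + y²`, and the
  -- bounds on the quartic terms become homogeneous quadratic forms in `(x, y)`.
  obtain ⟨y, hy⟩ : ∃ y, y = W * r := ⟨_, rfl⟩
  have hy0 : 0 ≤ y := by rw [hy]; positivity
  have t1' : 4 * S.size * ((14 / 13 * W) * (W * r / 12 + x) * ((14 / 13) * (13 / 12 * r))) =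
      S.size * (4 * (14 / 13) * (14 / 13) * (13 / 12) * (y * (y / 12 + x))) := by rw [hy]; ring
  have t2' : 4 * S.size * ((14 / 13 * W) * (14 / 13 * W) * ((13 / 12 * r) * (13 / 12 * r))) =
      S.size * (4 * (14 / 13) * (14 / 13) * (13 / 12) * (13 / 12) * y ^ 2) := by rw [hy]; ring
  have t3' : 4 * S.size * ((14 / 13 * W) * (14 / 13 * W) * ((14 / 13) * (13 / 12 * r ^ 2))) =
      S.size * (4 * (14 / 13) * (14 / 13) * (14 / 13) * (13 / 12) * y ^ 2) := by rw [hy]; ring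
  rw [t1'] at t1
  rw [t2'] at t2
  rw [t3'] at t3
  have e1 : ‖w‖ ^ 2 * S.weakE h h = y ^ 2 := by rw [weakE_self, ← hWe, ← hr, hy]; ring
  have hfin : S.size * (8 * (4 * (14 / 13) * (14 / 13) * (13 / 12) * (y * (y / 12 + x))) +
      4 * (4 * (14 / 13) * (14 / 13) * (13 / 12) * (13 / 12) * y ^ 2) +
      4 * (4 * (14 / 13) * (14 / 13) * (14 / 13) * (13 / 12) * y ^ 2)) ≤ x ^ 2 + y ^ 2 := by
    have hq : 8 * (4 * (14 / 13) * (14 / 13) * (13 / 12) * (y * (y / 12 + x))) +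
      4 * (4 * (14 / 13) * (14 / 13) * (13 / 12) * (13 / 12) * y ^ 2) +
      -- Bounding `xy` by `(x² + y²)/2` leaves both coefficients well below 174.
      4 * (4 * (14 / 13) * (14 / 13) * (14 / 13) * (13 / 12) * y ^ 2) ≤ 174 * (x ^ 2 + y ^ 2) := by
      nlinarith [sq_nonneg (x - y), sq_nonneg x, sq_nonneg y]
    calc _ ≤ S.size * (174 * (x ^ 2 + y ^ 2)) := mul_le_mul_of_nonneg_left hq hs0
      _ ≤ 1 / 174 * (174 * (x ^ 2 + y ^ 2)) := by gcongr
      _ = _ := by ring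
  have b1 := (abs_le.1 t1).1
  have b2 := (abs_le.1 t2).1
  have b3 := (abs_le.1 t3).1
  unfold hess strongSq
  rw [← hx, mul_assoc 2, e1]
  linarith

end QuarticSetting

/-! ### Existence and uniqueness of the maximizer -/

namespace QuarticSetting

variable {H E : Type*} [NormedAddCommGroup H] [InnerProductSpace ℝ H]
  [NormedAddCommGroup E] [InnerProductSpace ℝ E] {S : QuarticSetting H E}

/-- Squares of seminorms are convex. Hence the region is convex and the Hessian bound holds all
along segments in it. -/
lemma strongSq_line_le (w : H) (φ η : E) {t : ℝ} (ht : t ∈ Icc (0 : ℝ) 1) :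
    S.strongSq w (φ + t • (η - φ)) ≤ (1 - t) * S.strongSq w φ + t * S.strongSq w η := by
  obtain ⟨h0, h1⟩ := ht
  have e : φ + t • (η - φ) = (1 - t) • φ + t • η := by module
  have hsq : ∀ {x y z : ℝ}, 0 ≤ z → z ≤ (1 - t) * x + t * y →
      z ^ 2 ≤ (1 - t) * x ^ 2 + t * y ^ 2 := by
    intro x y z hz h
    calc z ^ 2 ≤ ((1 - t) * x + t * y) ^ 2 := pow_le_pow_left₀ hz h 2
      _ = (1 - t) * x ^ 2 + t * y ^ 2 - (1 - t) * t * (x - y) ^ 2 := by ring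
      _ ≤ _ := by
        have : 0 ≤ (1 - t) * t * (x - y) ^ 2 :=
          mul_nonneg (mul_nonneg (by linarith) h0) (sq_nonneg _)
        linarith
  have a1 : ‖φ + t • (η - φ)‖ ^ 2 ≤ (1 - t) * ‖φ‖ ^ 2 + t * ‖η‖ ^ 2 := by
    refine hsq (norm_nonneg _) ?_
    rw [e]
    refine (norm_add_le _ _).trans ?_
    rw [norm_smul, norm_smul, Real.norm_of_nonneg h0, Real.norm_of_nonneg (by linarith)]
  have a2 : S.weakE (φ + t • (η - φ)) (φ + t • (η - φ)) ≤
      (1 - t) * S.weakE φ φ + t * S.weakE η η := by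
    rw [weakE_self, weakE_self, weakE_self]
    refine hsq (apply_nonneg _ _) ?_
    rw [e, map_add, map_smul, map_smul]
    refine (map_add_le_add _ _ _).trans ?_
    rw [map_smul_eq_mul, map_smul_eq_mul, Real.norm_of_nonneg h0,
      Real.norm_of_nonneg (by linarith)]
  unfold strongSq
  nlinarith [mul_le_mul_of_nonneg_left a2 (sq_nonneg ‖w‖)]

lemma line_mem_region {w : H} {φ η : E} (hφ : φ ∈ S.region w) (hη : η ∈ S.region w) {t : ℝ}
    (ht : t ∈ Icc (0 : ℝ) 1) : φ + t • (η - φ) ∈ S.region w := by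
  refine (strongSq_line_le w φ η ht).trans ?_
  have hφ : S.strongSq w φ ≤ ‖w‖ ^ 2 / 174 := hφ
  have hη : S.strongSq w η ≤ ‖w‖ ^ 2 / 174 := hη
  have h1 := mul_le_mul_of_nonneg_left hφ (by linarith [ht.2] : 0 ≤ 1 - t)
  have h2 := mul_le_mul_of_nonneg_left hη ht.1
  linarith

/-- Strong concavity of the energy on the region. -/
lemma energy_le {w : H} (hw : S.weakNorm w = 1) {φ η : E} (hφ : φ ∈ S.region w)
    (hη : η ∈ S.region w) :
    S.energy w η ≤ S.energy w φ + S.grad w φ (η - φ) - S.strongSq w (η - φ) / 2 := by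
  have hlt : ∀ t ∈ Icc (0 : ℝ) 1,
      S.weakE (φ + t • (η - φ)) (φ + t • (η - φ)) < 1 := fun t ht =>
    weakE_lt_one_of_mem_region hw (line_mem_region hφ hη ht)
  have h := le_of_second_deriv_le
    (fun t ht => S.hasDerivAt_energy w φ (η - φ) (hlt t ht))
    (fun t ht => S.hasDerivAt_grad w φ (η - φ) (hlt t ht))
    (fun t ht => hess_le hw (line_mem_region hφ hη ht) (η - φ))
  simpa using h

lemma strongSq_nonneg (w : H) (φ : E) : 0 ≤ S.strongSq w φ :=
  (sq_nonneg _).trans (S.norm_sq_le_strongSq w φ)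

/-- Only the sign of the diagonal quartic form enters, so the bound holds for every `φ`, also where
the weak norm exceeds 1 and `amp` takes the default value 0 of the square root. -/
lemma energy_le_sub_strongSq (w : H) (φ : E) : S.energy w φ ≤ ‖w‖ ^ 2 - S.strongSq w φ := by
  have := S.quartic_self_nonneg (S.state w φ)
  unfold energy strongSq
  rw [weakE_apply]
  linarith

lemma state_zero (w : H) : S.state w 0 = w := by
  simp [state, amp]

lemma strongSq_zero (w : H) : S.strongSq w 0 = 0 := by simp [strongSq]

lemma energy_zero_ge {w : H} (hw : S.weakNorm w = 1) :
    ‖w‖ ^ 2 - S.size * ‖w‖ ^ 2 ≤ S.energy w 0 := by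
  have := S.quartic_self_le w
  rw [hw] at this
  unfold energy
  rw [state_zero]
  simp
  linarith

lemma zero_mem_region (w : H) : (0 : E) ∈ S.region w := by
  change S.strongSq w 0 ≤ _
  rw [strongSq_zero]; positivity

lemma continuous_energy (w : H) : Continuous (S.energy w) := by
  have h1 : Continuous fun φ => S.state w φ := by
    unfold state amp; fun_prop
  unfold energy
  fun_prop

lemma isClosed_region (w : H) : IsClosed (S.region w) := by
  unfold region strongSq
  exact isClosed_le (by fun_prop) continuous_const

/-- Points of almost maximal energy are close to each other. -/
lemma norm_sub_sq_le {w : H} (hw : S.weakNorm w = 1) {φ η : E} (hφ : φ ∈ S.region w)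
    (hη : η ∈ S.region w) {s δ : ℝ} (hs : ∀ ζ ∈ S.region w, S.energy w ζ ≤ s)
    (h1 : s - δ ≤ S.energy w φ) (h2 : s - δ ≤ S.energy w η) : ‖η - φ‖ ^ 2 ≤ 8 * δ := by
  -- Concavity is expanded about the midpoint: adding the two estimates cancels the gradient and
  -- leaves `2δ ≥ ‖η - φ‖²/4`.
  have hm : φ + (1 / 2 : ℝ) • (η - φ) ∈ S.region w :=
    line_mem_region hφ hη ⟨by norm_num, by norm_num⟩
  set μ := φ + (1 / 2 : ℝ) • (η - φ) with hμ
  have e1 : φ - μ = -((1 / 2 : ℝ) • (η - φ)) := by rw [hμ]; module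
  have e2 : η - μ = (1 / 2 : ℝ) • (η - φ) := by rw [hμ]; module
  have a1 := energy_le hw hm hφ
  have a2 := energy_le hw hm hη
  have b1 := S.norm_sq_le_strongSq w (φ - μ)
  have b2 := S.norm_sq_le_strongSq w (η - μ)
  have b3 := hs μ hm
  rw [e1] at a1 b1
  rw [e2] at a2 b2
  rw [norm_neg] at b1
  rw [map_neg] at a1
  have hn : ‖(1 / 2 : ℝ) • (η - φ)‖ ^ 2 = ‖η - φ‖ ^ 2 / 4 := by
    rw [norm_smul, mul_pow]; norm_num; ring
  rw [hn] at b1 b2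
  linarith

/-- By strong concavity every maximizing sequence is Cauchy in norm. The limit exists by
completeness, and continuity of the energy replaces any weak semicontinuity. -/
lemma exists_isMaxOn_region [CompleteSpace E] {w : H} (hw : S.weakNorm w = 1) :
    ∃ φ ∈ S.region w, ∀ η ∈ S.region w, S.energy w η ≤ S.energy w φ := by
  have hbdd : BddAbove (S.energy w '' S.region w) := by
    refine ⟨‖w‖ ^ 2, ?_⟩
    rintro _ ⟨φ, -, rfl⟩
    linarith [energy_le_sub_strongSq (S := S) w φ, strongSq_nonneg (S := S) w φ]
  have hne : (S.energy w '' S.region w).Nonempty := ⟨_, 0, zero_mem_region w, rfl⟩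
  set s := sSup (S.energy w '' S.region w) with hs
  have hle : ∀ ζ ∈ S.region w, S.energy w ζ ≤ s := fun ζ hζ => le_csSup hbdd ⟨ζ, hζ, rfl⟩
  have hex : ∀ k : ℕ, ∃ φ ∈ S.region w, s - 1 / ((k : ℝ) + 1) ≤ S.energy w φ := by
    intro k
    obtain ⟨_, ⟨φ, hφ, rfl⟩, h⟩ := exists_lt_of_lt_csSup hne
      (sub_lt_self s (Nat.one_div_pos_of_nat (α := ℝ) (n := k)))
    exact ⟨φ, hφ, h.le⟩
  choose u hu1 hu2 using hex
  have hc : CauchySeq u := by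
    refine cauchySeq_of_le_tendsto_0 (fun N : ℕ => √(8 * (1 / ((N : ℝ) + 1)))) ?_ ?_
    · intro i j N hi hj
      have hmono : ∀ {i : ℕ}, N ≤ i → s - 1 / ((N : ℝ) + 1) ≤ S.energy w (u i) := by
        intro i hi
        have : 1 / ((i : ℝ) + 1) ≤ 1 / ((N : ℝ) + 1) := Nat.one_div_le_one_div hi
        linarith [hu2 i]
      rw [dist_eq_norm]
      exact Real.le_sqrt_of_sq_le (norm_sub_sq_le hw (hu1 j) (hu1 i) hle (hmono hj) (hmono hi))
    · have h0 : Tendsto (fun N : ℕ => √(8 * (1 / ((N : ℝ) + 1)))) atTop (𝓝 (√(8 * 0))) :=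
        (tendsto_one_div_add_atTop_nhds_zero_nat.const_mul 8).sqrt
      simpa using h0
  obtain ⟨φ, hφ⟩ := cauchySeq_tendsto_of_complete hc
  have hφmem : φ ∈ S.region w := (isClosed_region w).mem_of_tendsto hφ (Eventually.of_forall hu1)
  refine ⟨φ, hφmem, fun η hη => (hle η hη).trans ?_⟩
  have h1 : Tendsto (fun k : ℕ => s - 1 / ((k : ℝ) + 1)) atTop (𝓝 (s - 0)) :=
    tendsto_const_nhds.sub tendsto_one_div_add_atTop_nhds_zero_nat
  have h2 := le_of_tendsto_of_tendsto' h1 (((continuous_energy w).tendsto φ).comp hφ) hu2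
  simpa using h2

/-- A critical point in the region is the strict global maximizer. -/
lemma energy_lt_of_grad_eq_zero {w : H} (hw : S.weakNorm w = 1) {φ η : E} (hφ : φ ∈ S.region w)
    (hg : S.grad w φ = 0) (hne : η ≠ φ) : S.energy w η < S.energy w φ := by
  have hin : ∀ ζ ∈ S.region w, S.energy w ζ ≤ S.energy w φ - ‖ζ - φ‖ ^ 2 / 2 := by
    intro ζ hζ
    have := energy_le hw hφ hζ
    rw [hg, zero_apply] at this
    linarith [S.norm_sq_le_strongSq w (ζ - φ)]
  by_cases hη : η ∈ S.region w
  · have := hin η hη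
    have h0 : 0 < ‖η - φ‖ := norm_pos_iff.2 (sub_ne_zero.2 hne)
    nlinarith [pow_pos h0 2]
  -- Outside the region `η` already loses against 0, whose energy is at least `(1 - size)‖w‖²`, and
  -- 0 does not beat `φ`.
  · have h1 : ‖w‖ ^ 2 / 174 < S.strongSq w η := not_le.1 hη
    have h2 := hin 0 (zero_mem_region w)
    have h3 := energy_zero_ge (S := S) hw
    have h4 := energy_le_sub_strongSq (S := S) w η
    have h5 : S.size * ‖w‖ ^ 2 ≤ 1 / 174 * ‖w‖ ^ 2 :=
      mul_le_mul_of_nonneg_right S.size_lt.le (sq_nonneg _)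
    nlinarith [sq_nonneg ‖0 - φ‖]

/-- The maximization problem has a solution. -/
lemma exists_maximizer [CompleteSpace E] {w : H} (hw : S.weakNorm w = 1) :
    ∃ φ : E, S.strongSq w φ ≤ S.size * ‖w‖ ^ 2 ∧ S.grad w φ = 0 := by
  obtain ⟨φ, hφ, hmax⟩ := exists_isMaxOn_region (S := S) hw
  have h1 : S.strongSq w φ ≤ S.size * ‖w‖ ^ 2 := by
    have h2 := hmax 0 (zero_mem_region w)
    have h3 := energy_zero_ge (S := S) hw
    have h4 := energy_le_sub_strongSq (S := S) w φ
    linarith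
  refine ⟨φ, h1, ?_⟩
  have hW := one_le_norm hw
  -- The strict inequality `size < 1/174` puts the maximizer inside the region, so small variations
  -- in every direction are admissible.
  have hlt : S.strongSq w φ < ‖w‖ ^ 2 / 174 := by
    have := mul_lt_mul_of_pos_right S.size_lt (by positivity : 0 < ‖w‖ ^ 2)
    linarith
  ext h
  have hd := S.hasDerivAt_energy w φ h (t := 0) (by
    rw [zero_smul, add_zero]; exact weakE_lt_one_of_mem_region hw hφ)
  rw [zero_smul, add_zero] at hd
  refine IsLocalMax.hasDerivAt_eq_zero ?_ hd
  have hc : Continuous fun t : ℝ => S.strongSq w (φ + t • h) := by unfold strongSq; fun_prop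
  have h0 : S.strongSq w (φ + (0 : ℝ) • h) < ‖w‖ ^ 2 / 174 := by rwa [zero_smul, add_zero]
  filter_upwards [hc.continuousAt.eventually_lt continuousAt_const h0] with t ht
  rw [zero_smul, add_zero]
  exact hmax _ ht.le

lemma mem_region_of_le {w : H} {φ : E} (h : S.strongSq w φ ≤ S.size * ‖w‖ ^ 2) :
    φ ∈ S.region w := by
  refine h.trans ?_
  have := mul_le_mul_of_nonneg_right S.size_lt.le (sq_nonneg ‖w‖)
  linarith

/-! ### Smooth dependence of the maximizer -/

lemma contDiffAt_amp {u : H × E} (hu : S.weakE u.2 u.2 < 1) :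
    ContDiffAt ℝ ∞ (fun p : H × E => S.amp p.2) u := by
  have hJ : ContDiffAt ℝ ∞ (fun p : H × E => S.weakE p.2) u :=
    S.weakE.contDiff.contDiffAt.comp u contDiffAt_snd
  simp_rw [amp_eq]
  exact (contDiffAt_const.sub (hJ.clm_apply contDiffAt_snd)).sqrt (by linarith)

lemma contDiffAt_state {u : H × E} (hu : S.weakE u.2 u.2 < 1) :
    ContDiffAt ℝ ∞ (fun p : H × E => S.state p.1 p.2) u :=
  ((contDiffAt_amp hu).smul contDiffAt_fst).add
    (S.incl.contDiff.contDiffAt.comp u contDiffAt_snd)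

lemma contDiffAt_grad {u : H × E} (hu : S.weakE u.2 u.2 < 1) :
    ContDiffAt ℝ ∞ (fun p : H × E => S.grad p.1 p.2) u := by
  have hJ : ContDiffAt ℝ ∞ (fun p : H × E => S.weakE p.2) u :=
    S.weakE.contDiff.contDiffAt.comp u contDiffAt_snd
  have hamp := contDiffAt_amp hu
  have hst := contDiffAt_state hu
  have hT : ContDiffAt ℝ ∞ (fun p : H × E =>
      S.quartic (S.state p.1 p.2) (S.state p.1 p.2) (S.state p.1 p.2)) u :=
    (((S.quartic.contDiff.contDiffAt.comp u hst).clm_apply hst).clm_apply hst)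
  have hnorm : ContDiffAt ℝ ∞ (fun p : H × E => ‖p.1‖ ^ 2) u :=
    (contDiff_norm_sq ℝ).contDiffAt.comp u contDiffAt_fst
  have hin : ContDiffAt ℝ ∞ (fun p : H × E => innerSL ℝ p.2) u :=
    (innerSL ℝ).contDiff.contDiffAt.comp u contDiffAt_snd
  unfold grad
  refine ((hin.const_smul (2 : ℝ)).neg.sub ((contDiffAt_const.mul hnorm).smul hJ)).sub
    (ContDiffAt.const_smul (4 : ℝ) ((hT.clm_comp contDiffAt_const).sub
      (((hT.clm_apply contDiffAt_fst).div hamp (S.amp_pos hu).ne').smul hJ)))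

/-- Lax-Milgram for `-A`, followed by the Riesz isomorphism and a change of sign. -/
lemma isInvertible_of_coercive [CompleteSpace E] {A : E →L[ℝ] E →L[ℝ] ℝ}
    (hA : ∀ h, A h h ≤ -‖h‖ ^ 2) : A.IsInvertible := by
  have hc : IsCoercive (-A) := ⟨1, one_pos, fun h => by
    rw [neg_apply, neg_apply]
    nlinarith [hA h]⟩
  refine ⟨hc.continuousLinearEquivOfBilin.trans
    ((InnerProductSpace.toDual ℝ E).toContinuousLinearEquiv.trans
      (ContinuousLinearEquiv.neg ℝ)), ?_⟩
  ext v h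
  have := hc.continuousLinearEquivOfBilin_apply v h
  rw [neg_apply, neg_apply] at this
  simp [this]

/-- Coercivity needs only the diagonal of the partial derivative in `φ`, which is found by
restricting to a line. -/
lemma fderiv_grad_apply {w : H} {φ : E} (hφ : S.weakE φ φ < 1) (h : E) :
    fderiv ℝ (fun p : H × E => S.grad p.1 p.2) (w, φ) (0, h) h = S.hess w φ h := by
  have h1 : HasFDerivAt (fun p : H × E => S.grad p.1 p.2)
      (fderiv ℝ (fun p : H × E => S.grad p.1 p.2) (w, φ)) (w, φ) :=
    ((contDiffAt_grad (S := S) (u := (w, φ)) hφ).differentiableAt (by simp)).hasFDerivAt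
  generalize fderiv ℝ (fun p : H × E => S.grad p.1 p.2) (w, φ) = L at h1
  have h2 : HasDerivAt (fun t : ℝ => (w, φ + t • h)) ((0 : H), h) 0 :=
    (hasDerivAt_const 0 w).prodMk (hasDerivAt_line φ h 0)
  have e0 : (w, φ) = (w, φ + (0 : ℝ) • h) := by rw [zero_smul, add_zero]
  rw [e0] at h1
  have h3 : HasDerivAt (fun t : ℝ => S.grad w (φ + t • h)) (L (0, h)) 0 := by
    have := HasFDerivAt.comp_hasDerivAt (f := fun t : ℝ => (w, φ + t • h)) (0 : ℝ) h1 h2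
    exact this
  have h4 : HasDerivAt (fun t : ℝ => S.grad w (φ + t • h) h) (L (0, h) h) 0 :=
    (ContinuousLinearMap.apply ℝ ℝ h).hasFDerivAt.comp_hasDerivAt 0 h3
  have h5 := S.hasDerivAt_grad w φ h (t := 0) (by rw [zero_smul, add_zero]; exact hφ)
  rw [zero_smul, add_zero] at h5
  exact h4.unique h5

/-- Near a maximizer, the solutions of the critical point equation depend smoothly on `w`. -/
lemma exists_contDiffAt_maximizer [CompleteSpace H] [CompleteSpace E] {w₀ : H}
    (hw₀ : S.weakNorm w₀ = 1) {Φ : H → E}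
    (hΦ : ∀ w, S.weakNorm w = 1 → S.strongSq w (Φ w) ≤ S.size * ‖w‖ ^ 2 ∧ S.grad w (Φ w) = 0) :
    ∃ Φ' : H → E, ContDiffAt ℝ ∞ Φ' w₀ ∧ ∀ᶠ w in 𝓝 w₀, S.weakNorm w = 1 → Φ' w = Φ w := by
  obtain ⟨hs, hg⟩ := hΦ w₀ hw₀
  have hmem := mem_region_of_le hs
  have hlt := weakE_lt_one_of_mem_region hw₀ hmem
  set f : H × E → E →L[ℝ] ℝ := fun p => S.grad p.1 p.2 with hf
  set u : H × E := (w₀, Φ w₀) with hu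
  have cdf : ContDiffAt ℝ ∞ f u := contDiffAt_grad (S := S) (u := u) hlt
  have hinv : (fderiv ℝ f u ∘L .inr ℝ H E).IsInvertible := by
    refine isInvertible_of_coercive fun h => ?_
    have h6 := hess_le hw₀ hmem h
    have h7 := S.norm_sq_le_strongSq w₀ h
    have h8 : (fderiv ℝ f u ∘L .inr ℝ H E) h h = fderiv ℝ f u (0, h) h := rfl
    rw [h8, fderiv_grad_apply hlt h]
    linarith
  have hn : (∞ : WithTop ℕ∞) ≠ 0 := by simp
  refine ⟨cdf.implicitFunction hn hinv, cdf.contDiffAt_implicitFunction hn hinv, ?_⟩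
  have hcont : ContinuousAt (cdf.implicitFunction hn hinv) w₀ :=
    (cdf.contDiffAt_implicitFunction hn hinv).continuousAt
  have hself : cdf.implicitFunction hn hinv w₀ = Φ w₀ := cdf.implicitFunction_apply_self hn hinv
  have hW := one_le_norm hw₀
  have hlt' : S.strongSq w₀ (cdf.implicitFunction hn hinv w₀) < ‖w₀‖ ^ 2 / 174 := by
    rw [hself]
    have := mul_lt_mul_of_pos_right S.size_lt (by positivity : 0 < ‖w₀‖ ^ 2)
    linarith
  have hcs : ContinuousAt (fun w => S.strongSq w (cdf.implicitFunction hn hinv w)) w₀ := by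
    unfold strongSq
    have h1 : ContinuousAt (fun w => S.weakE (cdf.implicitFunction hn hinv w)) w₀ :=
      S.weakE.continuous.continuousAt.comp hcont
    exact (hcont.norm.pow 2).add ((continuousAt_id.norm.pow 2).mul (h1.clm_apply hcont))
  have hcw : ContinuousAt (fun w : H => ‖w‖ ^ 2 / 174) w₀ := by fun_prop
  -- The implicit solution lives on a full neighbourhood in `H`. By continuity it stays inside the
  -- region; the unit sphere enters only when it is compared with `Φ`.
  filter_upwards [cdf.eventually_apply_implicitFunction hn hinv, hcs.eventually_lt hcw hlt']
    with w h1 h2 hw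
  have hg0 : f u = 0 := hg
  rw [hg0] at h1
  obtain ⟨h3, h4⟩ := hΦ w hw
  -- Two distinct critical points in the region would each be strictly better than the other.
  by_contra hne
  have a1 := energy_lt_of_grad_eq_zero hw (le_of_lt h2) h1 (Ne.symm hne)
  have a2 := energy_lt_of_grad_eq_zero hw (mem_region_of_le h3) h4 hne
  linarith

end QuarticSetting

end

end MaxwellDirac

namespace MaxwellDirac

noncomputable section

open Set Filter Topology

set_option maxSynthPendingDepth 3

attribute [local instance] InnerProductSpace.complexToReal

/-! ### The Maxwell-Dirac functional -/

/-- The real `L²` scalar product on `H^{1/2}`. -/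
def weakInner : Hhalf →L[ℝ] Hhalf →L[ℝ] ℝ :=
  LinearMap.mkContinuous₂ (LinearMap.mk₂ ℝ (fun f g : Hhalf => (inner ℂ (toL2 f) (toL2 g)).re)
    (fun f₁ f₂ g => by simp only [map_add, inner_add_left, Complex.add_re])
    (fun c f g => by
      have : c • f = (c : ℂ) • f := rfl
      simp only [this, map_smul, inner_smul_left, Complex.conj_ofReal, Complex.re_ofReal_mul,
        smul_eq_mul])
    (fun f g₁ g₂ => by simp only [map_add, inner_add_right, Complex.add_re])
    (fun c f g => by
      have : c • g = (c : ℂ) • g := rfl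
      simp only [this, map_smul, inner_smul_right, Complex.re_ofReal_mul, smul_eq_mul]))
    1 (fun f g => by
      rw [one_mul]
      calc ‖(inner ℂ (toL2 f) (toL2 g)).re‖ ≤ ‖toL2 f‖ * ‖toL2 g‖ :=
            (Complex.abs_re_le_norm _).trans (norm_inner_le_norm _ _)
        _ ≤ ‖f‖ * ‖g‖ := by gcongr <;> exact norm_toL2_le _)

lemma weakInner_apply (f g : Hhalf) : weakInner f g = (inner ℂ (toL2 f) (toL2 g)).re := rfl

/-- The `L²` norm as a seminorm on `H^{1/2}`. -/
def weakSeminorm : Seminorm ℝ Hhalf :=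
  Seminorm.of (fun f => ‖toL2 f‖) (fun f g => by rw [map_add]; exact norm_add_le _ _)
    (fun c f => by
      have : c • f = (c : ℂ) • f := rfl
      rw [this, map_smul, norm_smul, Complex.norm_real])

lemma weakSeminorm_apply (f : Hhalf) : weakSeminorm f = ‖toL2 f‖ := rfl

lemma weakInner_self (f : Hhalf) : weakInner f f = ‖toL2 f‖ ^ 2 :=
  (norm_sq_eq_re_inner (𝕜 := ℂ) (toL2 f)).symm

lemma weakInner_comm (f g : Hhalf) : weakInner f g = weakInner g f := by
  rw [weakInner_apply, weakInner_apply, ← inner_conj_symm, Complex.conj_re]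

/-- The Maxwell-Dirac problem as an instance of the abstract problem. -/
def setting (e m : ℝ) (he : e ^ 2 * gammaK < 1 / 87) (hm : 0 < m) (hm1 : m ≤ 1) :
    QuarticSetting Hhalf Xminus where
  incl := Xminus.subtypeL.restrictScalars ℝ
  norm_incl _ := rfl
  weak := weakInner
  weakNorm := weakSeminorm
  weak_comm := weakInner_comm
  weak_self := weakInner_self
  abs_weak_le f g := (Complex.abs_re_le_norm _).trans (norm_inner_le_norm _ _)
  weakNorm_le := norm_toL2_le
  quartic := (m * (e ^ 2 / 2)) • coulombQuartic
  size := m * (e ^ 2 / 2) * gammaK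
  size_nonneg := by have := gammaK_pos; positivity
  size_lt := by
    -- The factor 1/2 in front of the interaction turns the hypothesis with `1/87` into `1/174`, and
    -- `m ≤ 1` only helps.
    have h0 : 0 ≤ e ^ 2 * gammaK := by have := gammaK_pos; positivity
    nlinarith
  quartic_swap_left f g h k := by
    simp only [smul_apply, coulombQuartic_apply, coulombForm_swap_left f]
  quartic_swap f g h k := by
    simp only [smul_apply, coulombQuartic_apply, coulombForm_swap f]
  abs_quartic_le f g h k := by
    simp only [smul_apply, coulombQuartic_apply, smul_eq_mul, weakSeminorm_apply]
    have hk : 0 ≤ m * (e ^ 2 / 2) := by positivity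
    rw [abs_mul, abs_of_nonneg hk]
    have := mul_le_mul_of_nonneg_left (abs_coulombForm_le f g h k) hk
    linarith
  quartic_self_nonneg f := by
    simp only [smul_apply, coulombQuartic_apply, smul_eq_mul]
    exact mul_nonneg (by positivity) (coulombForm_nonneg f f)
  quartic_self_le f := by
    simp only [smul_apply, coulombQuartic_apply, smul_eq_mul, weakSeminorm_apply]
    have hk : 0 ≤ m * (e ^ 2 / 2) := by positivity
    have h1 : gammaK * kinetic f * ‖toL2 f‖ ^ 2 ≤ gammaK * ‖f‖ ^ 2 * ‖toL2 f‖ ^ 2 := by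
      have := gammaK_pos
      have := kinetic_le f
      gcongr
    have := mul_le_mul_of_nonneg_left ((coulombForm_self_le f).trans h1) hk
    linarith

lemma functional_eq (e m : ℝ) (ψ : Hhalf) : functional e m ψ =
    ‖projPlus ψ‖ ^ 2 - ‖projMinus ψ‖ ^ 2 - m * (e ^ 2 / 2) * coulombForm ψ ψ ψ ψ := by
  rw [functional, interaction_eq]

lemma contDiff_functional (e m : ℝ) : ContDiff ℝ ∞ (functional e m) := by
  have h0 : functional e m = fun ψ => ‖projPlusL.restrictScalars ℝ ψ‖ ^ 2 -
      ‖projMinusL.restrictScalars ℝ ψ‖ ^ 2 -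
        m * (e ^ 2 / 2) * coulombQuartic ψ ψ ψ ψ := funext (functional_eq e m)
  rw [h0]
  have hT : ContDiff ℝ ∞ fun ψ => coulombQuartic ψ ψ ψ ψ :=
    (((coulombQuartic.contDiff.clm_apply contDiff_id).clm_apply contDiff_id).clm_apply contDiff_id)
  exact (((contDiff_norm_sq ℝ).comp (projPlusL.restrictScalars ℝ).contDiff).sub
    ((contDiff_norm_sq ℝ).comp (projMinusL.restrictScalars ℝ).contDiff)).sub
    (contDiff_const.mul hT)

lemma fderiv_functional_apply (e m : ℝ) (ψ h : Hhalf) :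
    fderiv ℝ (functional e m) ψ h =
      2 * (inner ℂ (projPlus ψ) (projPlus h)).re - 2 * (inner ℂ (projMinus ψ) (projMinus h)).re -
        4 * (m * (e ^ 2 / 2)) * coulombForm ψ ψ ψ h := by
  have hd : HasFDerivAt (functional e m) (fderiv ℝ (functional e m) ψ) (ψ + (0 : ℝ) • h) := by
    rw [zero_smul, add_zero]
    exact ((contDiff_functional e m).differentiable (by simp)).differentiableAt.hasFDerivAt
  have hl : HasDerivAt (fun t : ℝ => ψ + t • h) h 0 := by
    simpa using ((hasDerivAt_id (0 : ℝ)).smul_const h).const_add ψ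
  have h1 : HasDerivAt (fun t : ℝ => functional e m (ψ + t • h))
      (fderiv ℝ (functional e m) ψ h) 0 :=
    HasFDerivAt.comp_hasDerivAt (f := fun t : ℝ => ψ + t • h) (0 : ℝ) hd hl
  have hp := ((projPlusL.restrictScalars ℝ).hasFDerivAt.comp_hasDerivAt (0 : ℝ) hl).norm_sq
  have hn := ((projMinusL.restrictScalars ℝ).hasFDerivAt.comp_hasDerivAt (0 : ℝ) hl).norm_sq
  have hT := hasDerivAt_quartic coulombQuartic hl hl hl hl
  have h2 := (hp.sub hn).sub (hT.const_mul (m * (e ^ 2 / 2)))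
  have h3 : HasDerivAt (fun t : ℝ => functional e m (ψ + t • h)) _ 0 :=
    h2.congr_of_eventuallyEq (Eventually.of_forall fun t => functional_eq e m (ψ + t • h))
  rw [h1.unique h3]
  simp only [Function.comp, zero_smul, add_zero, coulombQuartic_apply]
  rw [coulombForm_swap_left h ψ ψ ψ, coulombForm_swap ψ h ψ ψ, coulombForm_swap_right ψ ψ h ψ]
  have e1 : inner ℝ (projPlusL.restrictScalars ℝ ψ) (projPlusL.restrictScalars ℝ h) =
      (inner ℂ (projPlus ψ) (projPlus h)).re := rfl
  have e2 : inner ℝ (projMinusL.restrictScalars ℝ ψ) (projMinusL.restrictScalars ℝ h) =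
      (inner ℂ (projMinus ψ) (projMinus h)).re := rfl
  rw [e1, e2]
  ring

lemma functional_smul (e m : ℝ) {c : ℂ} (hc : ‖c‖ = 1) (ψ : Hhalf) :
    functional e m (c • ψ) = functional e m ψ := by
  have hcc : (starRingEnd ℂ) c * c = 1 := by
    rw [← Complex.normSq_eq_conj_mul_self, Complex.normSq_eq_norm_sq, hc]; norm_num
  rw [functional_eq, functional_eq, map_smul, map_smul, norm_smul, norm_smul, hc, one_mul, one_mul]
  congr 2
  unfold coulombForm
  refine integral_congr_ae ?_
  have hs : ∀ u v : C4, inner ℂ (c • u) (c • v) = inner ℂ u v := by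
    intro u v
    rw [inner_smul_left, inner_smul_right, ← mul_assoc, hcc, one_mul]
  filter_upwards [ae_fst (Lp.coeFn_smul c (toL2 ψ)), ae_snd (Lp.coeFn_smul c (toL2 ψ))]
    with z h1 h2
  simp only [coulombIntegrand]
  rw [map_smul, h1, h2, Pi.smul_apply, Pi.smul_apply]
  simp only [spinorPairing, map_smul, hs]

/-- The Pythagorean identity for `f + g` in `L²`, read backwards. -/
lemma re_inner_toL2_eq_zero {f g : Hhalf} (hf : f ∈ Xplus) (hg : g ∈ Xminus) :
    weakInner f g = 0 := by
  have h := norm_sq_toL2_projPlus_add (f + g)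
  rw [map_add projPlus f g, map_add projMinus f g, projPlus_of_mem hf, projMinus_of_mem hg,
    (mem_Xminus_iff g).1 hg,
    (mem_Xplus_iff f).1 hf, add_zero, zero_add, ← weakInner_self, ← weakInner_self,
    ← weakInner_self] at h
  simp only [map_add, add_apply, weakInner_comm g f] at h
  linarith

lemma kinetic_smul (a : ℝ) (f : Hhalf) : kinetic (a • f) = a ^ 2 * kinetic f := by
  have e : a • f = (a : ℂ) • f := rfl
  have h : hat (a • f) = (a : ℂ) • hat f := by
    rw [hat, e, map_smul, FourierTransform.fourier_smul]; rfl
  rw [kinetic, kinetic, ← integral_const_mul]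
  refine integral_congr_ae ?_
  rw [h]
  filter_upwards [Lp.coeFn_smul (a : ℂ) (hat f)] with ξ hξ
  rw [hξ, Pi.smul_apply, norm_smul, Complex.norm_real, mul_pow, Real.norm_eq_abs, sq_abs]
  ring

/-! ### The Euler-Lagrange equation and the bounds on the maximizer -/

section Maximizer

variable {e m : ℝ} {he : e ^ 2 * gammaK < 1 / 87} {hm : 0 < m} {hm1 : m ≤ 1}

lemma setting_weakE_self (φ : Xminus) :
    (setting e m he hm hm1).weakE φ φ = ‖toL2 (φ : Hhalf)‖ ^ 2 :=
  weakInner_self _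

lemma setting_state (w : Hhalf) (φ : Xminus) : (setting e m he hm hm1).state w φ =
    (((setting e m he hm hm1).amp φ : ℝ) : ℂ) • w + (φ : Hhalf) := rfl

lemma setting_amp (φ : Xminus) :
    (setting e m he hm hm1).amp φ = √(1 - ‖toL2 (φ : Hhalf)‖ ^ 2) := by
  rw [QuarticSetting.amp_eq, setting_weakE_self]

variable {w : Hhalf} {φ : Xminus}

lemma projPlus_state (hw : w ∈ Xplus) : projPlus ((setting e m he hm hm1).state w φ) =
    (((setting e m he hm hm1).amp φ : ℝ) : ℂ) • w := by
  rw [setting_state, map_add, map_smul, projPlus_of_mem hw, (mem_Xminus_iff _).1 φ.2, add_zero]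

lemma projMinus_state (hw : w ∈ Xplus) :
    projMinus ((setting e m he hm hm1).state w φ) = (φ : Hhalf) := by
  rw [setting_state, map_add, map_smul, projMinus_of_mem φ.2, (mem_Xplus_iff _).1 hw, smul_zero,
    zero_add]

lemma amp_sq (hφ : ‖toL2 (φ : Hhalf)‖ ^ 2 ≤ 1) :
    (setting e m he hm hm1).amp φ ^ 2 = 1 - ‖toL2 (φ : Hhalf)‖ ^ 2 := by
  rw [setting_amp, Real.sq_sqrt (by linarith)]

lemma norm_sq_toL2_state (hw : w ∈ unitSpherePlus) (hφ : ‖toL2 (φ : Hhalf)‖ ^ 2 ≤ 1) :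
    ‖toL2 ((setting e m he hm hm1).state w φ)‖ ^ 2 = 1 := by
  rw [← norm_sq_toL2_projPlus_add, projPlus_state hw.1, projMinus_state hw.1, map_smul, norm_smul,
    mul_pow, hw.2, Complex.norm_real, Real.norm_eq_abs, sq_abs, amp_sq hφ]
  ring

lemma norm_sq_projPlus_state (hw : w ∈ Xplus) (hφ : ‖toL2 (φ : Hhalf)‖ ^ 2 ≤ 1) :
    ‖projPlus ((setting e m he hm hm1).state w φ)‖ ^ 2 =
      (1 - ‖toL2 (φ : Hhalf)‖ ^ 2) * ‖w‖ ^ 2 := by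
  rw [projPlus_state hw, norm_smul, mul_pow, Complex.norm_real, Real.norm_eq_abs, sq_abs,
    amp_sq hφ]

lemma functional_state (hw : w ∈ Xplus) (hφ : ‖toL2 (φ : Hhalf)‖ ^ 2 ≤ 1) :
    functional e m ((setting e m he hm hm1).state w φ) =
      (setting e m he hm hm1).energy w φ := by
  rw [functional_eq, norm_sq_projPlus_state hw hφ, projMinus_state hw, QuarticSetting.energy]
  rw [← QuarticSetting.weakE_apply, setting_weakE_self]
  have h1 : ∀ ψ, (setting e m he hm hm1).quartic ψ ψ ψ ψ =
      m * (e ^ 2 / 2) * coulombForm ψ ψ ψ ψ := fun _ => rfl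
  have h2 : ‖(φ : Hhalf)‖ = ‖φ‖ := rfl
  rw [h1, h2]
  ring

/-- Every admissible state is a phase rotation of a state with real positive amplitude. -/
lemma exists_eq_smul_state (hw : w ∈ unitSpherePlus) {χ : Hhalf}
    (hχ : χ ∈ constraint (Submodule.span ℂ {w})) :
    ∃ (c : ℂ) (η : Xminus), ‖c‖ = 1 ∧ ‖toL2 (η : Hhalf)‖ ^ 2 ≤ 1 ∧
      χ = c • (setting e m he hm hm1).state w η := by
  obtain ⟨hχ1, hχ2⟩ := hχ
  have hχ1 : ‖toL2 χ‖ ^ 2 = 1 := hχ1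
  obtain ⟨d, hd⟩ := Submodule.mem_span_singleton.1 hχ2
  have hn : ‖d‖ ^ 2 + ‖toL2 (projMinus χ)‖ ^ 2 = 1 := by
    rw [← norm_sq_toL2_projPlus_add, ← hd, map_smul, norm_smul, mul_pow, hw.2, mul_one] at hχ1
    exact hχ1
  -- Polar form of the coefficient of `w`. If it vanishes any phase will do, and 1 is taken.
  obtain ⟨c, hc, hdc⟩ : ∃ c : ℂ, ‖c‖ = 1 ∧ d = c * (‖d‖ : ℂ) := by
    by_cases hd0 : d = 0
    · exact ⟨1, by simp, by simp [hd0]⟩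
    · have h0 : (‖d‖ : ℂ) ≠ 0 := by exact_mod_cast norm_ne_zero_iff.2 hd0
      refine ⟨d / ‖d‖, ?_, by field_simp⟩
      rw [norm_div, Complex.norm_real, norm_norm, div_self (norm_ne_zero_iff.2 hd0)]
  have hc0 : c ≠ 0 := by rw [← norm_ne_zero_iff, hc]; exact one_ne_zero
  have hmem : c⁻¹ • projMinus χ ∈ Xminus := Xminus.smul_mem _ ⟨χ, rfl⟩
  have hη : ‖toL2 (c⁻¹ • projMinus χ)‖ ^ 2 = ‖toL2 (projMinus χ)‖ ^ 2 := by
    rw [map_smul, norm_smul, norm_inv, hc, inv_one, one_mul]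
  refine ⟨c, ⟨_, hmem⟩, hc, ?_, ?_⟩
  · rw [hη]; nlinarith [sq_nonneg ‖d‖]
  · have ha : (setting e m he hm hm1).amp ⟨c⁻¹ • projMinus χ, hmem⟩ = ‖d‖ := by
      rw [setting_amp, hη, ← hn, add_sub_cancel_right, Real.sqrt_sq (norm_nonneg _)]
    rw [setting_state, ha, smul_add, smul_smul, smul_smul, mul_inv_cancel₀ hc0, one_smul, ← hdc,
      hd, projPlus_add_projMinus]

lemma weakNorm_eq_one (hw : w ∈ unitSpherePlus) : (setting e m he hm hm1).weakNorm w = 1 := by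
  have h : ‖toL2 w‖ ^ 2 = 1 := hw.2
  have h2 : (setting e m he hm hm1).weakNorm w = ‖toL2 w‖ := rfl
  rw [h2]
  nlinarith [norm_nonneg (toL2 w)]

lemma norm_toL2_le_of_maximizer (hw : w ∈ unitSpherePlus)
    (hφ : (setting e m he hm hm1).strongSq w φ ≤ (setting e m he hm hm1).size * ‖w‖ ^ 2) :
    ‖toL2 (φ : Hhalf)‖ ≤ 1 / 13 :=
  (QuarticSetting.bounds_of_mem_region (weakNorm_eq_one hw)
    (QuarticSetting.mem_region_of_le hφ)).2

lemma norm_sq_toL2_le_of_maximizer (hw : w ∈ unitSpherePlus)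
    (hφ : (setting e m he hm hm1).strongSq w φ ≤ (setting e m he hm hm1).size * ‖w‖ ^ 2) :
    ‖toL2 (φ : Hhalf)‖ ^ 2 ≤ 1 / 169 := by
  have h := norm_toL2_le_of_maximizer hw hφ
  nlinarith [norm_nonneg (toL2 (φ : Hhalf))]

lemma amp_pos_of_maximizer (hw : w ∈ unitSpherePlus)
    (hφ : (setting e m he hm hm1).strongSq w φ ≤ (setting e m he hm hm1).size * ‖w‖ ^ 2) :
    0 < (setting e m he hm hm1).amp φ := by
  have h := norm_sq_toL2_le_of_maximizer hw hφ
  refine QuarticSetting.amp_pos _ ?_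
  rw [setting_weakE_self]
  linarith

/-- The Lagrange multiplier. -/
def multiplier (S : QuarticSetting Hhalf Xminus) (w : Hhalf) (φ : Xminus) : ℝ :=
  ‖w‖ ^ 2 - 2 * S.quartic (S.state w φ) (S.state w φ) (S.state w φ) w / S.amp φ

/-- `multiplier` is defined so that the Euler-Lagrange equation holds in the direction `w`, where
the `L²` product with the state is `amp φ`. -/
lemma fderiv_functional_apply_self (hw : w ∈ unitSpherePlus)
    (hφ : (setting e m he hm hm1).strongSq w φ ≤ (setting e m he hm hm1).size * ‖w‖ ^ 2) :
    fderiv ℝ (functional e m) ((setting e m he hm hm1).state w φ) w =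
      2 * multiplier (setting e m he hm hm1) w φ * (setting e m he hm hm1).amp φ := by
  have ha := amp_pos_of_maximizer hw hφ
  rw [fderiv_functional_apply, projPlus_state hw.1, projPlus_of_mem hw.1,
    (mem_Xplus_iff w).1 hw.1, inner_zero_right, inner_smul_left, Complex.conj_ofReal,
    Complex.re_ofReal_mul, multiplier]
  have h1 : (inner ℂ w w).re = ‖w‖ ^ 2 := (norm_sq_eq_re_inner (𝕜 := ℂ) w).symm
  have h2 : ∀ ψ k, (setting e m he hm hm1).quartic ψ ψ ψ k =
      m * (e ^ 2 / 2) * coulombForm ψ ψ ψ k := fun _ _ => rfl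
  rw [h1, h2]
  field_simp
  simp
  ring

/-- A variation of `φ` also moves the amplitude of `w`, because the total `L²` norm is fixed. In
`grad w φ = 0` that induced motion along `w` supplies exactly the multiplier term. -/
lemma fderiv_functional_apply_minus (hw : w ∈ unitSpherePlus)
    (hφ : (setting e m he hm hm1).strongSq w φ ≤ (setting e m he hm hm1).size * ‖w‖ ^ 2)
    (hg : (setting e m he hm hm1).grad w φ = 0) {h : Hhalf} (hh : h ∈ Xminus) :
    fderiv ℝ (functional e m) ((setting e m he hm hm1).state w φ) h =
      2 * multiplier (setting e m he hm hm1) w φ * weakInner (φ : Hhalf) h := by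
  have ha := amp_pos_of_maximizer hw hφ
  have h0 := congrArg (fun L => L ⟨h, hh⟩) hg
  simp only [zero_apply] at h0
  rw [QuarticSetting.grad_apply, QuarticSetting.dstate, map_add, map_smul] at h0
  have e1 : inner ℝ φ ⟨h, hh⟩ = (inner ℂ (φ : Hhalf) h).re := rfl
  have e2 : (setting e m he hm hm1).weakE φ ⟨h, hh⟩ = weakInner (φ : Hhalf) h := rfl
  have e3 : (setting e m he hm hm1).incl ⟨h, hh⟩ = h := rfl
  have h2 : ∀ ψ k, (setting e m he hm hm1).quartic ψ ψ ψ k =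
      m * (e ^ 2 / 2) * coulombForm ψ ψ ψ k := fun _ _ => rfl
  rw [e1, e2, e3, h2, h2, smul_eq_mul] at h0
  rw [fderiv_functional_apply, projMinus_state hw.1, projMinus_of_mem hh,
    (mem_Xminus_iff h).1 hh, inner_zero_right, multiplier, h2, Complex.zero_re]
  have e4 : ∀ X A : ℝ, -A / (setting e m he hm hm1).amp φ * X =
    -(A * X / (setting e m he hm hm1).amp φ) := fun X A => by ring
  have e5 : ∀ X A : ℝ, 2 * (‖w‖ ^ 2 - 2 * X / (setting e m he hm hm1).amp φ) * A =
    2 * ‖w‖ ^ 2 * A - 4 * (A * X / (setting e m he hm hm1).amp φ) := fun X A => by ring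
  rw [e4] at h0
  rw [e5]
  linarith

lemma weakInner_I_smul (f : Hhalf) : weakInner f (Complex.I • f) = 0 := by
  rw [weakInner_apply, map_smul, inner_smul_right, Complex.I_mul_re, neg_eq_zero]
  exact inner_self_im (𝕜 := ℂ) (toL2 f)

lemma re_inner_I_smul (f : Hhalf) : (inner ℂ f (Complex.I • f)).re = 0 := by
  rw [inner_smul_right, Complex.I_mul_re, neg_eq_zero]
  exact inner_self_im (𝕜 := ℂ) f

lemma fderiv_functional_I_smul (ψ : Hhalf) :
    fderiv ℝ (functional e m) ψ (Complex.I • ψ) = 0 := by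
  rw [fderiv_functional_apply, map_smul, map_smul, re_inner_I_smul, re_inner_I_smul,
    coulombForm_I_smul]
  ring

/-- Phase invariance kills the derivative along `i ψ = a (i w) + i φ`. The part along `i φ`, a
direction in X₋, vanishes because `Re ⟨φ, i φ⟩ = 0`; dividing by `a > 0` leaves the direction `i w`.
-/
lemma fderiv_functional_apply_I_smul (hw : w ∈ unitSpherePlus)
    (hφ : (setting e m he hm hm1).strongSq w φ ≤ (setting e m he hm hm1).size * ‖w‖ ^ 2)
    (hg : (setting e m he hm hm1).grad w φ = 0) :
    fderiv ℝ (functional e m) ((setting e m he hm hm1).state w φ) (Complex.I • w) = 0 := by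
  have ha := amp_pos_of_maximizer hw hφ
  have h0 := fderiv_functional_I_smul (e := e) (m := m) ((setting e m he hm hm1).state w φ)
  have h1 : Complex.I • (setting e m he hm hm1).state w φ =
      (setting e m he hm hm1).amp φ • (Complex.I • w) + Complex.I • (φ : Hhalf) := by
    rw [setting_state, smul_add, smul_comm]
    rfl
  rw [h1, map_add, map_smul, fderiv_functional_apply_minus hw hφ hg (Xminus.smul_mem _ φ.2),
    weakInner_I_smul, mul_zero, add_zero, smul_eq_mul] at h0
  exact (mul_eq_zero.1 h0).resolve_left (ne_of_gt ha)

/-- The Euler-Lagrange equation. -/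
lemma euler_lagrange (hw : w ∈ unitSpherePlus)
    (hφ : (setting e m he hm hm1).strongSq w φ ≤ (setting e m he hm hm1).size * ‖w‖ ^ 2)
    (hg : (setting e m he hm hm1).grad w φ = 0)
    {h : Hhalf} (hh : h ∈ Submodule.span ℂ {w} ⊔ Xminus) :
    fderiv ℝ (functional e m) ((setting e m he hm hm1).state w φ) h =
      2 * multiplier (setting e m he hm hm1) w φ *
        weakInner ((setting e m he hm hm1).state w φ) h := by
  obtain ⟨k, hk, η, hη, rfl⟩ := Submodule.mem_sup.1 hh
  obtain ⟨c, rfl⟩ := Submodule.mem_span_singleton.1 hk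
  have hc : c • w = c.re • w + c.im • (Complex.I • w) := by
    have : ∀ r : ℝ, ∀ v : Hhalf, r • v = (r : ℂ) • v := fun _ _ => rfl
    rw [this, this, smul_smul, ← add_smul, Complex.re_add_im]
  have hst : (setting e m he hm hm1).state w φ =
      (setting e m he hm hm1).amp φ • w + (φ : Hhalf) := rfl
  have o1 : weakInner (φ : Hhalf) w = 0 := by
    rw [weakInner_comm]; exact re_inner_toL2_eq_zero hw.1 φ.2
  have o2 : weakInner (φ : Hhalf) (Complex.I • w) = 0 := by
    rw [weakInner_comm]; exact re_inner_toL2_eq_zero (Xplus.smul_mem _ hw.1) φ.2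
  have o3 : weakInner w η = 0 := re_inner_toL2_eq_zero hw.1 hη
  have o4 : weakInner w w = 1 := by rw [weakInner_self]; exact hw.2
  have hJ : weakInner ((setting e m he hm hm1).state w φ) (c • w + η) =
      c.re * (setting e m he hm hm1).amp φ + weakInner (φ : Hhalf) η := by
    rw [hst, hc]
    simp only [map_add, map_smul, add_apply, smul_apply, smul_eq_mul, o1, o2, o3, o4,
      weakInner_I_smul]
    ring
  rw [hJ, map_add, hc, map_add, map_smul, map_smul, fderiv_functional_apply_self hw hφ,
    fderiv_functional_apply_I_smul hw hφ hg, fderiv_functional_apply_minus hw hφ hg hη, smul_eq_mul,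
    smul_zero]
  ring

/-- The equation is tested with the state itself. The kinetic part is homogeneous of degree 2 and
the interaction of degree 4, so the interaction is counted once more than in the functional. -/
lemma multiplier_eq (hw : w ∈ unitSpherePlus)
    (hφ : (setting e m he hm hm1).strongSq w φ ≤ (setting e m he hm hm1).size * ‖w‖ ^ 2)
    (hg : (setting e m he hm hm1).grad w φ = 0) : multiplier (setting e m he hm hm1) w φ =
    functional e m ((setting e m he hm hm1).state w φ) -
      m * (e ^ 2 / 2) * coulombForm ((setting e m he hm hm1).state w φ)
        ((setting e m he hm hm1).state w φ) ((setting e m he hm hm1).state w φ)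
        ((setting e m he hm hm1).state w φ) := by
  have hn := norm_sq_toL2_le_of_maximizer hw hφ
  have hmem : (setting e m he hm hm1).state w φ ∈ Submodule.span ℂ {w} ⊔ Xminus :=
    Submodule.add_mem_sup (Submodule.smul_mem _ _ (Submodule.mem_span_singleton_self w)) φ.2
  have h := euler_lagrange hw hφ hg hmem
  have hs := norm_sq_toL2_state (he := he) (hm := hm) (hm1 := hm1) (φ := φ) hw (by linarith)
  rw [weakInner_self, hs, fderiv_functional_apply] at h
  have h1 : ∀ f : Hhalf, (inner ℂ f f).re = ‖f‖ ^ 2 :=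
    fun f => (norm_sq_eq_re_inner (𝕜 := ℂ) f).symm
  rw [h1, h1] at h
  rw [functional_eq]
  linarith

lemma sub_eq_sub_strongSq (hw : w ∈ unitSpherePlus)
    (hφ : (setting e m he hm hm1).strongSq w φ ≤ (setting e m he hm hm1).size * ‖w‖ ^ 2) :
    ‖projPlus ((setting e m he hm hm1).state w φ)‖ ^ 2 -
      ‖projMinus ((setting e m he hm hm1).state w φ)‖ ^ 2 =
      ‖w‖ ^ 2 - (setting e m he hm hm1).strongSq w φ := by
  have hn := norm_sq_toL2_le_of_maximizer hw hφ
  rw [norm_sq_projPlus_state hw.1 (by linarith), projMinus_state hw.1, QuarticSetting.strongSq,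
    setting_weakE_self]
  have h2 : ‖(φ : Hhalf)‖ = ‖φ‖ := rfl
  rw [h2]
  ring

/-- The kinetic difference is at least `(1 - 1/174)‖w‖²`. The interaction, counted twice, is at most
`2 size ‖ψ‖²`, which with `‖ψ‖² ≤ 2‖w‖²` is at most `(4/174)‖w‖²`. -/
lemma multiplier_pos (hw : w ∈ unitSpherePlus)
    (hφ : (setting e m he hm hm1).strongSq w φ ≤ (setting e m he hm hm1).size * ‖w‖ ^ 2)
    (hg : (setting e m he hm hm1).grad w φ = 0) : 0 < multiplier (setting e m he hm hm1) w φ := by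
  have hn := norm_sq_toL2_le_of_maximizer hw hφ
  have hW := QuarticSetting.one_le_norm (weakNorm_eq_one (he := he) (hm := hm) (hm1 := hm1) hw)
  have h1 := sub_eq_sub_strongSq hw hφ
  have h2 := multiplier_eq hw hφ hg
  have h3 := (setting e m he hm hm1).quartic_self_le ((setting e m he hm hm1).state w φ)
  have h4 : (setting e m he hm hm1).weakNorm ((setting e m he hm hm1).state w φ) ^ 2 = 1 :=
    norm_sq_toL2_state (he := he) (hm := hm) (hm1 := hm1) (φ := φ) hw (by linarith)
  have h5 := norm_sq_projPlus_add ((setting e m he hm hm1).state w φ)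
  have h6 := norm_sq_projPlus_state (e := e) (m := m) (he := he) (hm := hm) (hm1 := hm1) (φ := φ)
    hw.1 (by linarith)
  have h7 := (setting e m he hm hm1).norm_sq_le_strongSq w φ
  have h8 : ‖projMinus ((setting e m he hm hm1).state w φ)‖ ^ 2 = ‖φ‖ ^ 2 := by
    rw [projMinus_state hw.1]; rfl
  have e1 : ∀ ψ, (setting e m he hm hm1).quartic ψ ψ ψ ψ =
      m * (e ^ 2 / 2) * coulombForm ψ ψ ψ ψ := fun _ => rfl
  have hs0 := (setting e m he hm hm1).size_nonneg
  have hs1 := (setting e m he hm hm1).size_lt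
  rw [e1, h4, mul_one] at h3
  rw [functional_eq] at h2
  set s := (setting e m he hm hm1).size
  set ψ := (setting e m he hm hm1).state w φ
  set q := (setting e m he hm hm1).strongSq w φ
  have hW2 : 1 ≤ ‖w‖ ^ 2 := by nlinarith
  have h9 : s * ‖w‖ ^ 2 ≤ 1 / 174 * ‖w‖ ^ 2 := by gcongr
  have h10 : ‖ψ‖ ^ 2 ≤ 2 * ‖w‖ ^ 2 := by nlinarith [sq_nonneg ‖toL2 (φ : Hhalf)‖]
  have h11 : s * ‖ψ‖ ^ 2 ≤ 1 / 174 * (2 * ‖w‖ ^ 2) := by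
    refine mul_le_mul hs1.le h10 (sq_nonneg _) (by norm_num)
  linarith

/-- Here `b` and `n` are the strong and weak norms of the negative part, `W = ‖w‖` and `N` is the
kinetic energy of `w`. If `W² ≥ 2` the a priori bound suffices. Otherwise failure forces `D = W² - 1
< 3b²`, hence `N ≤ 3b`, and `hmain` then bounds `b²` by a small multiple of itself. -/
lemma one_le_sub_of_bootstrap {b n N W s : ℝ} (hb0 : 0 ≤ b) (hn0 : 0 ≤ n) (hnb : n ≤ b)
    (hn : n ≤ 1 / 13) (hs1 : s < 1 / 174) (hW : 1 ≤ W) (hN0 : 0 ≤ N)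
    (hmain : b ^ 2 ≤ 8 * s * (N + b ^ 2) * n)
    (hN : ∀ t : ℝ, 0 < t → N ≤ (t * (W ^ 2 - 1 ^ 2) + t⁻¹ * (W ^ 2 + 1 ^ 2)) / 2)
    (hq : b ^ 2 + W ^ 2 * n ^ 2 ≤ s * W ^ 2) :
    1 ≤ W ^ 2 - (b ^ 2 + W ^ 2 * n ^ 2) := by
  obtain ⟨D, hD⟩ : ∃ D, D = W ^ 2 - 1 := ⟨_, rfl⟩
  have hw2 : W ^ 2 = D + 1 := by linarith
  have hD0 : 0 ≤ D := by rw [hD, sub_nonneg]; exact one_le_pow₀ hW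
  rw [hw2] at hq hN ⊢
  have hsq : s * (D + 1) ≤ 1 / 174 * (D + 1) := by gcongr
  by_cases hD1 : 1 ≤ D
  · linarith
  · push Not at hD1
    by_contra hcon
    have hn2b : n ^ 2 ≤ b ^ 2 := pow_le_pow_left₀ hn0 hnb 2
    have h3b : D < 3 * b ^ 2 := by
      have : D * n ^ 2 ≤ 1 * b ^ 2 := by gcongr
      linarith
    have hbpos : 0 < b := by
      rcases hb0.eq_or_lt with h | h
      · rw [← h] at h3b; linarith
      · exact h
    have hN3 : N ≤ 3 * b := by
      -- The choice `t = 1/b` balances the two terms: `D/b` and `b (D + 2)` are both at most `3b`.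
      have h := hN b⁻¹ (by positivity)
      rw [inv_inv] at h
      have h4 : b⁻¹ * D ≤ 3 * b := by
        rw [inv_mul_le_iff₀ hbpos]; linarith
      have h5 : b * (D + 1 + 1) ≤ b * 3 := by gcongr; linarith
      norm_num at h
      linarith
    have h6 : 8 * s * (N + b ^ 2) * n ≤ 8 * (1 / 174) * (3 * b * b + b ^ 2 * (1 / 13)) := by
      calc 8 * s * (N + b ^ 2) * n ≤ 8 * (1 / 174) * (N + b ^ 2) * n := by gcongr
        _ = 8 * (1 / 174) * (N * n + b ^ 2 * n) := by ring
        _ ≤ _ := by gcongr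
    linarith [pow_pos hbpos 2]

/-- The kinetic energy of the maximizer is at least the rest energy. -/
lemma one_le_norm_sq_sub (hw : w ∈ unitSpherePlus)
    (hφ : (setting e m he hm hm1).strongSq w φ ≤ (setting e m he hm hm1).size * ‖w‖ ^ 2)
    (hg : (setting e m he hm hm1).grad w φ = 0) :
    1 ≤ ‖projPlus ((setting e m he hm hm1).state w φ)‖ ^ 2 -
      ‖projMinus ((setting e m he hm hm1).state w φ)‖ ^ 2 := by
  have hn := norm_toL2_le_of_maximizer hw hφ
  have hn2 := norm_sq_toL2_le_of_maximizer hw hφ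
  have hμ := multiplier_pos hw hφ hg
  have hW := QuarticSetting.one_le_norm (weakNorm_eq_one (he := he) (hm := hm) (hm1 := hm1) hw)
  have ha := amp_pos_of_maximizer hw hφ
  have hasq := amp_sq (e := e) (m := m) (he := he) (hm := hm) (hm1 := hm1) (φ := φ) (by linarith)
  rw [sub_eq_sub_strongSq hw hφ]
  -- The equation is tested with the negative part itself. The multiplier term and the quartic term
  -- quadratic in `φ` have favourable signs, so `‖φ‖²` is controlled by the mixed term `coulombForm
  -- ψ ψ w φ` alone.
  have hEL := fderiv_functional_apply_minus hw hφ hg φ.2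
  rw [fderiv_functional_apply, weakInner_self, projMinus_state hw.1, projMinus_of_mem φ.2,
    (mem_Xminus_iff _).1 φ.2, inner_zero_right, Complex.zero_re] at hEL
  have h1 : (inner ℂ (φ : Hhalf) (φ : Hhalf)).re = ‖φ‖ ^ 2 :=
    (norm_sq_eq_re_inner (𝕜 := ℂ) (φ : Hhalf)).symm
  rw [h1] at hEL
  have hkap : 0 ≤ m * (e ^ 2 / 2) := by positivity
  obtain ⟨ψ, hψ⟩ : ∃ ψ, ψ = (setting e m he hm hm1).state w φ := ⟨_, rfl⟩
  have hsplit : coulombForm ψ ψ ψ (φ : Hhalf) =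
      (setting e m he hm hm1).amp φ * coulombForm ψ ψ w φ + coulombForm ψ ψ φ φ := by
    have hst : ψ = (setting e m he hm hm1).amp φ • w + (φ : Hhalf) := hψ
    have : coulombQuartic ψ ψ ((setting e m he hm hm1).amp φ • w + (φ : Hhalf)) φ =
        (setting e m he hm hm1).amp φ * coulombQuartic ψ ψ w φ + coulombQuartic ψ ψ φ φ := by
      simp only [map_add, map_smul, add_apply, smul_apply, smul_eq_mul]
    rw [← hst] at this
    exact this
  have hpos := coulombForm_nonneg ψ (φ : Hhalf)
  have hbd := abs_coulombForm_le_kinetic ψ ψ w (φ : Hhalf)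
  have hkin : kinetic ψ ≤ kinetic w + ‖φ‖ ^ 2 := by
    rw [← kinetic_projPlus_add ψ, hψ, projPlus_state hw.1, projMinus_state hw.1]
    have e1 : (((setting e m he hm hm1).amp φ : ℝ) : ℂ) • w =
        (setting e m he hm hm1).amp φ • w := rfl
    rw [e1, kinetic_smul, hasq]
    have := kinetic_le (φ : Hhalf)
    have h2 : ‖(φ : Hhalf)‖ = ‖φ‖ := rfl
    rw [h2] at this
    nlinarith [kinetic_nonneg w, mul_nonneg (sq_nonneg ‖toL2 (φ : Hhalf)‖) (kinetic_nonneg w)]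
  have hnb : ‖toL2 (φ : Hhalf)‖ ≤ ‖φ‖ := norm_toL2_le (φ : Hhalf)
  have hw1 : ‖toL2 w‖ = 1 := weakNorm_eq_one (he := he) (hm := hm) (hm1 := hm1) hw
  have hss : (setting e m he hm hm1).size = m * (e ^ 2 / 2) * gammaK := rfl
  have hs0 := (setting e m he hm hm1).size_nonneg
  have hs1 := (setting e m he hm hm1).size_lt
  have hq : (setting e m he hm hm1).strongSq w φ =
      ‖φ‖ ^ 2 + ‖w‖ ^ 2 * ‖toL2 (φ : Hhalf)‖ ^ 2 := by
    rw [QuarticSetting.strongSq, setting_weakE_self]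
  have hkinw := fun t ht => kinetic_le_of_pos w (t := t) ht
  rw [mul_assoc gammaK, Real.mul_self_sqrt (kinetic_nonneg ψ), hw1, one_mul] at hbd
  rw [← hψ, hsplit] at hEL
  rw [hw1] at hkinw
  obtain ⟨b, hb⟩ : ∃ b, b = ‖φ‖ := ⟨_, rfl⟩
  obtain ⟨n, hne⟩ : ∃ n, n = ‖toL2 (φ : Hhalf)‖ := ⟨_, rfl⟩
  have hb0 : 0 ≤ b := hb ▸ norm_nonneg _
  have hn0 : 0 ≤ n := hne ▸ norm_nonneg _
  obtain ⟨N, hN⟩ : ∃ N, N = kinetic w := ⟨_, rfl⟩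
  have hN0 : 0 ≤ N := hN ▸ kinetic_nonneg w
  rw [← hN] at hkin hkinw
  rw [← hb] at hEL hkin hnb hq
  rw [← hne] at hEL hbd hnb hq hn hn2 hasq
  generalize (setting e m he hm hm1).amp φ = a at *
  generalize multiplier (setting e m he hm hm1) w φ = μ at *
  generalize (setting e m he hm hm1).strongSq w φ = q at *
  generalize (setting e m he hm hm1).size = s at *
  generalize coulombForm ψ ψ w φ = t1 at *
  generalize coulombForm ψ ψ φ φ = t2 at *
  generalize kinetic ψ = K at *
  have ha1 : a ≤ 1 := by nlinarith
  have hmain : b ^ 2 ≤ 8 * s * (N + b ^ 2) * n := by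
    have hat : -(a * t1) ≤ 4 * (gammaK * K * n) := by
      have h3 : -t1 ≤ |t1| := neg_le_abs t1
      have h4 : a * (-t1) ≤ a * |t1| := mul_le_mul_of_nonneg_left h3 ha.le
      have h5 : a * |t1| ≤ |t1| := mul_le_of_le_one_left (abs_nonneg _) ha1
      linarith
    have h3 : 4 * (gammaK * K * n) ≤ 4 * (gammaK * (N + b ^ 2) * n) := by
      have := gammaK_pos
      gcongr
    have h4 := mul_le_mul_of_nonneg_left (hat.trans h3) hkap
    have h5 : 0 ≤ m * (e ^ 2 / 2) * t2 := mul_nonneg hkap hpos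
    have h6 : 0 ≤ μ * n ^ 2 := mul_nonneg hμ.le (sq_nonneg n)
    rw [hss]
    linarith
  rw [hq]
  rw [hq] at hφ
  exact one_le_sub_of_bootstrap hb0 hn0 hnb hn hs1 hW hN0 hmain hkinw hφ

end Maximizer

/-! ### The maximizer -/

section MaximizerMap

variable (e m : ℝ) (he : e ^ 2 * gammaK < 1 / 87) (hm : 0 < m) (hm1 : m ≤ 1)

open Classical in
/-- The negative part of the maximizer over the positive direction `w`. -/
def negativePart (w : Hhalf) : Xminus :=
  -- The value off the unit sphere is a mere default. On the sphere the choice is immaterial, since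
  -- the critical point in the region is unique.
  if hw : (setting e m he hm hm1).weakNorm w = 1 then
    (QuarticSetting.exists_maximizer (S := setting e m he hm hm1) hw).choose else 0

lemma negativePart_spec (w : Hhalf) (hw : (setting e m he hm hm1).weakNorm w = 1) :
    (setting e m he hm hm1).strongSq w (negativePart e m he hm hm1 w) ≤
        (setting e m he hm hm1).size * ‖w‖ ^ 2 ∧
      (setting e m he hm hm1).grad w (negativePart e m he hm hm1 w) = 0 := by
  rw [negativePart, dif_pos hw]
  exact (QuarticSetting.exists_maximizer (S := setting e m he hm hm1) hw).choose_spec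

/-- The maximizer over the positive direction `w`. -/
def maximizer (w : Hhalf) : Hhalf :=
  (setting e m he hm hm1).state w (negativePart e m he hm hm1 w)

variable {e m he hm hm1} {w : Hhalf}

lemma norm_sq_toL2_negativePart_le (hw : w ∈ unitSpherePlus) :
    ‖toL2 (negativePart e m he hm hm1 w : Hhalf)‖ ^ 2 ≤ 1 / 169 :=
  norm_sq_toL2_le_of_maximizer hw (negativePart_spec e m he hm hm1 w (weakNorm_eq_one hw)).1

lemma projMinus_maximizer (hw : w ∈ unitSpherePlus) :
    projMinus (maximizer e m he hm hm1 w) = (negativePart e m he hm hm1 w : Hhalf) :=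
  projMinus_state hw.1

lemma projPlus_maximizer (hw : w ∈ unitSpherePlus) : projPlus (maximizer e m he hm hm1 w) =
    ((√(1 - ‖toL2 (projMinus (maximizer e m he hm hm1 w))‖ ^ 2) : ℝ) : ℂ) • w := by
  rw [projMinus_maximizer hw, ← setting_amp (e := e) (m := m) (he := he) (hm := hm) (hm1 := hm1)]
  exact projPlus_state hw.1

lemma maximizer_mem_constraint (hw : w ∈ unitSpherePlus) :
    maximizer e m he hm hm1 w ∈ constraint (Submodule.span ℂ {w}) := by
  refine ⟨norm_sq_toL2_state hw ?_, ?_⟩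
  · exact (norm_sq_toL2_negativePart_le hw).trans (by norm_num)
  · rw [projPlus_maximizer hw]
    exact Submodule.smul_mem _ _ (Submodule.mem_span_singleton_self w)

lemma functional_maximizer (hw : w ∈ unitSpherePlus) :
    functional e m (maximizer e m he hm hm1 w) =
    (setting e m he hm hm1).energy w (negativePart e m he hm hm1 w) :=
  functional_state hw.1 ((norm_sq_toL2_negativePart_le hw).trans (by norm_num))

lemma functional_lt_functional_maximizer (hw : w ∈ unitSpherePlus) {χ : Hhalf}
    (hχ : χ ∈ constraint (Submodule.span ℂ {w}))
    (hne : ∀ c : ℂ, ‖c‖ = 1 → χ ≠ c • maximizer e m he hm hm1 w) :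
    functional e m χ < functional e m (maximizer e m he hm hm1 w) := by
  obtain ⟨c, η, hc, hη, rfl⟩ :=
    exists_eq_smul_state (e := e) (m := m) (he := he) (hm := hm) (hm1 := hm1) hw hχ
  have hW := weakNorm_eq_one (e := e) (m := m) (he := he) (hm := hm) (hm1 := hm1) hw
  obtain ⟨h1, h2⟩ := negativePart_spec e m he hm hm1 w hW
  rw [functional_smul e m hc, functional_state hw.1 hη, functional_maximizer hw]
  refine QuarticSetting.energy_lt_of_grad_eq_zero hW (QuarticSetting.mem_region_of_le h1) h2 ?_
  rintro rfl
  exact hne c hc rfl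

lemma isMaxOn_maximizer (hw : w ∈ unitSpherePlus) :
    IsMaxOn (functional e m) (constraint (Submodule.span ℂ {w})) (maximizer e m he hm hm1 w) := by
  intro χ hχ
  by_cases h : ∃ c : ℂ, ‖c‖ = 1 ∧ χ = c • maximizer e m he hm hm1 w
  · obtain ⟨c, hc, rfl⟩ := h
    exact (functional_smul e m hc _).le
  · push Not at h
    exact (functional_lt_functional_maximizer hw hχ h).le

lemma functional_maximizer_eq_maxLevel (hw : w ∈ unitSpherePlus) :
    functional e m (maximizer e m he hm hm1 w) =
    maxLevel e m (Submodule.span ℂ {w}) := by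
  refine (IsGreatest.csSup_eq ⟨mem_image_of_mem _ (maximizer_mem_constraint hw), ?_⟩).symm
  rintro _ ⟨χ, hχ, rfl⟩
  exact isMaxOn_maximizer hw hχ

lemma norm_sq_toL2_projMinus_lt (hw : w ∈ unitSpherePlus) :
    ‖toL2 (projMinus (maximizer e m he hm hm1 w))‖ ^ 2 <
    ‖toL2 (projPlus (maximizer e m he hm hm1 w))‖ ^ 2 := by
  have h1 := norm_sq_toL2_projPlus_add (maximizer e m he hm hm1 w)
  have h2 : ‖toL2 (maximizer e m he hm hm1 w)‖ ^ 2 = 1 := (maximizer_mem_constraint hw).1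
  have h3 := norm_sq_toL2_negativePart_le (e := e) (m := m) (he := he) (hm := hm) (hm1 := hm1) hw
  rw [← projMinus_maximizer hw] at h3
  linarith

lemma norm_sq_projMinus_maximizer_le (hw : w ∈ unitSpherePlus) :
    ‖projMinus (maximizer e m he hm hm1 w)‖ ^ 2 ≤
    m * (e ^ 2 / 2) * gammaK * ‖w‖ ^ 2 := by
  have h1 := (setting e m he hm hm1).norm_sq_le_strongSq w (negativePart e m he hm hm1 w)
  have h2 := (negativePart_spec e m he hm hm1 w (weakNorm_eq_one hw)).1
  rw [projMinus_maximizer hw]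
  exact h1.trans h2

lemma exists_multiplier (hw : w ∈ unitSpherePlus) : ∃ μ : ℝ,
    (∀ h ∈ Submodule.span ℂ {w} ⊔ Xminus,
      fderiv ℝ (functional e m) (maximizer e m he hm hm1 w) h
        - 2 * μ * (inner ℂ (toL2 (maximizer e m he hm hm1 w)) (toL2 h)).re = 0) ∧
    0 < μ ∧ μ ≤ maxLevel e m (Submodule.span ℂ {w}) := by
  obtain ⟨h1, h2⟩ := negativePart_spec e m he hm hm1 w (weakNorm_eq_one hw)
  refine ⟨multiplier (setting e m he hm hm1) w (negativePart e m he hm hm1 w), fun h hh => ?_,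
    multiplier_pos hw h1 h2, ?_⟩
  · exact sub_eq_zero.2 (euler_lagrange hw h1 h2 hh)
  · rw [← functional_maximizer_eq_maxLevel (he := he) (hm := hm) (hm1 := hm1) hw,
      multiplier_eq hw h1 h2]
    exact sub_le_self _ (mul_nonneg (by positivity) (coulombForm_nonneg _ _))

lemma norm_toL2_normalize {v : Hhalf} (hv : v ≠ 0) : ‖toL2 (normalize v)‖ = 1 := by
  have h : ‖toL2 v‖ ≠ 0 := norm_ne_zero_iff.2 fun h0 => hv (toL2_injective (h0.trans
    (map_zero toL2).symm))
  rw [normalize, map_smul, norm_smul, Complex.norm_real, norm_inv, norm_norm, inv_mul_cancel₀ h]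

lemma contDiffAt_normalize {v : Hhalf} (hv : v ≠ 0) : ContDiffAt ℝ ∞ normalize v := by
  have h : ‖toL2 v‖ ≠ 0 := norm_ne_zero_iff.2 fun h0 => hv (toL2_injective (h0.trans
    (map_zero toL2).symm))
  have h1 : ContDiffAt ℝ ∞ (fun u : Hhalf => ‖toL2 u‖) v := by
    have h2 : (fun u : Hhalf => ‖toL2 u‖) = fun u => √(weakInner u u) := by
      funext u
      rw [weakInner_self, Real.sqrt_sq (norm_nonneg _)]
    rw [h2]
    refine ContDiffAt.sqrt ?_ ?_
    · exact (weakInner.contDiff.clm_apply contDiff_id).contDiffAt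
    · rw [weakInner_self]
      positivity
  exact (h1.inv h).smul contDiffAt_id

variable (e m he hm hm1) in
-- Nonzero vectors near `v` are normalized onto the unit sphere, where the chosen negative part
-- agrees with the smooth implicit solution. The abstract problem never asks that `w` lie in X₊, so
-- smoothness holds on all of `H^{1/2}` minus the origin and is restricted to X₊ only at the end.
lemma contDiffAt_maximizer_normalize {v : Hhalf} (hv : v ≠ 0) :
    ContDiffAt ℝ ∞ (fun u => maximizer e m he hm hm1 (normalize u)) v := by
  have hw := norm_toL2_normalize hv
  obtain ⟨Φ, hΦ, hev⟩ := QuarticSetting.exists_contDiffAt_maximizer (S := setting e m he hm hm1) hw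
    (negativePart_spec e m he hm hm1)
  have hn := contDiffAt_normalize hv
  have hΦv : Φ (normalize v) = negativePart e m he hm hm1 (normalize v) := hev.self_of_nhds hw
  have hlt : (setting e m he hm hm1).weakE (Φ (normalize v)) (Φ (normalize v)) < 1 := by
    rw [hΦv]
    exact QuarticSetting.weakE_lt_one_of_mem_region hw
      (QuarticSetting.mem_region_of_le (negativePart_spec e m he hm hm1 _ hw).1)
  have hst := QuarticSetting.contDiffAt_state (S := setting e m he hm hm1)
    (u := (normalize v, Φ (normalize v))) hlt
  have hpair : ContDiffAt ℝ ∞ (fun u => (normalize u, Φ (normalize u))) v :=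
    hn.prodMk (ContDiffAt.comp v hΦ hn)
  refine (ContDiffAt.comp v hst hpair).congr_of_eventuallyEq ?_
  filter_upwards [hn.continuousAt.eventually hev, isOpen_ne.mem_nhds hv] with u h1 h2
  simp only [Function.comp, maximizer]
  rw [h1 (norm_toL2_normalize h2)]

end MaximizerMap

end

end MaxwellDirac

open MaxwellDirac
theorem mainTheorem3 (e : ℝ) (he : e ^ 2 * gammaK < 1 / 87)
    (m : ℝ) (hm : 0 < m) (hm1 : m ≤ 1) :
    ∃ Ψ : Hhalf → Hhalf,
      (∀ w ∈ unitSpherePlus,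
        -- `Ψ w` is a global maximizer on `X_W`, `W = span {w}`, and it is strict up to a phase
        Ψ w ∈ constraint (Submodule.span ℂ {w}) ∧
        IsMaxOn (functional e m) (constraint (Submodule.span ℂ {w})) (Ψ w) ∧
        functional e m (Ψ w) = maxLevel e m (Submodule.span ℂ {w}) ∧
        (∀ φ ∈ constraint (Submodule.span ℂ {w}),
          (∀ c : ℂ, ‖c‖ = 1 → φ ≠ c • Ψ w) → functional e m φ < functional e m (Ψ w)) ∧
        -- the choice of the phase: `ψ₊ = (1 - ‖ψ₋‖²)^{1/2} w`
        projPlus (Ψ w) = ((√(1 - ‖toL2 (projMinus (Ψ w))‖ ^ 2) : ℝ) : ℂ) • w ∧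
        -- the Euler-Lagrange equation and the bounds on the multiplier
        DifferentiableAt ℝ (functional e m) (Ψ w) ∧
        (∃ μ : ℝ,
          (∀ h ∈ Submodule.span ℂ {w} ⊔ Xminus,
            fderiv ℝ (functional e m) (Ψ w) h
              - 2 * μ * (inner ℂ (toL2 (Ψ w)) (toL2 h)).re = 0) ∧
          0 < μ ∧ μ ≤ maxLevel e m (Submodule.span ℂ {w})) ∧
        ‖toL2 (projMinus (Ψ w))‖ ^ 2 < ‖toL2 (projPlus (Ψ w))‖ ^ 2 ∧
        1 ≤ ‖projPlus (Ψ w)‖ ^ 2 - ‖projMinus (Ψ w)‖ ^ 2 ∧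
        ‖projMinus (Ψ w)‖ ^ 2 ≤ m * (e ^ 2 / 2) * gammaK * ‖w‖ ^ 2) ∧
      ContDiffOn ℝ ∞ (fun v : Xplus => Ψ (normalize (v : Hhalf))) {v | v ≠ 0} := by
  refine ⟨maximizer e m he hm hm1, fun w hw => ?_, fun v hv => ?_⟩
  · obtain ⟨h1, h2⟩ := negativePart_spec e m he hm hm1 w (weakNorm_eq_one hw)
    exact ⟨maximizer_mem_constraint hw, isMaxOn_maximizer hw, functional_maximizer_eq_maxLevel hw,
      fun φ hφ hne => functional_lt_functional_maximizer hw hφ hne, projPlus_maximizer hw,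
      ((contDiff_functional e m).differentiable (by simp)).differentiableAt, exists_multiplier hw,
      norm_sq_toL2_projMinus_lt hw, one_le_norm_sq_sub hw h1 h2, norm_sq_projMinus_maximizer_le hw⟩
  · have hv0 : (v : Hhalf) ≠ 0 := fun h => hv (Subtype.ext h)
    exact (ContDiffAt.comp v (contDiffAt_maximizer_normalize e m he hm hm1 hv0)
      (Xplus.subtypeL.restrictScalars ℝ).contDiff.contDiffAt).contDiffWithinAt
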